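/- \textbf{Setting.} Let $S$ be a compact connected surface without boundary, orientable or not, of Euler genus $g$; let $T$ be a set of $t$ points of $S$ (terminals) and $R$ a set of unordered pairs of elements of $T$. Let $K$ be a cut graph of $S$ (an embedded graph whose unique face is an open disk) that has at least one edge, has $O(g+t)$ edges, and has all the terminals among its vertices. Cutting $S$ along $K$ gives a disk $D$; the copies of the vertices and edges of $K$ on $\partial D$ are the corners and the sides of $D$, and gluing the sides in pairs gives back $S$. Let $C$ be a graph (loops and multiple edges allowed) embedded on $S$ in general position with respect to $K$: $C$ and $K$ meet in finitely many points, each of which is a crossing of an edge of $C$ with an edge of $K$. Let $\bar C$ be the graph in $D$ formed by the pieces of the edges of $C$. The graph $C$ is \emph{good} if $\bar C$ is a disjoint union of trees, each with at least one vertex of degree at least two and with all its leaves on $\partial D$, and of arcs (single edges whose two endpoints lie on different sides of $D$), and if moreover $C$ has $O(g+t)$ intersection points with each side of $D$ and the trees have $O(g+t)$ edges in total. The graph $C$ is a \emph{multicut dual} if for every $\{t_1,t_2\}\in R$ the terminals $t_1$ and $t_2$ lie in different faces of $C$ (components of $S\setminus C$). The \emph{topology} of a good graph $C$ is the combinatorial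 map of the connected plane graph in $D$ formed by $\partial D$ and $\bar C$, with the outer face distinguished and divided into the sides of $D$ (which are paired as in $K$), up to renaming. A topology is \emph{valid} if it is the topology of a good graph that is a multicut dual. \textbf{Proposition.} Fix the constants in the three bounds $O(g+t)$ above. Then there are a constant $A$ and an algorithm, both depending only on these constants, such that the following holds whenever $g+t\ge 2$. The number of valid topologies is finite and at most $(g+t)^{A(g+t)}$. Moreover, given $g$, the terminals, the pairs $R$, and $K$ (as the gluing of the sides of $D$), the algorithm outputs, in at most $(g+t)^{A(g+t)}$ steps, a list that contains each valid topology exactly once and nothing else. -/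

import Mathlib

namespace Multicut

/-! ## Programs with a step count

The machine model is a pointer machine on binary trees (nested pairs): a program works on
immutable cells, and one step builds a cell, follows one pointer of a cell, tests whether a value is
`nil`, or passes control. Each step allocates at most one cell. -/

/-- The values handled by programs: binary trees. -/
inductive Data : Type
  | nil : Data
  | cons : Data → Data → Data

/-- Programs. `comp q p` runs `p`, then `q`; `ite c p q` runs `p` if `c` returns something else than
`nil`, and `q` otherwise; `loop c p` is `while c(x) ≠ nil do x := p(x)`. -/
inductive Prog : Type
  | id : Prog
  | nil : Prog
  | hd : Prog
  | tl : Prog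
  | cons : Prog → Prog → Prog
  | comp : Prog → Prog → Prog
  | ite : Prog → Prog → Prog → Prog
  | loop : Prog → Prog → Prog

/-- `Run p x y n`: the program `p`, started on `x`, halts with the result `y` after `n` steps. -/
inductive Run : Prog → Data → Data → ℕ → Prop
  | id (x : Data) : Run Prog.id x x 1
  | nil (x : Data) : Run Prog.nil x Data.nil 1
  | hd_nil : Run Prog.hd Data.nil Data.nil 1
  | hd_cons (a b : Data) : Run Prog.hd (Data.cons a b) a 1
  | tl_nil : Run Prog.tl Data.nil Data.nil 1
  | tl_cons (a b : Data) : Run Prog.tl (Data.cons a b) b 1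
  | cons {p q : Prog} {x a b : Data} {m n : ℕ} :
      Run p x a m → Run q x b n → Run (Prog.cons p q) x (Data.cons a b) (m + n + 1)
  | comp {p q : Prog} {x y z : Data} {m n : ℕ} :
      Run p x y m → Run q y z n → Run (Prog.comp q p) x z (m + n + 1)
  | ite_then {c p q : Prog} {x a b y : Data} {k n : ℕ} :
      Run c x (Data.cons a b) k → Run p x y n → Run (Prog.ite c p q) x y (k + n + 1)
  | ite_else {c p q : Prog} {x y : Data} {k n : ℕ} :
      Run c x Data.nil k → Run q x y n → Run (Prog.ite c p q) x y (k + n + 1)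
  | loop_stop {c p : Prog} {x : Data} {k : ℕ} :
      Run c x Data.nil k → Run (Prog.loop c p) x x (k + 1)
  | loop_step {c p : Prog} {x a b y z : Data} {k m n : ℕ} :
      Run c x (Data.cons a b) k → Run p x y m → Run (Prog.loop c p) y z n →
        Run (Prog.loop c p) x z (k + m + n + 1)

/-- A finite sequence of values. -/
def Data.ofList : List Data → Data
  | [] => Data.nil
  | a :: l => Data.cons a (Data.ofList l)

/-- Natural numbers are written in unary. -/
def Data.ofNat (n : ℕ) : Data := Data.ofList (List.replicate n Data.nil)

/-- Booleans, with `false` written as `nil`. -/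
def Data.ofBool : Bool → Data
  | false => Data.nil
  | true => Data.cons Data.nil Data.nil

/-- The table of a function on `Fin n`. -/
def Data.ofFun {n : ℕ} (f : Fin n → Data) : Data := Data.ofList (List.ofFn f)

/-! ## Cut graphs -/

/-- A cut graph `K` of a compact connected surface `S` without boundary, orientable or not, given
by the disk `D` obtained from `S` by cutting along `K`, together with the gluing that gives back `S`.
`D` is a polygon with `2 * edges` sides, numbered counterclockwise (`D` lies to the left); corner `i`
is the starting point of side `i`. Side `i` is glued with side `mate i`: with opposite directions if
`twist i = false` (the pattern `a … a⁻¹`), with equal directions if `twist i = true` (the pattern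
`a … a`). -/
structure Gluing where
  /-- The number of edges of `K`. -/
  edges : ℕ
  edges_pos : 0 < edges
  mate : Fin (2 * edges) → Fin (2 * edges)
  mate_mate : ∀ i, mate (mate i) = i
  mate_ne : ∀ i, mate i ≠ i
  twist : Fin (2 * edges) → Bool
  twist_mate : ∀ i, twist (mate i) = twist i

namespace Gluing

variable (K : Gluing)

/-- The end of side `i`, which is the start of the following side. -/
def sideEnd (i : Fin (2 * K.edges)) : Fin (2 * K.edges) := finRotate (2 * K.edges) i

/-- The gluing of side `i` with side `mate i` identifies the corners `a` and `b`. -/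
def GluesCorners (a b : Fin (2 * K.edges)) : Prop :=
  ∃ i, (a = i ∧ b = if K.twist i then K.mate i else K.sideEnd (K.mate i)) ∨
    (a = K.sideEnd i ∧ b = if K.twist i then K.sideEnd (K.mate i) else K.mate i)

/-- The vertices of `K` are the classes of corners under the gluing. -/
def vertexSetoid : Setoid (Fin (2 * K.edges)) := Relation.EqvGen.setoid K.GluesCorners

/-- The vertices of `K`. -/
def Vertex : Type := Quotient K.vertexSetoid

/-- The vertex of `K` of which corner `i` is a copy. -/
def vertexAt (i : Fin (2 * K.edges)) : K.Vertex := Quotient.mk K.vertexSetoid i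

/-- The surface `S` has Euler genus `g`: Euler's formula `v - e + f = 2 - g` for `K`, which has
a single face. -/
def HasEulerGenus (g : ℕ) : Prop := Nat.card K.Vertex + g = K.edges + 1

end Gluing

/-- A surface with a cut graph `K` passing through all the terminals, and the terminal pairs. -/
structure Instance where
  K : Gluing
  /-- The Euler genus of the surface. -/
  g : ℕ
  hasEulerGenus : K.HasEulerGenus g
  /-- The number of terminals. -/
  t : ℕ
  /-- The terminals are distinct vertices of `K`, each one given by one of its copies. -/
  terminal : Fin t → Fin (2 * K.edges)
  terminal_inj : Function.Injective fun a => K.vertexAt (terminal a)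
  /-- The set `R` of terminal pairs. -/
  pairs : Finset (Sym2 (Fin t))

/-- The description of an instance that is given to an algorithm. -/
def Instance.encode (I : Instance) : Data :=
  Data.ofList
    [Data.ofNat I.g,
     Data.ofFun fun i => Data.ofNat (I.K.mate i),
     Data.ofFun fun i => Data.ofBool (I.K.twist i),
     Data.ofFun fun a => Data.ofNat (I.terminal a),
     Data.ofFun fun a => Data.ofFun fun b => Data.ofBool (decide (s(a, b) ∈ I.pairs))]

/-! ## Topologies -/

/-- The number of cycles of a permutation, fixed points included. -/
noncomputable def numCycles {d : ℕ} (f : Equiv.Perm (Fin d)) : ℕ :=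
  Nat.card (Quotient (Equiv.Perm.SameCycle.setoid f))

/-- A topology on a polygon with `N` sides: the combinatorial map of a connected planar graph `U`
whose outer face is distinguished and is bounded by a cycle that is divided into the sides
`0, …, N - 1`, in counterclockwise order.

A dart is an edge of `U` with a direction; `rev x` is the reverse of `x`, and `next x` is the dart
that follows `x` in counterclockwise order around the vertex from which `x` leaves. Hence the vertices
are the cycles of `next`, the edges are the cycles of `rev`, and the faces are the cycles of
`next⁻¹ * rev`, which maps `x` to the dart that follows it along the face to its left. Likewise
`next * rev` maps `x` to the dart that follows it along the face to its right.

Side `i` starts with the dart `corner i`, contains `cross i` vertices besides its two ends, and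
has the outer face to its right. -/
structure Topology (N : ℕ) where
  darts : ℕ
  next : Equiv.Perm (Fin darts)
  rev : Equiv.Perm (Fin darts)
  rev_rev : ∀ x, rev (rev x) = x
  rev_ne : ∀ x, rev x ≠ x
  connected : ∀ x y, Relation.EqvGen (fun a b => b = next a ∨ b = rev a) x y
  planar : numCycles next + numCycles (next⁻¹ * rev) = numCycles rev + 2
  corner : Fin N → Fin darts
  cross : Fin N → ℕ
  side_end : ∀ i, ((next * rev) ^ (cross i + 1)) (corner i) = corner (finRotate N i)
  outer_simple : ∀ i i' j j', j ≤ cross i → j' ≤ cross i' →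
    next.SameCycle (((next * rev) ^ j) (corner i)) (((next * rev) ^ j') (corner i')) →
      i = i' ∧ j = j'

namespace Topology

variable {N : ℕ} (U : Topology N)

/-- The description of a topology that is returned by an algorithm. -/
def encode : Data :=
  Data.ofList
    [Data.ofFun fun x => Data.ofNat (U.next x),
     Data.ofFun fun x => Data.ofNat (U.rev x),
     Data.ofFun fun i => Data.ofNat (U.corner i),
     Data.ofFun fun i => Data.ofNat (U.cross i)]

/-- Two topologies are the same if they differ by a renaming of the darts. -/
def Same (U V : Topology N) : Prop :=
  ∃ e : Fin U.darts ≃ Fin V.darts,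
    (∀ x, e (U.next x) = V.next (e x)) ∧ (∀ x, e (U.rev x) = V.rev (e x)) ∧
      (∀ i, e (U.corner i) = V.corner i) ∧ ∀ i, U.cross i = V.cross i

/-- Topologies up to a renaming of the darts. -/
def setoid (N : ℕ) : Setoid (Topology N) where
  r := Same
  iseqv :=
    { refl := fun _ => ⟨Equiv.refl _, fun _ => rfl, fun _ => rfl, fun _ => rfl, fun _ => rfl⟩
      symm := by
        rintro U V ⟨e, h1, h2, h3, h4⟩
        refine ⟨e.symm, fun x => ?_, fun x => ?_, fun i => ?_, fun i => (h4 i).symm⟩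
        · rw [Equiv.symm_apply_eq, h1, Equiv.apply_symm_apply]
        · rw [Equiv.symm_apply_eq, h2, Equiv.apply_symm_apply]
        · rw [Equiv.symm_apply_eq, h3]
      trans := by
        rintro U V W ⟨e, h1, h2, h3, h4⟩ ⟨f, k1, k2, k3, k4⟩
        refine ⟨e.trans f, fun x => ?_, fun x => ?_, fun i => ?_, fun i => (h4 i).trans (k4 i)⟩
        · simp [h1, k1]
        · simp [h2, k2]
        · simp [h3, k3] }

/-- The dart at position `j` on side `i`, for `0 ≤ j ≤ cross i`. It leaves from corner `i` if `j = 0`,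
and from the `j`-th crossing point of side `i` otherwise. -/
def piece (i : Fin N) (j : ℕ) : Fin U.darts := ((U.next * U.rev) ^ j) (U.corner i)

/-- The degree of the vertex from which the dart `x` leaves. -/
noncomputable def degree (x : Fin U.darts) : ℕ := Function.minimalPeriod U.next x

/-- The dart `x` belongs to an edge on the outer cycle (a piece of `K`). -/
def IsOuter (x : Fin U.darts) : Prop :=
  ∃ i j, j ≤ U.cross i ∧ (x = U.piece i j ∨ U.rev x = U.piece i j)

/-- The darts of the interior edges (the pieces of `C`). -/
def interior : Set (Fin U.darts) := {x | ¬ U.IsOuter x}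

/-- The dart `x` leaves from a vertex on side `i`. -/
def OnSide (i : Fin N) (x : Fin U.darts) : Prop :=
  ∃ j, j ≤ U.cross i ∧ U.next.SameCycle (U.piece i j) x

/-- The dart `x` leaves from a vertex on the boundary of the polygon. -/
def OnBoundary (x : Fin U.darts) : Prop := ∃ i, U.OnSide i x

/-- The vertices from which `x` and `y` leave are connected by edges with darts in `A`. -/
def Connects (A : Set (Fin U.darts)) : Fin U.darts → Fin U.darts → Prop :=
  Relation.EqvGen fun x y => U.next.SameCycle x y ∨ (x ∈ A ∧ y = U.rev x)

/-- The edge of `x` is an interior edge with an endpoint off the boundary (an edge of a tree). -/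
def IsTreeDart (x : Fin U.darts) : Prop :=
  x ∈ U.interior ∧ ¬ (U.OnBoundary x ∧ U.OnBoundary (U.rev x))

variable {K : Gluing} (U : Topology (2 * K.edges))

/-- The graph `C` formed by the interior edges is drawn in general position with respect to `K`
on the surface: crossing points correspond under the gluing, `C` avoids the vertices of `K`, and
a crossing point meets one piece of `C` on each of its two copies. -/
structure GeneralPosition : Prop where
  cross_mate : ∀ i, U.cross (K.mate i) = U.cross i
  degree_corner : ∀ i, U.degree (U.corner i) = 2
  degree_crossing : ∀ i j, 1 ≤ j → j ≤ U.cross i → U.degree (U.piece i j) = 3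

/-- The position, on side `mate i`, of the piece that is glued with piece `j` of side `i`. -/
def glue (i : Fin (2 * K.edges)) (j : ℕ) : ℕ := if K.twist i then j else U.cross i - j

/-- The position, on side `mate i`, of the crossing point that is glued with the `j`-th
crossing point of side `i`, for `1 ≤ j ≤ cross i`. -/
def gluePoint (i : Fin (2 * K.edges)) (j : ℕ) : ℕ := if K.twist i then j else U.cross i + 1 - j

/-- The points of `C` from which `x` and `y` leave are connected within `C` on the surface: one may
also go through crossing points. -/
def ConnectsInSurface : Fin U.darts → Fin U.darts → Prop :=
  Relation.EqvGen fun x y => U.next.SameCycle x y ∨ (x ∈ U.interior ∧ y = U.rev x) ∨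
    ∃ i j, 1 ≤ j ∧ j ≤ U.cross i ∧ x = U.piece i j ∧ y = U.piece (K.mate i) (U.gluePoint i j)

/-- After the gluing, the interior edges form a graph `C`: there is no closed curve without a vertex.
The vertices of `C` are the vertices of `U` off the boundary. -/
def FormsGraph : Prop :=
  ∀ x ∈ U.interior, ∃ y, ¬ U.OnBoundary y ∧ U.ConnectsInSurface x y

/-- `U` is the overlay, in the polygon, of `K` and a graph `C` in general position. -/
structure IsOverlay : Prop where
  generalPosition : U.GeneralPosition
  formsGraph : U.FormsGraph

/-- `C` is good, with `p` and `q` as the bounds on the crossings with each side and on the number of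
edges of the trees. The first three fields say that the pieces of `C` form a disjoint union of
trees that have a vertex of degree at least two and all their leaves on the boundary, and of arcs, which
connect different sides. -/
structure IsGood (p q : ℕ) : Prop where
  /-- There is no cycle: every interior edge is a bridge. -/
  forest : ∀ x ∈ U.interior, ¬ U.Connects (U.interior \ {x, U.rev x}) x (U.rev x)
  leaves : ∀ x, U.degree x = 1 → U.OnBoundary x
  arcs : ∀ x ∈ U.interior, ∀ i i', U.OnSide i x → U.OnSide i' (U.rev x) → i ≠ i'
  cross_le : ∀ i, U.cross i ≤ p
  /-- Every edge has two darts. -/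
  tree_le : Nat.card {x // U.IsTreeDart x} ≤ 2 * q

/-- The faces of `U` to the left of `x` and `y` lie in the same face of `C` on the surface: one can go
from one to the other by crossing pieces of `K`. -/
def SameFace : Fin U.darts → Fin U.darts → Prop :=
  Relation.EqvGen fun x y => (U.next⁻¹ * U.rev).SameCycle x y ∨
    ∃ i j, j ≤ U.cross i ∧ x = U.piece i j ∧ y = U.piece (K.mate i) (U.glue i j)

end Topology

namespace Instance

variable (I : Instance)

/-- `C` is a multicut dual: the two terminals of each pair lie in different faces of `C`. -/
def IsMulticutDual (U : Topology (2 * I.K.edges)) : Prop :=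
  ∀ a b, s(a, b) ∈ I.pairs → ¬ U.SameFace (U.corner (I.terminal a)) (U.corner (I.terminal b))

/-- `U` is the topology of a good graph that is a multicut dual. -/
structure IsValid (a b : ℕ) (U : Topology (2 * I.K.edges)) : Prop where
  isOverlay : U.IsOverlay
  isGood : U.IsGood (a * (I.g + I.t)) (b * (I.g + I.t))
  isMulticutDual : I.IsMulticutDual U

/-- The set of valid topologies, up to a renaming of the darts. -/
def validTopologies (a b : ℕ) : Set (Quotient (Topology.setoid (2 * I.K.edges))) :=
  {Q | ∃ U, I.IsValid a b U ∧ Quotient.mk _ U = Q}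

/-- The list `L` contains each valid topology exactly once, and nothing else. -/
structure Enumerates (a b : ℕ) (L : List (Topology (2 * I.K.edges))) : Prop where
  valid : ∀ U ∈ L, I.IsValid a b U
  complete : ∀ V, I.IsValid a b V → ∃ U ∈ L, U.Same V
  no_repetition : L.Pairwise fun U V => ¬ U.Same V

end Instance

end Multicut

/-! Write n = g + t. A good graph has O(n) crossings on each of O(n) sides, so a topology may have
of the order of n² darts, and counting pairs of permutations of the darts would give no better than
n^{O(n²)}. The bound n^{O(n)} holds because the arcs run in parallel bundles, and a bundle costs no
more to describe than a single arc.

There are few bundles for the following reason. Call a face of the overlay special if it is the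
outer face, contains the last piece of a side, or has a tree edge on its boundary; only O(n) faces
are special. Since an arc joins different sides, every other face has at least two arcs on its
boundary (`two_le_arcsOn`). Euler's formula bounds the number of arc darts by twice the number of
faces plus O(n) (`euler`), so only O(n) arc darts lie on special faces or on faces with three arcs
or more (`card_irregular_arcs`). All remaining faces are strips between two parallel arcs whose
endpoints are successive crossing points on both sides.

Now number the darts side by side: the pieces of the sides, the reversed pieces, the darts that
enter the polygon at the crossing points, then the O(n) others. Each of the tables of `next`, `rev`,
`corner` and `cross` becomes a concatenation of O(n) intervals of consecutive integers, increasing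
or decreasing (`exists_same`). Such an interval can be chosen in n^{O(1)} ways, hence there are
n^{O(n)} quadruples of such tables (`length_candidates`).

The algorithm lists these quadruples, keeps those that are the tables of a valid topology
(`PD.exists_isValid`) and deletes repetitions. Sameness is tested by walking through two topologies
simultaneously from a common corner (`Topology.same_iff`), and validity is invariant under renaming
(`Instance.IsValid.of_same`), so nothing is lost by looking only at well numbered representatives.

The program is not written out. The predicate `PT` asserts that some program computes a function in
time polynomial in a measure, and it is closed under composition, case distinction and loops. The
measure is n^n in the end: polynomials in n^n are n^{O(n)}. -/

namespace Multicut

open Data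

/-! ## Programs whose running time is polynomial in a measure -/

section Measure

variable {Γ Δ : Type}

/-- `f` is bounded by a polynomial in the measure `m`. -/
def Bdd (m f : Γ → ℕ) : Prop := ∃ c, ∀ γ, f γ ≤ (m γ + 2) ^ c

variable {m f g : Γ → ℕ}

theorem Bdd.mono (hg : Bdd m g) (h : ∀ γ, f γ ≤ g γ) : Bdd m f :=
  let ⟨c, hc⟩ := hg
  ⟨c, fun γ => (h γ).trans (hc γ)⟩

/-- The base `m γ + 2` is at least 2 whatever the measure, so its powers exceed every constant; this
also lets one further factor absorb a sum. -/
theorem Bdd.const (n : ℕ) : Bdd m fun _ => n :=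
  ⟨n, fun _ => Nat.lt_two_pow_self.le.trans (Nat.pow_le_pow_left (by omega) n)⟩

theorem Bdd.mul (hf : Bdd m f) (hg : Bdd m g) : Bdd m fun γ => f γ * g γ := by
  obtain ⟨c, hc⟩ := hf
  obtain ⟨d, hd⟩ := hg
  exact ⟨c + d, fun γ => by rw [pow_add]; exact Nat.mul_le_mul (hc γ) (hd γ)⟩

theorem Bdd.add (hf : Bdd m f) (hg : Bdd m g) : Bdd m fun γ => f γ + g γ := by
  obtain ⟨c, hc⟩ := hf
  obtain ⟨d, hd⟩ := hg
  refine ⟨c + d + 1, fun γ => ?_⟩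
  have h1 : f γ ≤ (m γ + 2) ^ (c + d) := (hc γ).trans (Nat.pow_le_pow_right (by omega) (by omega))
  have h2 : g γ ≤ (m γ + 2) ^ (c + d) := (hd γ).trans (Nat.pow_le_pow_right (by omega) (by omega))
  rw [pow_succ]
  nlinarith [Nat.zero_le (m γ * (m γ + 2) ^ (c + d))]

theorem Bdd.pow (hf : Bdd m f) (n : ℕ) : Bdd m fun γ => f γ ^ n := by
  obtain ⟨c, hc⟩ := hf
  exact ⟨c * n, fun γ => by rw [pow_mul]; exact Nat.pow_le_pow_left (hc γ) n⟩

theorem Bdd.pull (hf : Bdd m f) (π : Δ → Γ) : Bdd (fun δ => m (π δ)) fun δ => f (π δ) :=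
  let ⟨c, hc⟩ := hf
  ⟨c, fun δ => hc (π δ)⟩

theorem Bdd.succ (hf : Bdd m f) : Bdd m fun γ => f γ + 1 := hf.add (Bdd.const 1)

theorem Bdd.fin {N : Γ → ℕ} (hN : Bdd m N) (x : ∀ γ, Fin (N γ)) : Bdd m fun γ => (x γ : ℕ) :=
  hN.mono fun γ => (x γ).2.le

end Measure

/-- Some program computes `f γ` from `e γ`, in a number of steps that is polynomial in `m γ`. -/
def PT {Γ : Type} (m : Γ → ℕ) (e f : Γ → Data) : Prop :=
  ∃ (p : Prog) (T : Γ → ℕ), Bdd m T ∧ ∀ γ, ∃ n ≤ T γ, Run p (e γ) (f γ) n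

/-- Truth values as data. -/
noncomputable def Data.ofProp (P : Prop) : Data := by
  classical exact Data.ofBool (decide P)

theorem Data.ofProp_true {P : Prop} (h : P) : ofProp P = cons nil nil := by
  simp [ofProp, ofBool, h]

theorem Data.ofProp_false {P : Prop} (h : ¬ P) : ofProp P = nil := by
  simp [ofProp, ofBool, h]

theorem Data.ofProp_congr {P Q : Prop} (h : P ↔ Q) : ofProp P = ofProp Q := by
  rw [propext h]

theorem Data.ofBool_eq (b : Bool) : ofBool b = ofProp (b = true) := by
  cases b <;> simp [ofProp, ofBool]

/-- The predicate `P` is decided by a program, in a number of steps that is polynomial in `m γ`. -/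
def PD {Γ : Type} (m : Γ → ℕ) (e : Γ → Data) (P : Γ → Prop) : Prop := PT m e fun γ => ofProp (P γ)

section PT

variable {Γ Δ : Type} {m : Γ → ℕ} {e f g h : Γ → Data} {P Q : Γ → Prop}

theorem PT.congr (hf : PT m e f) (H : ∀ γ, g γ = f γ) : PT m e g := by
  rwa [show g = f from funext H]

theorem PD.congr (hP : PD m e P) (H : ∀ γ, Q γ ↔ P γ) : PD m e Q := by
  rwa [show Q = P from funext fun γ => propext (H γ)]

/-- Reindexing costs nothing: `π` is never computed, it only selects the contexts on which the same
program is run. -/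
theorem PT.pull (hf : PT m e f) (π : Δ → Γ) :
    PT (fun δ => m (π δ)) (fun δ => e (π δ)) fun δ => f (π δ) := by
  obtain ⟨p, T, hT, h⟩ := hf
  exact ⟨p, fun δ => T (π δ), hT.pull π, fun δ => h (π δ)⟩

theorem PD.pull (hf : PD m e P) (π : Δ → Γ) :
    PD (fun δ => m (π δ)) (fun δ => e (π δ)) fun δ => P (π δ) := PT.pull hf π

theorem PT.id : PT m e e := ⟨Prog.id, fun _ => 1, Bdd.const 1, fun _ => ⟨1, le_rfl, Run.id _⟩⟩

theorem PT.nil : PT m e fun _ => Data.nil :=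
  ⟨Prog.nil, fun _ => 1, Bdd.const 1, fun _ => ⟨1, le_rfl, Run.nil _⟩⟩

theorem PT.comp (hf : PT m e f) (hg : PT m f g) : PT m e g := by
  obtain ⟨p, T, hT, h⟩ := hf
  obtain ⟨q, T', hT', h'⟩ := hg
  refine ⟨Prog.comp q p, fun γ => T γ + T' γ + 1, (hT.add hT').succ, fun γ => ?_⟩
  obtain ⟨n, hn, r⟩ := h γ
  obtain ⟨n', hn', r'⟩ := h' γ
  exact ⟨n + n' + 1, by dsimp only; omega, Run.comp r r'⟩

theorem PT.cons (hf : PT m e f) (hg : PT m e g) : PT m e fun γ => Data.cons (f γ) (g γ) := by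
  obtain ⟨p, T, hT, h⟩ := hf
  obtain ⟨q, T', hT', h'⟩ := hg
  refine ⟨Prog.cons p q, fun γ => T γ + T' γ + 1, (hT.add hT').succ, fun γ => ?_⟩
  obtain ⟨n, hn, r⟩ := h γ
  obtain ⟨n', hn', r'⟩ := h' γ
  exact ⟨n + n' + 1, by dsimp only; omega, Run.cons r r'⟩

theorem PT.hd (h : PT m e fun γ => Data.cons (f γ) (g γ)) : PT m e f :=
  h.comp ⟨Prog.hd, fun _ => 1, Bdd.const 1, fun _ => ⟨1, le_rfl, Run.hd_cons _ _⟩⟩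

theorem PT.tl (h : PT m e fun γ => Data.cons (f γ) (g γ)) : PT m e g :=
  h.comp ⟨Prog.tl, fun _ => 1, Bdd.const 1, fun _ => ⟨1, le_rfl, Run.tl_cons _ _⟩⟩

/-- Under additional variables. -/
theorem PT.wk {a : Γ → Data} (hf : PT m e f) : PT m (fun γ => Data.cons (a γ) (e γ)) f :=
  (PT.tl PT.id).comp hf

/-- A branch has to be correct only on the contexts that reach it. Later tests can therefore rely on
earlier ones, and even speak of objects whose existence was just tested. -/
theorem PT.cases (hP : PD m e P)
    (h1 : PT (fun γ : {γ // P γ} => m γ) (fun γ => e γ) fun γ => f γ)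
    (h2 : PT (fun γ : {γ // ¬ P γ} => m γ) (fun γ => e γ) fun γ => f γ) : PT m e f := by
  classical
  obtain ⟨c, T, hT, h⟩ := hP
  obtain ⟨p, T1, ⟨c1, hT1⟩, h1⟩ := h1
  obtain ⟨q, T2, ⟨c2, hT2⟩, h2⟩ := h2
  -- `T1` and `T2` are defined only on the two subtypes; the powers of the measure that bound them
  -- make sense on all of `Γ`.
  refine ⟨Prog.ite c p q, fun γ => T γ + ((m γ + 2) ^ c1 + (m γ + 2) ^ c2) + 1,
    (hT.add (Bdd.add ⟨c1, fun _ => le_rfl⟩ ⟨c2, fun _ => le_rfl⟩)).succ, fun γ => ?_⟩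
  obtain ⟨k, hk, r⟩ := h γ
  by_cases hγ : P γ
  · obtain ⟨n, hn, r'⟩ := h1 ⟨γ, hγ⟩
    have := hT1 ⟨γ, hγ⟩
    simp only [ofProp_true hγ] at r
    exact ⟨k + n + 1, by dsimp only at *; omega, Run.ite_then r r'⟩
  · obtain ⟨n, hn, r'⟩ := h2 ⟨γ, hγ⟩
    have := hT2 ⟨γ, hγ⟩
    simp only [ofProp_false hγ] at r
    exact ⟨k + n + 1, by dsimp only at *; omega, Run.ite_else r r'⟩

theorem PT.ite (hP : PD m e P) (hf : PT m e f) (hg : PT m e g) (h1 : ∀ γ, P γ → h γ = f γ)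
    (h2 : ∀ γ, ¬ P γ → h γ = g γ) : PT m e h :=
  PT.cases hP ((hf.pull Subtype.val).congr fun γ => h1 _ γ.2)
    ((hg.pull Subtype.val).congr fun γ => h2 _ γ.2)

theorem PD.true : PD m e fun _ => True :=
  (PT.cons PT.nil PT.nil).congr fun _ => ofProp_true trivial

theorem PD.false : PD m e fun _ => False := PT.nil.congr fun _ => ofProp_false id

theorem PD.and_of (hP : PD m e P) (hQ : PD (fun γ : {γ // P γ} => m γ) (fun γ => e γ) fun γ => Q γ) :
    PD m e fun γ => P γ ∧ Q γ :=
  PT.cases hP (hQ.congr fun γ => by simp [γ.2]) (PD.false.congr fun γ => by simp [γ.2])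

theorem PD.and (hP : PD m e P) (hQ : PD m e Q) : PD m e fun γ => P γ ∧ Q γ :=
  hP.and_of (hQ.pull Subtype.val)

theorem PD.not (hP : PD m e P) : PD m e fun γ => ¬ P γ :=
  PT.ite hP PD.false PD.true (fun γ h => by simp [h]) (fun γ h => by simp [h])

theorem PD.or (hP : PD m e P) (hQ : PD m e Q) : PD m e fun γ => P γ ∨ Q γ :=
  (hP.not.and hQ.not).not.congr fun γ => by tauto

theorem PD.imp (hP : PD m e P) (hQ : PD m e Q) : PD m e fun γ => P γ → Q γ :=
  (hP.and hQ.not).not.congr fun γ => by tauto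

theorem PD.isNil (hf : PT m e f) : PD m e fun γ => f γ = Data.nil := by
  classical
  refine hf.comp ⟨Prog.ite Prog.id Prog.nil (Prog.cons Prog.nil Prog.nil), fun _ => 10, Bdd.const _,
    fun γ => ?_⟩
  cases hγ : f γ with
  | nil =>
    dsimp only
    rw [hγ, ofProp_true rfl]
    exact ⟨_, by norm_num, Run.ite_else (Run.id _) (Run.cons (Run.nil _) (Run.nil _))⟩
  | cons a b =>
    dsimp only
    rw [hγ, ofProp_false (by simp)]
    exact ⟨_, by norm_num, Run.ite_then (Run.id _) (Run.nil _)⟩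

/-- The tail of a list, with `nil` for the tail of `nil`. -/
def Data.tail : Data → Data
  | nil => nil
  | cons _ b => b

/-- The head of a list, with `nil` for the head of `nil`. -/
def Data.head : Data → Data
  | nil => nil
  | cons a _ => a

theorem PT.tail (hf : PT m e f) : PT m e fun γ => (f γ).tail :=
  hf.comp ⟨Prog.tl, fun _ => 1, Bdd.const 1, fun γ => ⟨1, le_rfl, by
    dsimp only; cases f γ <;> constructor⟩⟩

theorem PT.head (hf : PT m e f) : PT m e fun γ => (f γ).head :=
  hf.comp ⟨Prog.hd, fun _ => 1, Bdd.const 1, fun γ => ⟨1, le_rfl, by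
    dsimp only; cases f γ <;> constructor⟩⟩

end PT

/-! ## Loops -/

section Loops

variable {Γ : Type} {m : Γ → ℕ} {e : Γ → Data}

/-- A run of a loop is built from its end, so the induction is on the number `r` of rounds still to
be made. A round costs at most `2 * τ + 1`. -/
theorem run_loop {c p : Prog} {x : ℕ → Data} {N τ : ℕ}
    (hc : ∀ j < N, ∃ a b, ∃ k ≤ τ, Run c (x j) (Data.cons a b) k)
    (hp : ∀ j < N, ∃ n ≤ τ, Run p (x j) (x (j + 1)) n)
    (hN : ∃ k ≤ τ, Run c (x N) Data.nil k) :
    ∃ n ≤ (N + 1) * (2 * τ + 1), Run (Prog.loop c p) (x 0) (x N) n := by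
  suffices H : ∀ r ≤ N, ∃ n ≤ (r + 1) * (2 * τ + 1), Run (Prog.loop c p) (x (N - r)) (x N) n by
    simpa using H N le_rfl
  intro r
  induction r with
  | zero =>
    obtain ⟨k, hk, r⟩ := hN
    exact fun _ => ⟨k + 1, by omega, by simpa using Run.loop_stop r⟩
  | succ r ih =>
    intro hr
    obtain ⟨n, hn, h⟩ := ih (by omega)
    obtain ⟨a, b, k, hk, h1⟩ := hc (N - (r + 1)) (by omega)
    obtain ⟨l, hl, h2⟩ := hp (N - (r + 1)) (by omega)
    rw [show N - (r + 1) + 1 = N - r by omega] at h2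
    refine ⟨k + l + n + 1, ?_, Run.loop_step h1 h2 h⟩
    rw [add_mul (r + 1), one_mul]
    omega

/-- The memory holds the list of the remaining items, the state and the input. Its head is the
remaining list, so `Prog.hd` serves as the loop test and gives `nil` exactly after the last item.
The step has to be correct only on the states that really occur, and only the prescribed sequence
`S` enters the time bound. -/
theorem PT.loop {N : Γ → ℕ} (hN : Bdd m N) {item : ∀ γ, Fin (N γ) → Data} {S : Γ → ℕ → Data}
    (hl : PT m e fun γ => ofFun (item γ)) (h0 : PT m e fun γ => S γ 0)
    (hs : PT (fun δ : Σ γ, Fin (N γ) => m δ.1)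
      (fun δ => Data.cons (item δ.1 δ.2) (Data.cons (S δ.1 δ.2) (e δ.1)))
      fun δ => S δ.1 (δ.2 + 1)) :
    PT m e fun γ => S γ (N γ) := by
  let X : Γ → ℕ → Data := fun γ j =>
    Data.cons (ofList ((List.ofFn (item γ)).drop j)) (Data.cons (S γ j) (e γ))
  have hX0 : PT m e fun γ => X γ 0 := hl.cons (h0.cons PT.id)
  have hXN : PT m (fun γ => X γ (N γ)) fun γ => S γ (N γ) := PT.hd (PT.tl PT.id)
  refine (hX0.comp ?_).comp hXN
  have hdrop : ∀ δ : Σ γ, Fin (N γ), X δ.1 δ.2 = Data.cons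
      (Data.cons (item δ.1 δ.2) (ofList ((List.ofFn (item δ.1)).drop (δ.2 + 1))))
      (Data.cons (S δ.1 δ.2) (e δ.1)) := by
    rintro ⟨γ, j⟩
    simp only [X]
    rw [List.drop_eq_getElem_cons (by simp)]
    simp [ofList]
  have hstep : PT (fun δ : Σ γ, Fin (N γ) => m δ.1) (fun δ => X δ.1 δ.2)
      fun δ => X δ.1 (δ.2 + 1) := by
    have hid : PT (fun δ : Σ γ, Fin (N γ) => m δ.1) (fun δ => X δ.1 δ.2) fun δ => Data.cons
      (Data.cons (item δ.1 δ.2) (ofList ((List.ofFn (item δ.1)).drop (δ.2 + 1))))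
      (Data.cons (S δ.1 δ.2) (e δ.1)) := PT.id.congr fun δ => (hdrop δ).symm
    exact hid.hd.tl.cons (((hid.hd.hd.cons hid.tl).comp hs).cons hid.tl.tl)
  obtain ⟨p, T, ⟨c, hT⟩, hp⟩ := hstep
  refine ⟨Prog.loop Prog.hd p, fun γ => (N γ + 1) * (2 * (m γ + 2) ^ c + 1),
    hN.succ.mul ((Bdd.const 2).mul ⟨c, fun _ => le_rfl⟩).succ, fun γ => ?_⟩
  refine run_loop (fun j hj => ?_) (fun j hj => ?_) ?_
  · have := hdrop ⟨γ, j, hj⟩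
    simp only at this
    rw [this]
    exact ⟨_, _, 1, Nat.one_le_pow _ _ (by omega), Run.hd_cons _ _⟩
  · obtain ⟨n, hn, r⟩ := hp ⟨γ, j, hj⟩
    exact ⟨n, hn.trans (hT ⟨γ, j, hj⟩), r⟩
  · refine ⟨1, Nat.one_le_pow _ _ (by omega), ?_⟩
    simp only [X]
    rw [List.drop_eq_nil_of_le (by simp)]
    exact Run.hd_cons _ _

theorem Data.ofNat_eq_ofFun (n : ℕ) : ofNat n = ofFun fun _ : Fin n => Data.nil := by
  simp [ofNat, ofFun]

theorem Data.ofNat_succ (n : ℕ) : ofNat (n + 1) = Data.cons Data.nil (ofNat n) := rfl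

theorem PT.iter {N : Γ → ℕ} (hN : Bdd m N) {S : Γ → ℕ → Data}
    (hn : PT m e fun γ => ofNat (N γ)) (h0 : PT m e fun γ => S γ 0)
    (hs : PT (fun δ : Σ γ, Fin (N γ) => m δ.1) (fun δ => Data.cons (S δ.1 δ.2) (e δ.1))
      fun δ => S δ.1 (δ.2 + 1)) :
    PT m e fun γ => S γ (N γ) :=
  PT.loop hN (item := fun _ _ => Data.nil) (hn.congr fun _ => (ofNat_eq_ofFun _).symm) h0
    ((PT.tl PT.id).comp hs)

/-! ### Lists -/

theorem PT.reverse {α : Γ → Type} {l : ∀ γ, List (α γ)} {c : ∀ γ, α γ → Data}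
    (hN : Bdd m fun γ => (l γ).length) (hl : PT m e fun γ => ofList ((l γ).map (c γ))) :
    PT m e fun γ => ofList ((l γ).reverse.map (c γ)) := by
  have := PT.loop (m := m) (e := e) (N := fun γ => (l γ).length)
    (item := fun γ j => c γ (l γ)[j])
    (S := fun γ j => ofList (((l γ).take j).reverse.map (c γ))) hN
    (hl.congr fun γ => by
      rw [ofFun]; congr 1; apply List.ext_getElem <;> simp)
    PT.nil
    (((PT.hd PT.id).cons (PT.hd (PT.tl PT.id))).congr fun δ => by
      rw [List.take_succ_eq_append_getElem δ.2.2, List.reverse_append, List.map_append]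
      rfl)
  exact this.congr fun γ => by simp

/-- The numbers below `n`. -/
theorem PT.range {N : Γ → ℕ} (hN : Bdd m N) (hn : PT m e fun γ => ofNat (N γ)) :
    PT m e fun γ => ofFun fun j : Fin (N γ) => ofNat j := by
  -- The state is the counter with the list of the smaller numbers. The list grows at its head,
  -- hence comes out in decreasing order and is reversed afterwards.
  have h1 : PT m e fun γ => Data.cons (ofNat (N γ)) (ofList ((List.range (N γ)).reverse.map ofNat)) :=
    PT.iter hN (S := fun γ j => Data.cons (ofNat j) (ofList ((List.range j).reverse.map ofNat))) hn
      (PT.cons PT.nil PT.nil)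
      (((PT.cons PT.nil (PT.hd (PT.hd PT.id))).cons
        ((PT.hd (PT.hd PT.id)).cons (PT.tl (PT.hd PT.id)))).congr fun δ => by
          simp [List.range_succ, ofList, ofNat_succ])
  refine (PT.reverse (l := fun γ => (List.range (N γ)).reverse) (hN.mono fun γ => by simp)
    h1.tl).congr fun γ => ?_
  rw [ofFun]; congr 1; apply List.ext_getElem <;> simp

/-- Loop with a counter. -/
theorem PT.for {N : Γ → ℕ} (hN : Bdd m N) {S : Γ → ℕ → Data}
    (hn : PT m e fun γ => ofNat (N γ)) (h0 : PT m e fun γ => S γ 0)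
    (hs : PT (fun δ : Σ γ, Fin (N γ) => m δ.1)
      (fun δ => Data.cons (ofNat δ.2) (Data.cons (S δ.1 δ.2) (e δ.1))) fun δ => S δ.1 (δ.2 + 1)) :
    PT m e fun γ => S γ (N γ) :=
  PT.loop hN (PT.range hN hn) h0 hs

/-- Application of a function to the elements of a list. -/
theorem PT.mapFun {N : Γ → ℕ} (hN : Bdd m N) {a b : ∀ γ, Fin (N γ) → Data}
    (ha : PT m e fun γ => ofFun (a γ))
    (hb : PT (fun δ : Σ γ, Fin (N γ) => m δ.1) (fun δ => Data.cons (a δ.1 δ.2) (e δ.1))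
      fun δ => b δ.1 δ.2) :
    PT m e fun γ => ofFun (b γ) := by
  have h1 : PT m e fun γ => ofList (((List.ofFn (b γ)).take (N γ)).reverse.map fun x => x) :=
    PT.loop hN (S := fun γ j => ofList (((List.ofFn (b γ)).take j).reverse.map fun x => x)) ha PT.nil
      ((((PT.hd PT.id).cons (PT.tl (PT.tl PT.id))).comp hb |>.cons (PT.hd (PT.tl PT.id))).congr
        fun δ => by
          rw [List.take_succ_eq_append_getElem (by simp)]
          simp [ofList])
  refine (PT.reverse (l := fun γ => ((List.ofFn (b γ)).take (N γ)).reverse)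
    (hN.mono fun γ => by simp) h1).congr fun γ => ?_
  rw [List.map_id', List.reverse_reverse, List.take_of_length_le (by simp), ofFun]

theorem PT.table {N : Γ → ℕ} (hN : Bdd m N) {b : ∀ γ, Fin (N γ) → Data}
    (hn : PT m e fun γ => ofNat (N γ))
    (hb : PT (fun δ : Σ γ, Fin (N γ) => m δ.1) (fun δ => Data.cons (ofNat δ.2) (e δ.1))
      fun δ => b δ.1 δ.2) :
    PT m e fun γ => ofFun (b γ) :=
  PT.mapFun hN (PT.range hN hn) hb

theorem PT.foldlList {α : Γ → Type} {l : ∀ γ, List (α γ)} {c : ∀ γ, α γ → Data}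
    {β : Γ → Type} {d : ∀ γ, β γ → Data} {F : ∀ γ, β γ → α γ → β γ} {b : ∀ γ, β γ}
    (hN : Bdd m fun γ => (l γ).length) (hl : PT m e fun γ => ofList ((l γ).map (c γ)))
    (hb : PT m e fun γ => d γ (b γ))
    (hs : PT (fun δ : Σ γ, Fin (l γ).length => m δ.1)
      (fun δ => Data.cons (c δ.1 (l δ.1)[δ.2])
        (Data.cons (d δ.1 (((l δ.1).take δ.2).foldl (F δ.1) (b δ.1))) (e δ.1)))
      fun δ => d δ.1 (F δ.1 (((l δ.1).take δ.2).foldl (F δ.1) (b δ.1)) (l δ.1)[δ.2])) :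
    PT m e fun γ => d γ ((l γ).foldl (F γ) (b γ)) := by
  have := PT.loop (m := m) (e := e) (N := fun γ => (l γ).length)
    (item := fun γ j => c γ (l γ)[j])
    (S := fun γ j => d γ (((l γ).take j).foldl (F γ) (b γ))) hN
    (hl.congr fun γ => by
      rw [ofFun]; congr 1; apply List.ext_getElem <;> simp)
    (hb.congr fun γ => by simp)
    (hs.congr fun δ => by
      rw [List.take_succ_eq_append_getElem δ.2.2, List.foldl_append]
      rfl)
  exact this.congr fun γ => by simp

theorem PT.append {l l' : Γ → List Data} (hN : Bdd m fun γ => (l γ).length)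
    (hl : PT m e fun γ => ofList (l γ)) (hl' : PT m e fun γ => ofList (l' γ)) :
    PT m e fun γ => ofList (l γ ++ l' γ) := by
  have h1 : PT m e fun γ => ofList ((l γ).map fun x => x) := hl.congr fun γ => by simp
  have := PT.foldlList (l := fun γ => (l γ).reverse) (c := fun _ x => x)
    (d := fun _ => ofList) (F := fun _ s x => x :: s) (b := l') (hN.mono fun γ => by simp)
    (PT.reverse hN h1) hl' ((PT.hd PT.id).cons (PT.hd (PT.tl PT.id)))
  exact this.congr fun γ => by simp

end Loops


/-- A context with an additional variable, bounded by `N`. -/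
abbrev Ext {Γ : Type} (N : Γ → ℕ) : Type := Σ γ, Fin (N γ)

/-! ### Unary arithmetic, access to tables, bounded quantifiers -/

section Arithmetic

variable {Γ : Type} {m : Γ → ℕ} {e : Γ → Data} {a b : Γ → ℕ} {N : Γ → ℕ}

theorem PT.wkFin {f : Γ → Data} (hf : PT m e f) : PT (fun δ : Ext N => m δ.1)
    (fun δ => Data.cons (ofNat δ.2) (e δ.1)) fun δ => f δ.1 :=
  (hf.pull Sigma.fst).wk

theorem PT.var {f g : Γ → Data} : PT m (fun γ => Data.cons (f γ) (g γ)) f := PT.hd PT.id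

theorem Bdd.var {M : Γ → ℕ} (hM : Bdd m M) : Bdd (fun δ : Ext M => m δ.1) fun δ => (δ.2 : ℕ) :=
  (hM.pull Sigma.fst).mono fun δ => δ.2.2.le

theorem Bdd.ext {M : Γ → ℕ} {f : Γ → ℕ} (hf : Bdd m f) :
    Bdd (fun δ : Ext M => m δ.1) fun δ => f δ.1 := hf.pull Sigma.fst

theorem PT.natConst (n : ℕ) : PT m e fun _ => ofNat n := by
  induction n with
  | zero => exact PT.nil
  | succ n ih => exact PT.nil.cons ih

theorem PT.natSucc (ha : PT m e fun γ => ofNat (a γ)) : PT m e fun γ => ofNat (a γ + 1) :=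
  PT.nil.cons ha

theorem PT.natAdd (hB : Bdd m b) (ha : PT m e fun γ => ofNat (a γ))
    (hb : PT m e fun γ => ofNat (b γ)) : PT m e fun γ => ofNat (a γ + b γ) :=
  PT.iter hB (S := fun γ j => ofNat (a γ + j)) hb ha PT.var.natSucc

theorem Data.tail_ofNat (n : ℕ) : (ofNat n).tail = ofNat (n - 1) := by cases n <;> rfl

theorem PT.natSub (hB : Bdd m b) (ha : PT m e fun γ => ofNat (a γ))
    (hb : PT m e fun γ => ofNat (b γ)) : PT m e fun γ => ofNat (a γ - b γ) :=
  PT.iter hB (S := fun γ j => ofNat (a γ - j)) hb ha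
    (PT.var.tail.congr fun δ => by rw [tail_ofNat, Nat.sub_sub])

theorem PT.natMul (hA : Bdd m a) (hB : Bdd m b) (ha : PT m e fun γ => ofNat (a γ))
    (hb : PT m e fun γ => ofNat (b γ)) : PT m e fun γ => ofNat (a γ * b γ) :=
  PT.iter hB (S := fun γ j => ofNat (a γ * j)) hb PT.nil
    (PT.natAdd (hA.pull _) PT.var (PT.wk (ha.pull _)))

theorem Data.ofNat_eq_nil (n : ℕ) : ofNat n = Data.nil ↔ n = 0 := by
  cases n
  · simp [ofNat, ofList]
  · simp [ofNat_succ]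

theorem PD.natLe (hB : Bdd m b) (ha : PT m e fun γ => ofNat (a γ))
    (hb : PT m e fun γ => ofNat (b γ)) : PD m e fun γ => a γ ≤ b γ :=
  (PD.isNil (PT.natSub hB ha hb)).congr fun γ => by rw [ofNat_eq_nil]; omega

theorem PD.natLt (hB : Bdd m b) (ha : PT m e fun γ => ofNat (a γ))
    (hb : PT m e fun γ => ofNat (b γ)) : PD m e fun γ => a γ < b γ :=
  PD.natLe hB ha.natSucc hb

theorem PD.natEq (hA : Bdd m a) (hB : Bdd m b) (ha : PT m e fun γ => ofNat (a γ))
    (hb : PT m e fun γ => ofNat (b γ)) : PD m e fun γ => a γ = b γ :=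
  ((PD.natLe hB ha hb).and (PD.natLe hA hb ha)).congr fun _ => le_antisymm_iff

theorem PD.finEq (hN : Bdd m N) {x y : ∀ γ, Fin (N γ)} (hx : PT m e fun γ => ofNat (x γ))
    (hy : PT m e fun γ => ofNat (y γ)) : PD m e fun γ => x γ = y γ :=
  (PD.natEq (hN.fin x) (hN.fin y) hx hy).congr fun _ => Fin.ext_iff

theorem PT.drop {l : Γ → List Data} (hA : Bdd m a) (hl : PT m e fun γ => ofList (l γ))
    (ha : PT m e fun γ => ofNat (a γ)) : PT m e fun γ => ofList ((l γ).drop (a γ)) :=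
  PT.iter hA (S := fun γ j => ofList ((l γ).drop j)) ha hl (PT.var.tail.congr fun δ => by
    rw [← List.tail_drop]
    cases (l δ.1).drop δ.2 <;> rfl)

theorem PT.getD {l : Γ → List Data} (hA : Bdd m a) (hl : PT m e fun γ => ofList (l γ))
    (ha : PT m e fun γ => ofNat (a γ)) : PT m e fun γ => (l γ).getD (a γ) Data.nil :=
  (PT.drop hA hl ha).head.congr fun γ => by
    rcases lt_or_ge (a γ) (l γ).length with h | h
    · rw [List.drop_eq_getElem_cons h, List.getD_eq_getElem _ _ h]
      rfl
    · rw [List.drop_of_length_le h, List.getD_eq_default _ _ h]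
      rfl

theorem PT.apply {F : ∀ γ, Fin (N γ) → Data} {i : ∀ γ, Fin (N γ)} (hN : Bdd m N)
    (hF : PT m e fun γ => ofFun (F γ)) (hi : PT m e fun γ => ofNat (i γ)) :
    PT m e fun γ => F γ (i γ) :=
  (PT.getD (hN.fin i) hF hi).congr fun γ => by
    rw [List.getD_eq_getElem _ _ (by simp)]
    simp

theorem PD.ofBool {c : Γ → Bool} (h : PT m e fun γ => Data.ofBool (c γ)) :
    PD m e fun γ => c γ = Bool.true :=
  h.congr fun _ => (ofBool_eq _).symm

/-- The loop keeps the truth value of the statement for the indices below the counter; the test of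
one index sees it as a new variable in front of the input. -/
theorem PD.forallFin (hN : Bdd m N) {P : ∀ γ, Fin (N γ) → Prop}
    (hn : PT m e fun γ => ofNat (N γ))
    (hP : PD (fun δ : Ext N => m δ.1) (fun δ => Data.cons (ofNat δ.2) (e δ.1))
      fun δ => P δ.1 δ.2) : PD m e fun γ => ∀ j, P γ j := by
  have := PT.for hN (S := fun γ j => ofProp (∀ i : Fin (N γ), i < j → P γ i)) hn
    (PD.true.congr fun γ => by simp)
    (PD.congr (Q := fun δ : Ext N => ∀ i : Fin (N δ.1), i < (δ.2 : ℕ) + 1 → P δ.1 i)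
      (PD.and (P := fun δ : Ext N => ∀ i : Fin (N δ.1), i < (δ.2 : ℕ) → P δ.1 i)
        (PT.hd (PT.tl PT.id)) ((PT.cons PT.var (PT.tl (PT.tl PT.id))).comp hP)) fun δ => by
      constructor
      · exact fun h => ⟨fun i hi => h i (by omega), h _ (by omega)⟩
      · rintro ⟨h1, h2⟩ i hi
        rcases (Nat.lt_succ_iff_lt_or_eq.1 hi) with h | h
        · exact h1 i h
        · rwa [Fin.ext h])
  exact this.congr fun γ => ofProp_congr ⟨fun h i _ => h i, fun h i => h i i.2⟩

theorem PD.existsFin (hN : Bdd m N) {P : ∀ γ, Fin (N γ) → Prop}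
    (hn : PT m e fun γ => ofNat (N γ))
    (hP : PD (fun δ : Ext N => m δ.1) (fun δ => Data.cons (ofNat δ.2) (e δ.1))
      fun δ => P δ.1 δ.2) : PD m e fun γ => ∃ j, P γ j :=
  (PD.forallFin (P := fun γ j => ¬ P γ j) hN hn hP.not).not.congr fun γ => by simp

theorem PD.forallLe (hA : Bdd m a) {P : Γ → ℕ → Prop} (ha : PT m e fun γ => ofNat (a γ))
    (hP : PD (fun δ : Ext fun γ => a γ + 1 => m δ.1) (fun δ => Data.cons (ofNat δ.2) (e δ.1))
      fun δ => P δ.1 δ.2) : PD m e fun γ => ∀ j, j ≤ a γ → P γ j :=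
  (PD.forallFin hA.succ ha.natSucc hP).congr fun γ =>
    ⟨fun h j => h j (by omega), fun h j hj => h ⟨j, by omega⟩⟩

theorem PD.existsLe (hA : Bdd m a) {P : Γ → ℕ → Prop} (ha : PT m e fun γ => ofNat (a γ))
    (hP : PD (fun δ : Ext fun γ => a γ + 1 => m δ.1) (fun δ => Data.cons (ofNat δ.2) (e δ.1))
      fun δ => P δ.1 δ.2) : PD m e fun γ => ∃ j, j ≤ a γ ∧ P γ j :=
  (PD.existsFin hA.succ ha.natSucc hP).congr fun γ =>
    ⟨fun ⟨j, hj, h⟩ => ⟨⟨j, by omega⟩, h⟩, fun ⟨j, h⟩ => ⟨j, by omega, h⟩⟩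

theorem PT.card (hN : Bdd m N) {P : ∀ γ, Fin (N γ) → Prop} (hn : PT m e fun γ => ofNat (N γ))
    (hP : PD (fun δ : Ext N => m δ.1) (fun δ => Data.cons (ofNat δ.2) (e δ.1))
      fun δ => P δ.1 δ.2) : PT m e fun γ => ofNat (Nat.card {j // P γ j}) := by
  classical
  have := PT.for hN (S := fun γ j => ofNat
      (Finset.univ.filter fun i : Fin (N γ) => i < j ∧ P γ i).card) hn
    (PT.nil.congr fun γ => by simp [ofNat, ofList])
    (PT.ite (((PT.cons PT.var (PT.tl (PT.tl PT.id))).comp hP))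
      (PT.natSucc (PT.hd (PT.tl PT.id))) (PT.hd (PT.tl PT.id))
      (fun δ h => by
        congr 1
        rw [← Finset.card_insert_of_notMem (a := δ.2) (by simp)]
        congr 1
        ext i
        simp only [Finset.mem_filter, Finset.mem_univ, true_and, Finset.mem_insert,
          Nat.lt_succ_iff_lt_or_eq, Fin.ext_iff]
        constructor
        · tauto
        · rintro (h' | h')
          · exact ⟨Or.inr h', (Fin.ext h' : i = δ.2) ▸ h⟩
          · tauto)
      (fun δ h => by
        congr 2
        ext i
        simp only [Finset.mem_filter, Finset.mem_univ, true_and, Nat.lt_succ_iff_lt_or_eq]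
        constructor
        · rintro ⟨h1 | h1, h2⟩
          · exact ⟨h1, h2⟩
          · exact absurd ((Fin.ext h1 : i = δ.2) ▸ h2) h
        · tauto))
  refine this.congr fun γ => ?_
  rw [Nat.card_eq_fintype_card, Fintype.card_subtype]
  simp

theorem PT.iterate (hA : Bdd m a) {F : ∀ γ, Fin (N γ) → Fin (N γ)} {x : ∀ γ, Fin (N γ)}
    (hN : Bdd m N) (hF : PT m e fun γ => ofFun fun y => ofNat (F γ y))
    (hx : PT m e fun γ => ofNat (x γ)) (ha : PT m e fun γ => ofNat (a γ)) :
    PT m e fun γ => ofNat ((F γ)^[a γ] (x γ)) :=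
  PT.iter hA (S := fun γ j => ofNat ((F γ)^[j] (x γ))) ha hx
    ((PT.apply (hN.pull _) (PT.wk (hF.pull _)) PT.var).congr fun δ => by
      rw [Function.iterate_succ_apply'])

end Arithmetic

/-! ## Reachability -/

/-- The elements that can be reached from `x` along at most `k` edges of a relation. -/
def reachIn {n : ℕ} (R : Fin n → Fin n → Prop) (x : Fin n) : ℕ → Fin n → Prop
  | 0 => fun v => v = x
  | k + 1 => fun v => ∃ u, reachIn R x k u ∧ (v = u ∨ R u v ∨ R v u)

theorem reachIn_succ_of {n : ℕ} {R : Fin n → Fin n → Prop} {x : Fin n} {k : ℕ} {v : Fin n}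
    (h : reachIn R x k v) : reachIn R x (k + 1) v := ⟨v, h, Or.inl rfl⟩

theorem reachIn_eqvGen {n : ℕ} {R : Fin n → Fin n → Prop} {x : Fin n} {k : ℕ} :
    ∀ {v}, reachIn R x k v → Relation.EqvGen R x v := by
  induction k with
  | zero => rintro v rfl; exact Relation.EqvGen.refl _
  | succ k ih =>
    rintro v ⟨u, hu, rfl | h | h⟩
    · exact ih hu
    · exact (ih hu).trans _ _ _ (Relation.EqvGen.rel _ _ h)
    · exact (ih hu).trans _ _ _ ((Relation.EqvGen.rel _ _ h).symm)

theorem reachIn_stable {n : ℕ} {R : Fin n → Fin n → Prop} {x : Fin n} {k : ℕ}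
    (h : ∀ v, reachIn R x (k + 1) v → reachIn R x k v) {l : ℕ} (hl : k ≤ l) :
    ∀ v, reachIn R x (l + 1) v → reachIn R x l v := by
  induction l, hl using Nat.le_induction with
  | base => exact h
  | succ l _ ih =>
    rintro v ⟨u, hu, hv⟩
    exact ⟨u, ih u hu, hv⟩

/-- A round that reaches nothing new is followed only by such rounds. If round `n + 1` were
productive, so would be all earlier ones, and more than `n` elements would be reached. -/
theorem exists_reachIn_stable {n : ℕ} (R : Fin n → Fin n → Prop) (x : Fin n) :
    ∀ v, reachIn R x (n + 1) v → reachIn R x n v := by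
  classical
  by_contra hn
  have hk : ∀ k ≤ n, ∃ v, reachIn R x (k + 1) v ∧ ¬ reachIn R x k v := by
    intro k hk
    by_contra h
    push Not at h
    exact hn (reachIn_stable h hk)
  have hcard : ∀ k ≤ n + 1, k ≤ (Finset.univ.filter (reachIn R x k)).card := by
    intro k
    induction k with
    | zero => simp
    | succ k ih =>
      intro hk'
      obtain ⟨v, hv, hv'⟩ := hk k (by omega)
      refine (ih (by omega)).trans_lt (Finset.card_lt_card ?_)
      refine Finset.ssubset_iff_subset_ne.2 ⟨fun u hu => ?_, fun h => hv' ?_⟩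
      · simp only [Finset.mem_filter, Finset.mem_univ, true_and] at hu ⊢
        exact reachIn_succ_of hu
      · have : v ∈ Finset.univ.filter (reachIn R x (k + 1)) := by simpa using hv
        rw [← h] at this
        simpa using this
  have := (hcard (n + 1) le_rfl).trans (Finset.card_le_univ _)
  simp at this

theorem reachIn_iff {n : ℕ} {R : Fin n → Fin n → Prop} {x v : Fin n} :
    reachIn R x n v ↔ Relation.EqvGen R x v := by
  refine ⟨reachIn_eqvGen, fun h => ?_⟩
  have hx : ∀ k, reachIn R x k x := fun k => by
    induction k with
    | zero => rfl
    | succ k ih => exact reachIn_succ_of ih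
  have key : ∀ u v, Relation.EqvGen R u v → (reachIn R x n u ↔ reachIn R x n v) := by
    intro u v h
    induction h with
    | rel u v h =>
      exact ⟨fun hu => exists_reachIn_stable R x v ⟨u, hu, Or.inr (Or.inl h)⟩,
        fun hv => exists_reachIn_stable R x u ⟨v, hv, Or.inr (Or.inr h)⟩⟩
    | refl => rfl
    | symm _ _ _ ih => exact ih.symm
    | trans _ _ _ _ _ ih1 ih2 => exact ih1.trans ih2
  exact (key x v h).1 (hx n)

section Reachability

variable {Γ : Type} {m : Γ → ℕ} {e : Γ → Data} {N : Γ → ℕ}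

/-- All notions of connection in the definitions reduce to this. The loop updates the table of the
elements reached so far; `N γ` rounds suffice by `reachIn_iff`. -/
theorem PD.eqvGen (hN : Bdd m N) {R : ∀ γ, Fin (N γ) → Fin (N γ) → Prop} {x y : ∀ γ, Fin (N γ)}
    (hn : PT m e fun γ => ofNat (N γ))
    (hR : PD (fun δ : Ext fun δ : Ext N => N δ.1 => m δ.1.1)
      (fun δ => Data.cons (ofNat δ.2) (Data.cons (ofNat δ.1.2) (e δ.1.1)))
      fun δ => R δ.1.1 δ.1.2 δ.2)
    (hx : PT m e fun γ => ofNat (x γ)) (hy : PT m e fun γ => ofNat (y γ)) :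
    PD m e fun γ => Relation.EqvGen (R γ) (x γ) (y γ) := by
  have h1 : PT m e fun γ => ofFun fun v => ofProp (reachIn (R γ) (x γ) (N γ) v) := by
    refine PT.iter hN (S := fun γ j => ofFun fun v => ofProp (reachIn (R γ) (x γ) j v)) hn ?_ ?_
    · exact PT.table hN hn (PD.finEq (hN.pull _) PT.var (hx.wkFin))
    · refine PT.table (hN.pull _) (PT.wk (hn.pull _)) ?_
      refine PD.existsFin (N := fun δ : Ext fun δ : Ext N => N δ.1 => N δ.1.1) (hN.pull _) ?_ ?_
      · exact PT.wk (PT.wk (hn.pull _))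
      · refine PD.and ?_ (PD.or ?_ (PD.or ?_ ?_))
        · exact PT.apply (N := fun δ : Ext fun δ : Ext fun δ : Ext N => N δ.1 => N δ.1.1 => N δ.1.1.1)
            (F := fun δ v => ofProp (reachIn (R δ.1.1.1) (x δ.1.1.1) δ.1.1.2 v))
            (i := fun δ => δ.2) (hN.pull _) (PT.hd (PT.tl (PT.tl PT.id))) PT.var
        · exact PD.finEq (N := fun δ : Ext fun δ : Ext fun δ : Ext N => N δ.1 => N δ.1.1 => N δ.1.1.1) (x := fun δ => δ.1.2) (y := fun δ => δ.2)
            (hN.pull _) (PT.hd (PT.tl PT.id)) PT.var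
        · exact (PT.cons (PT.hd (PT.tl PT.id)) (PT.cons PT.var (PT.tl (PT.tl (PT.tl PT.id))))).comp
            (PT.pull (Δ := Ext fun δ : Ext fun δ : Ext N => N δ.1 => N δ.1.1) hR fun δ => ⟨⟨δ.1.1.1, δ.2⟩, δ.1.2⟩)
        · exact (PT.cons PT.var (PT.cons (PT.hd (PT.tl PT.id)) (PT.tl (PT.tl (PT.tl PT.id))))).comp
            (PT.pull (Δ := Ext fun δ : Ext fun δ : Ext N => N δ.1 => N δ.1.1) hR fun δ => ⟨⟨δ.1.1.1, δ.1.2⟩, δ.2⟩)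
  exact PD.congr (PT.apply hN h1 hy : PD m e fun γ => reachIn (R γ) (x γ) (N γ) (y γ))
    fun γ => reachIn_iff.symm

theorem sameCycle_iff_eqvGen {α : Type*} {f : Equiv.Perm α} {x y : α} :
    f.SameCycle x y ↔ Relation.EqvGen (fun a b => b = f a) x y := by
  constructor
  · rintro ⟨k, rfl⟩
    induction k using Int.induction_on with
    | zero => exact Relation.EqvGen.refl _
    | succ k ih =>
      refine ih.trans _ _ _ (Relation.EqvGen.rel _ _ ?_)
      rw [add_comm, zpow_add, zpow_one]; rfl
    | pred k ih =>
      refine ih.trans _ _ _ (Relation.EqvGen.rel _ _ ?_).symm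
      rw [show (-(k : ℤ)) = 1 + (-k - 1) by ring, zpow_add, zpow_one]
      simp
  · intro h
    induction h with
    | rel a b h => subst h; exact Equiv.Perm.sameCycle_apply_right.2 (Equiv.Perm.SameCycle.refl _ _)
    | refl => exact Equiv.Perm.SameCycle.refl _ _
    | symm _ _ _ ih => exact ih.symm
    | trans _ _ _ _ _ ih1 ih2 => exact ih1.trans ih2

theorem PD.sameCycle (hN : Bdd m N) {f : ∀ γ, Equiv.Perm (Fin (N γ))} {x y : ∀ γ, Fin (N γ)}
    (hn : PT m e fun γ => ofNat (N γ)) (hf : PT m e fun γ => ofFun fun v => ofNat (f γ v))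
    (hx : PT m e fun γ => ofNat (x γ)) (hy : PT m e fun γ => ofNat (y γ)) :
    PD m e fun γ => (f γ).SameCycle (x γ) (y γ) := by
  refine PD.congr (PD.eqvGen hN hn (R := fun γ a b => b = f γ a) ?_ hx hy)
    fun γ => sameCycle_iff_eqvGen
  exact PD.finEq (N := fun δ : Ext fun δ : Ext N => N δ.1 => N δ.1.1) (hN.pull _) PT.var
    (PT.apply (F := fun (δ : Ext fun δ : Ext N => N δ.1) v => ofNat (f δ.1.1 v)) (hN.pull _) hf.wkFin.wkFin (PT.wk PT.var))

/-- Each cycle is represented by its least element, which replaces a quotient by a subset that can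
be tested. -/
theorem numCycles_eq {d : ℕ} (f : Equiv.Perm (Fin d)) :
    numCycles f = Nat.card {x : Fin d // ∀ y, f.SameCycle y x → x ≤ y} := by
  classical
  refine (Nat.card_congr (Equiv.ofBijective
    (fun x : {x : Fin d // ∀ y, f.SameCycle y x → x ≤ y} =>
      Quotient.mk (Equiv.Perm.SameCycle.setoid f) x.1) ⟨?_, ?_⟩)).symm
  · rintro ⟨x, hx⟩ ⟨y, hy⟩ h
    have h' : f.SameCycle x y := Quotient.exact h
    exact Subtype.ext (le_antisymm (hx y h'.symm) (hy x h'))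
  · intro q
    induction q using Quotient.inductionOn with
    | h x =>
      obtain ⟨y, hy, hmin⟩ := Finset.exists_min_image (Finset.univ.filter fun y => f.SameCycle y x)
        (fun y => y) ⟨x, by simpa using Equiv.Perm.SameCycle.refl _ _⟩
      simp only [Finset.mem_filter, Finset.mem_univ, true_and] at hy hmin
      exact ⟨⟨y, fun z hz => hmin z (hz.trans hy)⟩, Quotient.sound hy⟩

theorem PT.numCycles (hN : Bdd m N) {f : ∀ γ, Equiv.Perm (Fin (N γ))}
    (hn : PT m e fun γ => ofNat (N γ)) (hf : PT m e fun γ => ofFun fun v => ofNat (f γ v)) :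
    PT m e fun γ => ofNat (numCycles (f γ)) := by
  refine (PT.card hN hn (P := fun γ x => ∀ y, (f γ).SameCycle y x → x ≤ y) ?_).congr
    fun γ => by rw [numCycles_eq]
  refine PD.forallFin (hN.pull _) hn.wkFin (PD.imp ?_ ?_)
  · exact PD.sameCycle (N := fun δ : Ext fun δ : Ext N => N δ.1 => N δ.1.1) (f := fun δ => f δ.1.1) (hN.pull _) hn.wkFin.wkFin
      hf.wkFin.wkFin PT.var (PT.wk PT.var)
  · exact PD.natLe ((hN.pull _).fin fun δ : Ext fun δ : Ext N => N δ.1 => δ.2)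
      (PT.wk PT.var) PT.var

theorem numCycles_le {d : ℕ} (f : Equiv.Perm (Fin d)) : Multicut.numCycles f ≤ d := by
  have := Nat.card_le_card_of_surjective (Quotient.mk (Equiv.Perm.SameCycle.setoid f))
    Quotient.mk_surjective
  simpa [Multicut.numCycles] using this

end Reachability


/-! ### Topologies and instances as tables, and the test of the axioms of a topology -/

/-- The data of a topology on a polygon with `N` sides, without the topological conditions. -/
structure PreTopology (N : ℕ) where
  darts : ℕ
  next : Equiv.Perm (Fin darts)
  rev : Equiv.Perm (Fin darts)
  corner : Fin N → Fin darts
  cross : Fin N → ℕ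

/-- The underlying data of a topology. -/
abbrev Topology.toPre {N : ℕ} (U : Topology N) : PreTopology N :=
  ⟨U.darts, U.next, U.rev, U.corner, U.cross⟩

section

variable {Γ Δ : Type} {m : Γ → ℕ} {e : Γ → Data}

/-- The tables of a family of topologies are available to programs. -/
structure HasPre (m : Γ → ℕ) (e : Γ → Data) {N : Γ → ℕ} (W : ∀ γ, PreTopology (N γ)) : Prop where
  bdd_sides : Bdd m N
  sides : PT m e fun γ => ofNat (N γ)
  bdd_darts : Bdd m fun γ => (W γ).darts
  darts : PT m e fun γ => ofNat (W γ).darts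
  next : PT m e fun γ => ofFun fun x => ofNat ((W γ).next x)
  rev : PT m e fun γ => ofFun fun x => ofNat ((W γ).rev x)
  corner : PT m e fun γ => ofFun fun x => ofNat ((W γ).corner x)
  cross : PT m e fun γ => ofFun fun x => ofNat ((W γ).cross x)
  bdd_cross : ∃ B, Bdd m B ∧ ∀ γ i, (W γ).cross i ≤ B γ

/-- The description of an instance is available to programs. -/
structure HasInst (m : Γ → ℕ) (e : Γ → Data) (I : Γ → Instance) : Prop where
  bdd_sides : Bdd m fun γ => 2 * (I γ).K.edges
  sides : PT m e fun γ => ofNat (2 * (I γ).K.edges)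
  bdd_terminals : Bdd m fun γ => (I γ).t
  terminals : PT m e fun γ => ofNat (I γ).t
  bdd_genus : Bdd m fun γ => (I γ).g
  genus : PT m e fun γ => ofNat (I γ).g
  mate : PT m e fun γ => ofFun fun i => ofNat ((I γ).K.mate i)
  twist : PT m e fun γ => ofFun fun i => ofBool ((I γ).K.twist i)
  terminal : PT m e fun γ => ofFun fun i => ofNat ((I γ).terminal i)
  pairs : PT m e fun γ => ofFun fun a => ofFun fun b => ofBool (decide (s(a, b) ∈ (I γ).pairs))

theorem HasInst.pull {I : Γ → Instance} (h : HasInst m e I) (π : Δ → Γ) :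
    HasInst (fun δ => m (π δ)) (fun δ => e (π δ)) fun δ => I (π δ) where
  bdd_sides := h.bdd_sides.pull _
  sides := h.sides.pull _
  bdd_terminals := h.bdd_terminals.pull _
  terminals := h.terminals.pull _
  bdd_genus := h.bdd_genus.pull _
  genus := h.genus.pull _
  mate := h.mate.pull _
  twist := h.twist.pull _
  terminal := h.terminal.pull _
  pairs := h.pairs.pull _

theorem HasInst.wk {I : Γ → Instance} (h : HasInst m e I) {a : Γ → Data} :
    HasInst m (fun γ => Data.cons (a γ) (e γ)) I where
  bdd_sides := h.bdd_sides
  sides := h.sides.wk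
  bdd_terminals := h.bdd_terminals
  terminals := h.terminals.wk
  bdd_genus := h.bdd_genus
  genus := h.genus.wk
  mate := h.mate.wk
  twist := h.twist.wk
  terminal := h.terminal.wk
  pairs := h.pairs.wk

theorem HasInst.ext {I : Γ → Instance} (h : HasInst m e I) {M : Γ → ℕ} :
    HasInst (fun δ : Ext M => m δ.1) (fun δ => Data.cons (ofNat δ.2) (e δ.1)) fun δ => I δ.1 :=
  (h.pull _).wk

section

variable {N : Γ → ℕ} {W : ∀ γ, PreTopology (N γ)}

theorem HasPre.pull (h : HasPre m e W) (π : Δ → Γ) :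
    HasPre (fun δ => m (π δ)) (fun δ => e (π δ)) fun δ => W (π δ) where
  bdd_sides := h.bdd_sides.pull _
  sides := h.sides.pull _
  bdd_darts := h.bdd_darts.pull _
  darts := h.darts.pull _
  next := h.next.pull _
  rev := h.rev.pull _
  corner := h.corner.pull _
  cross := h.cross.pull _
  bdd_cross := let ⟨_, hB, hB'⟩ := h.bdd_cross; ⟨_, hB.pull π, fun δ => hB' (π δ)⟩

theorem HasPre.wk (h : HasPre m e W) {a : Γ → Data} :
    HasPre m (fun γ => Data.cons (a γ) (e γ)) W where
  bdd_sides := h.bdd_sides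
  sides := h.sides.wk
  bdd_darts := h.bdd_darts
  darts := h.darts.wk
  next := h.next.wk
  rev := h.rev.wk
  corner := h.corner.wk
  cross := h.cross.wk
  bdd_cross := h.bdd_cross

theorem HasPre.ext (h : HasPre m e W) {M : Γ → ℕ} :
    HasPre (fun δ : Ext M => m δ.1) (fun δ => Data.cons (ofNat δ.2) (e δ.1)) fun δ => W δ.1 :=
  (h.pull _).wk

theorem PT.finRotate {i : ∀ γ, Fin (N γ)} (hN : Bdd m N) (hn : PT m e fun γ => ofNat (N γ))
    (hi : PT m e fun γ => ofNat (i γ)) : PT m e fun γ => ofNat (finRotate (N γ) (i γ)) := by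
  refine PT.ite (PD.natEq (hN.fin i).succ hN hi.natSucc hn) (PT.natConst 0) hi.natSucc ?_ ?_
  · intro γ h
    generalize i γ = j at h
    generalize N γ = n at j h
    obtain _ | n := n
    · exact j.elim0
    · rw [coe_finRotate]; simp_all [Fin.ext_iff]
  · intro γ h
    generalize i γ = j at h
    generalize N γ = n at j h
    obtain _ | n := n
    · exact j.elim0
    · rw [coe_finRotate]; simp_all [Fin.ext_iff]

variable {x y : ∀ γ, Fin (W γ).darts} {i i' : ∀ γ, Fin (N γ)} {j j' : Γ → ℕ}

theorem HasPre.nextOf (h : HasPre m e W) (hx : PT m e fun γ => ofNat (x γ)) :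
    PT m e fun γ => ofNat ((W γ).next (x γ)) :=
  PT.apply (F := fun γ x => ofNat ((W γ).next x)) h.bdd_darts h.next hx

theorem HasPre.revOf (h : HasPre m e W) (hx : PT m e fun γ => ofNat (x γ)) :
    PT m e fun γ => ofNat ((W γ).rev (x γ)) :=
  PT.apply (F := fun γ x => ofNat ((W γ).rev x)) h.bdd_darts h.rev hx

theorem HasPre.cornerOf (h : HasPre m e W) (hi : PT m e fun γ => ofNat (i γ)) :
    PT m e fun γ => ofNat ((W γ).corner (i γ)) :=
  PT.apply (F := fun γ x => ofNat ((W γ).corner x)) h.bdd_sides h.corner hi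

theorem HasPre.crossOf (h : HasPre m e W) (hi : PT m e fun γ => ofNat (i γ)) :
    PT m e fun γ => ofNat ((W γ).cross (i γ)) :=
  PT.apply (F := fun γ x => ofNat ((W γ).cross x)) h.bdd_sides h.cross hi

theorem HasPre.bddCross (h : HasPre m e W) (i : ∀ γ, Fin (N γ)) :
    Bdd m fun γ => (W γ).cross (i γ) :=
  let ⟨_, hB, hB'⟩ := h.bdd_cross
  hB.mono fun γ => hB' γ (i γ)

theorem HasPre.sameCycle (h : HasPre m e W) (hx : PT m e fun γ => ofNat (x γ))
    (hy : PT m e fun γ => ofNat (y γ)) : PD m e fun γ => (W γ).next.SameCycle (x γ) (y γ) :=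
  PD.sameCycle h.bdd_darts h.darts h.next hx hy

theorem HasPre.eqDart (h : HasPre m e W) (hx : PT m e fun γ => ofNat (x γ))
    (hy : PT m e fun γ => ofNat (y γ)) : PD m e fun γ => x γ = y γ :=
  PD.finEq h.bdd_darts hx hy

/-- The dart at position `j` on side `i`. -/
def PreTopology.piece {N : ℕ} (W : PreTopology N) (i : Fin N) (j : ℕ) : Fin W.darts :=
  ((W.next * W.rev) ^ j) (W.corner i)

theorem HasPre.pieceOf (h : HasPre m e W) (hi : PT m e fun γ => ofNat (i γ)) (hJ : Bdd m j)
    (hj : PT m e fun γ => ofNat (j γ)) : PT m e fun γ => ofNat ((W γ).piece (i γ) (j γ)) := by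
  refine (PT.iterate (F := fun γ x => (W γ).next ((W γ).rev x)) (x := fun γ => (W γ).corner (i γ))
    hJ h.bdd_darts ?_ (h.cornerOf hi) hj).congr fun γ => ?_
  · exact PT.table h.bdd_darts h.darts (h.ext.nextOf (h.ext.revOf PT.var))
  · rw [PreTopology.piece, ← Equiv.Perm.iterate_eq_pow]; rfl

/-- The conditions of `Topology`. -/
structure PreTopology.IsTopology {N : ℕ} (W : PreTopology N) : Prop where
  rev_rev : ∀ x, W.rev (W.rev x) = x
  rev_ne : ∀ x, W.rev x ≠ x
  connected : ∀ x y, Relation.EqvGen (fun a b => b = W.next a ∨ b = W.rev a) x y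
  planar : numCycles W.next + numCycles (W.next⁻¹ * W.rev) = numCycles W.rev + 2
  side_end : ∀ i, W.piece i (W.cross i + 1) = W.corner (finRotate N i)
  outer_simple : ∀ i i' j, j ≤ W.cross i → ∀ j', j' ≤ W.cross i' →
    W.next.SameCycle (W.piece i j) (W.piece i' j') → i = i' ∧ j = j'

/-- The topology with given underlying data. -/
def PreTopology.IsTopology.toTopology {N : ℕ} {W : PreTopology N} (h : W.IsTopology) :
    Topology N where
  __ := W
  rev_rev := h.rev_rev
  rev_ne := h.rev_ne
  connected := h.connected
  planar := h.planar
  side_end := h.side_end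
  outer_simple i i' j j' hj hj' := h.outer_simple i i' j hj j' hj'

theorem Topology.isTopology_toPre {N : ℕ} (U : Topology N) : U.toPre.IsTopology where
  rev_rev := U.rev_rev
  rev_ne := U.rev_ne
  connected := U.connected
  planar := U.planar
  side_end := U.side_end
  outer_simple i i' j hj j' hj' := U.outer_simple i i' j j' hj hj'

theorem numCycles_inv {d : ℕ} (f : Equiv.Perm (Fin d)) : numCycles f⁻¹ = numCycles f := by
  unfold numCycles
  refine Nat.card_congr (Quotient.congrRight fun x y => ?_)
  exact Equiv.Perm.sameCycle_inv

/-- No table of `next⁻¹` is at hand. The faces are counted as the cycles of the inverse permutation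
`rev⁻¹ * next`, and `rev⁻¹` is `rev` as soon as `rev` is an involution. That condition is therefore
tested first, and the others on the contexts that satisfy it. -/
theorem HasPre.isTopology (h : HasPre m e W) : PD m e fun γ => (W γ).IsTopology := by
  have key : PD m e fun γ => (∀ x, (W γ).rev ((W γ).rev x) = x) ∧ (∀ x, ¬ (W γ).rev x = x) ∧
      (∀ x y, Relation.EqvGen (fun a b => b = (W γ).next a ∨ b = (W γ).rev a) x y) ∧
      (numCycles (W γ).next + numCycles ((W γ).rev⁻¹ * (W γ).next) = numCycles (W γ).rev + 2) ∧
      (∀ i, (W γ).piece i ((W γ).cross i + 1) = (W γ).corner (finRotate (N γ) i)) ∧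
      ∀ i i' j, j ≤ (W γ).cross i → ∀ j', j' ≤ (W γ).cross i' →
        (W γ).next.SameCycle ((W γ).piece i j) ((W γ).piece i' j') → i = i' ∧ j = j' := by
    refine PD.and_of ?_ ?_
    · exact PD.forallFin h.bdd_darts h.darts (h.ext.eqDart (h.ext.revOf (h.ext.revOf PT.var)) PT.var)
    have h := h.pull (Subtype.val : {γ // ∀ x, (W γ).rev ((W γ).rev x) = x} → Γ)
    refine PD.and ?_ (PD.and ?_ (PD.and ?_ (PD.and ?_ ?_)))
    · exact PD.forallFin h.bdd_darts h.darts (h.ext.eqDart (h.ext.revOf PT.var) PT.var).not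
    · refine PD.forallFin h.bdd_darts h.darts (PD.forallFin h.ext.bdd_darts h.ext.darts ?_)
      refine PD.eqvGen h.ext.ext.bdd_darts h.ext.ext.darts ?_ (PT.wk PT.var) PT.var
      exact PD.or
        (h.ext.ext.ext.ext.eqDart PT.var (h.ext.ext.ext.ext.nextOf (PT.wk PT.var)))
        (h.ext.ext.ext.ext.eqDart PT.var (h.ext.ext.ext.ext.revOf (PT.wk PT.var)))
    · have hface : PT (fun γ : {γ // ∀ x, (W γ).rev ((W γ).rev x) = x} => m γ) (fun γ => e γ) fun γ =>
          ofNat (numCycles ((W γ).rev⁻¹ * (W γ).next)) := by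
        refine (PT.numCycles h.bdd_darts (f := fun γ => (W γ.1).rev⁻¹ * (W γ.1).next) h.darts ?_)
        refine (PT.table h.bdd_darts h.darts (b := fun γ x => ofNat ((W γ.1).rev ((W γ.1).next x)))
          (h.ext.revOf (h.ext.nextOf PT.var))).congr fun γ => ?_
        congr! 3 with x
        rw [Equiv.Perm.mul_apply]
        congr 1
        exact Equiv.Perm.inv_eq_iff_eq.2 (γ.2 _).symm
      have hb : ∀ f : ∀ γ : {γ // ∀ x, (W γ).rev ((W γ).rev x) = x}, Equiv.Perm (Fin (W γ).darts),
          Bdd (fun γ : {γ // ∀ x, (W γ).rev ((W γ).rev x) = x} => m γ)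
            fun γ => numCycles (f γ) := fun f => h.bdd_darts.mono fun γ => numCycles_le _
      exact PD.natEq ((hb _).add (hb _)) ((hb _).add (Bdd.const 2))
        (PT.natAdd (hb _) (PT.numCycles h.bdd_darts h.darts h.next) hface)
        (PT.natAdd (Bdd.const 2) (PT.numCycles h.bdd_darts h.darts h.rev) (PT.natConst 2))
    · refine PD.forallFin h.bdd_sides h.sides ?_
      exact h.ext.eqDart (h.ext.pieceOf PT.var (h.ext.bddCross _).succ (h.ext.crossOf PT.var).natSucc)
        (h.ext.cornerOf (PT.finRotate h.ext.bdd_sides h.ext.sides PT.var))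
    · refine PD.forallFin h.bdd_sides h.sides (PD.forallFin h.ext.bdd_sides h.ext.sides ?_)
      refine PD.forallLe (h.ext.ext.bddCross _) (h.ext.ext.crossOf (PT.wk PT.var)) ?_
      refine PD.forallLe (h.ext.ext.ext.bddCross _) (h.ext.ext.ext.crossOf (PT.wk PT.var)) ?_
      have h2 := (h.ext (M := fun γ => N γ)).ext (M := fun δ => N δ.1)
      have h3 := h2.ext (M := fun δ => (W δ.1.1).cross δ.1.2 + 1)
      have h4 := h3.ext (M := fun δ => (W δ.1.1.1).cross δ.1.2 + 1)
      have hj := (h2.bddCross fun δ => δ.1.2).succ.var.ext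
        (M := fun δ => (W δ.1.1.1).cross δ.1.2 + 1)
      have hj' := (h3.bddCross fun δ => δ.1.2).succ.var
      refine PD.imp (h4.sameCycle (h4.pieceOf (PT.wk (PT.wk (PT.wk PT.var))) hj (PT.wk PT.var))
        (h4.pieceOf (PT.wk (PT.wk PT.var)) hj' PT.var)) (PD.and
          (PD.finEq h4.bdd_sides (PT.wk (PT.wk (PT.wk PT.var))) (PT.wk (PT.wk PT.var)))
          (PD.natEq hj hj' (PT.wk PT.var) PT.var))
  refine key.congr fun γ => ?_
  rw [← numCycles_inv ((W γ).rev⁻¹ * (W γ).next), mul_inv_rev, inv_inv]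
  exact ⟨fun h => ⟨h.1, h.2, h.3, h.4, h.5, h.6⟩,
    fun ⟨h1, h2, h3, h4, h5, h6⟩ => ⟨h1, h2, h3, h4, h5, h6⟩⟩

end

end


/-! ### Tests for the boundary, the degrees and the absence of cycles -/

section

variable {Γ : Type} {m : Γ → ℕ} {e : Γ → Data} {N : Γ → ℕ} {U : ∀ γ, Topology (N γ)}
  {x y : ∀ γ, Fin (U γ).darts} {i : ∀ γ, Fin (N γ)}

theorem HasPre.isOuter (h : HasPre m e fun γ => (U γ).toPre) (hx : PT m e fun γ => ofNat (x γ)) :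
    PD m e fun γ => (U γ).IsOuter (x γ) := by
  refine PD.existsFin h.bdd_sides h.sides ?_
  have h1 := h.ext (M := N)
  refine PD.existsLe (h1.bddCross fun δ => δ.2) (h1.crossOf PT.var) ?_
  have h2 := h1.ext (M := fun δ => (U δ.1).cross δ.2 + 1)
  have hp := h2.pieceOf (PT.wk PT.var) (h1.bddCross fun δ => δ.2).succ.var PT.var
  exact (h2.eqDart hx.wkFin.wkFin hp).or (h2.eqDart (h2.revOf hx.wkFin.wkFin) hp)

theorem HasPre.onSide (h : HasPre m e fun γ => (U γ).toPre) (hi : PT m e fun γ => ofNat (i γ))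
    (hx : PT m e fun γ => ofNat (x γ)) : PD m e fun γ => (U γ).OnSide (i γ) (x γ) := by
  refine PD.existsLe (h.bddCross i) (h.crossOf hi) ?_
  have h1 := h.ext (M := fun γ => (U γ).cross (i γ) + 1)
  exact h1.sameCycle (h1.pieceOf hi.wkFin (h.bddCross i).succ.var PT.var) hx.wkFin

theorem HasPre.onBoundary (h : HasPre m e fun γ => (U γ).toPre)
    (hx : PT m e fun γ => ofNat (x γ)) : PD m e fun γ => (U γ).OnBoundary (x γ) :=
  PD.existsFin h.bdd_sides h.sides (h.ext.onSide PT.var hx.wkFin)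

theorem HasPre.interior (h : HasPre m e fun γ => (U γ).toPre)
    (hx : PT m e fun γ => ofNat (x γ)) : PD m e fun γ => x γ ∈ (U γ).interior :=
  (h.isOuter hx).not

theorem HasPre.isTreeDart (h : HasPre m e fun γ => (U γ).toPre)
    (hx : PT m e fun γ => ofNat (x γ)) : PD m e fun γ => (U γ).IsTreeDart (x γ) :=
  (h.interior hx).and ((h.onBoundary hx).and (h.onBoundary (h.revOf hx))).not

theorem HasPre.degree_eq_one (h : HasPre m e fun γ => (U γ).toPre)
    (hx : PT m e fun γ => ofNat (x γ)) : PD m e fun γ => (U γ).degree (x γ) = 1 :=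
  (h.eqDart (h.nextOf hx) hx).congr fun _ => Function.minimalPeriod_eq_one_iff_isFixedPt

/-- Only the degrees 1, 2 and 3 occur in the definitions. Since 2 and 3 are prime, a minimal period
2 or 3 is recognized by one iterate that fixes the dart while `next` does not. -/
theorem HasPre.degree_eq_two (h : HasPre m e fun γ => (U γ).toPre)
    (hx : PT m e fun γ => ofNat (x γ)) : PD m e fun γ => (U γ).degree (x γ) = 2 :=
  ((h.eqDart (h.nextOf (h.nextOf hx)) hx).and (h.eqDart (h.nextOf hx) hx).not).congr fun _ =>
    haveI : Fact (Nat.Prime 2) := ⟨Nat.prime_two⟩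
    Function.minimalPeriod_eq_prime_iff

theorem HasPre.degree_eq_three (h : HasPre m e fun γ => (U γ).toPre)
    (hx : PT m e fun γ => ofNat (x γ)) : PD m e fun γ => (U γ).degree (x γ) = 3 :=
  ((h.eqDart (h.nextOf (h.nextOf (h.nextOf hx))) hx).and (h.eqDart (h.nextOf hx) hx).not).congr
    fun _ =>
      haveI : Fact (Nat.Prime 3) := ⟨Nat.prime_three⟩
      Function.minimalPeriod_eq_prime_iff

theorem HasPre.connects (h : HasPre m e fun γ => (U γ).toPre)
    {A : ∀ γ, Set (Fin (U γ).darts)} (hA : PD (fun δ : Ext fun γ => (U γ).darts => m δ.1)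
      (fun δ => Data.cons (ofNat δ.2) (e δ.1)) fun δ => δ.2 ∈ A δ.1)
    (hx : PT m e fun γ => ofNat (x γ)) (hy : PT m e fun γ => ofNat (y γ)) :
    PD m e fun γ => (U γ).Connects (A γ) (x γ) (y γ) := by
  refine PD.eqvGen h.bdd_darts h.darts ?_ hx hy
  have h2 := h.ext.ext (M := fun δ : Ext fun γ => (U γ).darts => (U δ.1).darts)
  refine (h2.sameCycle (PT.wk PT.var) PT.var).or (PD.and ?_ (h2.eqDart PT.var (h2.revOf (PT.wk PT.var))))
  exact PT.wk (hA.pull _)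

theorem HasPre.forest (h : HasPre m e fun γ => (U γ).toPre) : PD m e fun γ =>
    ∀ x ∈ (U γ).interior, ¬ (U γ).Connects ((U γ).interior \ {x, (U γ).rev x}) x ((U γ).rev x) := by
  refine PD.forallFin h.bdd_darts h.darts (PD.imp (h.ext.interior PT.var) (PD.not ?_))
  refine h.ext.connects ?_ PT.var (h.ext.revOf PT.var)
  have h2 := h.ext.ext (M := fun δ : Ext fun γ => (U γ).darts => (U δ.1).darts)
  exact (h2.interior PT.var).and ((h2.eqDart PT.var (PT.wk PT.var)).or
    (h2.eqDart PT.var (h2.revOf (PT.wk PT.var)))).not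

end

/-! ### Tests on the glued surface, and the test of validity -/

section

variable {Γ : Type} {m : Γ → ℕ} {e : Γ → Data} {I : Γ → Instance}
  {U : ∀ γ, Topology (2 * (I γ).K.edges)} {x y : ∀ γ, Fin (U γ).darts}
  {i : ∀ γ, Fin (2 * (I γ).K.edges)} {j : Γ → ℕ}

theorem HasInst.mateOf (hI : HasInst m e I) (hi : PT m e fun γ => ofNat (i γ)) :
    PT m e fun γ => ofNat ((I γ).K.mate (i γ)) :=
  PT.apply (F := fun γ x => ofNat ((I γ).K.mate x)) hI.bdd_sides hI.mate hi

theorem HasInst.twistOf (hI : HasInst m e I) (hi : PT m e fun γ => ofNat (i γ)) :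
    PD m e fun γ => (I γ).K.twist (i γ) = true :=
  PD.ofBool (PT.apply (F := fun γ x => ofBool ((I γ).K.twist x)) hI.bdd_sides hI.twist hi)

theorem HasPre.generalPosition (hI : HasInst m e I) (h : HasPre m e fun γ => (U γ).toPre) :
    PD m e fun γ => (U γ).GeneralPosition := by
  have key : PD m e fun γ => (∀ i, (U γ).cross ((I γ).K.mate i) = (U γ).cross i) ∧
      (∀ i, (U γ).degree ((U γ).corner i) = 2) ∧
      ∀ i j, j ≤ (U γ).cross i → 1 ≤ j → (U γ).degree ((U γ).piece i j) = 3 := by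
    refine PD.and ?_ (PD.and ?_ ?_)
    · exact PD.forallFin h.bdd_sides h.sides (PD.natEq (h.ext.bddCross _) (h.ext.bddCross _)
        (h.ext.crossOf (hI.ext.mateOf PT.var)) (h.ext.crossOf PT.var))
    · exact PD.forallFin h.bdd_sides h.sides (h.ext.degree_eq_two (h.ext.cornerOf PT.var))
    · refine PD.forallFin h.bdd_sides h.sides ?_
      have h1 := h.ext (M := fun γ => 2 * (I γ).K.edges)
      refine PD.forallLe (h1.bddCross fun δ => δ.2) (h1.crossOf PT.var) ?_
      have h2 := h1.ext (M := fun δ => (U δ.1).cross δ.2 + 1)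
      have hj := (h1.bddCross fun δ => δ.2).succ.var
      exact PD.imp (PD.natLe hj (PT.natConst 1) PT.var)
        (h2.degree_eq_three (h2.pieceOf (PT.wk PT.var) hj PT.var))
  exact key.congr fun γ => ⟨fun h => ⟨h.1, h.2, fun i j h1 h2 => h.3 i j h2 h1⟩,
    fun ⟨h1, h2, h3⟩ => ⟨h1, h2, fun i j h4 h5 => h3 i j h5 h4⟩⟩

theorem HasPre.bddGlue (h : HasPre m e fun γ => (U γ).toPre) (hJ : Bdd m j) :
    Bdd m fun γ => (U γ).glue (i γ) (j γ) :=
  (hJ.add (h.bddCross i)).mono fun γ => by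
    unfold Topology.glue; split <;> simp; omega

theorem HasPre.glueOf (hI : HasInst m e I) (h : HasPre m e fun γ => (U γ).toPre)
    (hi : PT m e fun γ => ofNat (i γ)) (hJ : Bdd m j) (hj : PT m e fun γ => ofNat (j γ)) :
    PT m e fun γ => ofNat ((U γ).glue (i γ) (j γ)) :=
  PT.ite (hI.twistOf hi) hj (PT.natSub hJ (h.crossOf hi) hj)
    (fun γ h => by simp [Topology.glue, h]) (fun γ h => by simp [Topology.glue, h])

theorem HasPre.bddGluePoint (h : HasPre m e fun γ => (U γ).toPre) (hJ : Bdd m j) :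
    Bdd m fun γ => (U γ).gluePoint (i γ) (j γ) :=
  (hJ.add (h.bddCross i).succ).mono fun γ => by
    unfold Topology.gluePoint; split <;> simp; omega

theorem HasPre.gluePointOf (hI : HasInst m e I) (h : HasPre m e fun γ => (U γ).toPre)
    (hi : PT m e fun γ => ofNat (i γ)) (hJ : Bdd m j) (hj : PT m e fun γ => ofNat (j γ)) :
    PT m e fun γ => ofNat ((U γ).gluePoint (i γ) (j γ)) :=
  PT.ite (hI.twistOf hi) hj (PT.natSub hJ (h.crossOf hi).natSucc hj)
    (fun γ h => by simp [Topology.gluePoint, h]) (fun γ h => by simp [Topology.gluePoint, h])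

theorem HasPre.connectsInSurface (hI : HasInst m e I) (h : HasPre m e fun γ => (U γ).toPre)
    (hx : PT m e fun γ => ofNat (x γ)) (hy : PT m e fun γ => ofNat (y γ)) :
    PD m e fun γ => (U γ).ConnectsInSurface (x γ) (y γ) := by
  refine PD.eqvGen h.bdd_darts h.darts ?_ hx hy
  have h2 := h.ext.ext (M := fun δ : Ext fun γ => (U γ).darts => (U δ.1).darts)
  refine (h2.sameCycle (PT.wk PT.var) PT.var).or (PD.or ((h2.interior (PT.wk PT.var)).and
    (h2.eqDart PT.var (h2.revOf (PT.wk PT.var)))) ?_)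
  refine PD.existsFin h2.bdd_sides h2.sides (PD.congr (P := fun δ => ∃ j, j ≤ (U δ.1.1.1).cross δ.2 ∧
    1 ≤ j ∧ δ.1.1.2 = (U δ.1.1.1).piece δ.2 j ∧ δ.1.2 = (U δ.1.1.1).piece ((I δ.1.1.1).K.mate δ.2)
      ((U δ.1.1.1).gluePoint δ.2 j)) ?_ fun δ => exists_congr fun j => and_left_comm)
  have h3 := h2.ext (M := fun δ => 2 * (I δ.1.1).K.edges)
  refine PD.existsLe (h3.bddCross fun δ => δ.2) (h3.crossOf PT.var) ?_
  have h4 := h3.ext (M := fun δ => (U δ.1.1.1).cross δ.2 + 1)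
  have hj := (h3.bddCross fun δ => δ.2).succ.var
  refine PD.and (PD.natLe hj (PT.natConst 1) PT.var) (PD.and
    (h4.eqDart (PT.wk (PT.wk (PT.wk PT.var))) (h4.pieceOf (PT.wk PT.var) hj PT.var))
    (h4.eqDart (PT.wk (PT.wk PT.var)) (h4.pieceOf (hI.ext.ext.ext.ext.mateOf (PT.wk PT.var))
      (h4.bddGluePoint hj) (h4.gluePointOf hI.ext.ext.ext.ext (PT.wk PT.var) hj PT.var))))

theorem HasPre.sameFace (hI : HasInst m e I) (h : HasPre m e fun γ => (U γ).toPre)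
    (hx : PT m e fun γ => ofNat (x γ)) (hy : PT m e fun γ => ofNat (y γ)) :
    PD m e fun γ => (U γ).SameFace (x γ) (y γ) := by
  refine PD.eqvGen h.bdd_darts h.darts ?_ hx hy
  have h2 := h.ext.ext (M := fun δ : Ext fun γ => (U γ).darts => (U δ.1).darts)
  refine PD.or ?_ ?_
  -- The face permutation is again replaced by its inverse, which has the same cycles and does not
  -- involve `next⁻¹`.
  · refine PD.congr (PD.sameCycle (f := fun δ => (U δ.1.1).rev * (U δ.1.1).next) h2.bdd_darts
      h2.darts (PT.table h2.bdd_darts h2.darts (h2.ext.revOf (h2.ext.nextOf PT.var)))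
      (PT.wk PT.var) PT.var) fun δ => ?_
    have hrev : (U δ.1.1).rev⁻¹ = (U δ.1.1).rev :=
      Equiv.ext fun x => Equiv.Perm.inv_eq_iff_eq.2 ((U δ.1.1).rev_rev x).symm
    rw [← Equiv.Perm.sameCycle_inv, mul_inv_rev, inv_inv, hrev]
  · refine PD.existsFin h2.bdd_sides h2.sides ?_
    have h3 := h2.ext (M := fun δ => 2 * (I δ.1.1).K.edges)
    refine PD.existsLe (h3.bddCross fun δ => δ.2) (h3.crossOf PT.var) ?_
    have h4 := h3.ext (M := fun δ => (U δ.1.1.1).cross δ.2 + 1)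
    have hj := (h3.bddCross fun δ => δ.2).succ.var
    refine PD.and
      (h4.eqDart (PT.wk (PT.wk (PT.wk PT.var))) (h4.pieceOf (PT.wk PT.var) hj PT.var))
      (h4.eqDart (PT.wk (PT.wk PT.var)) (h4.pieceOf (hI.ext.ext.ext.ext.mateOf (PT.wk PT.var))
        (h4.bddGlue hj) (h4.glueOf hI.ext.ext.ext.ext (PT.wk PT.var) hj PT.var)))

theorem HasPre.isOverlay (hI : HasInst m e I) (h : HasPre m e fun γ => (U γ).toPre) :
    PD m e fun γ => (U γ).IsOverlay := by
  refine PD.congr (PD.and (h.generalPosition hI) (Q := fun γ => (U γ).FormsGraph) ?_)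
    fun γ => ⟨fun h => ⟨h.1, h.2⟩, fun h => ⟨h.1, h.2⟩⟩
  refine PD.forallFin h.bdd_darts h.darts (PD.imp (h.ext.interior PT.var)
    (PD.existsFin h.ext.bdd_darts h.ext.darts ?_))
  exact (h.ext.ext.onBoundary PT.var).not.and
    (h.ext.ext.connectsInSurface hI.ext.ext (PT.wk PT.var) PT.var)

theorem HasPre.isGood (h : HasPre m e fun γ => (U γ).toPre) {p q : Γ → ℕ}
    (hP : Bdd m p) (hp : PT m e fun γ => ofNat (p γ)) (hQ : Bdd m q)
    (hq : PT m e fun γ => ofNat (q γ)) : PD m e fun γ => (U γ).IsGood (p γ) (q γ) := by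
  have key : PD m e fun γ =>
      (∀ x ∈ (U γ).interior,
        ¬ (U γ).Connects ((U γ).interior \ {x, (U γ).rev x}) x ((U γ).rev x)) ∧
      (∀ x, (U γ).degree x = 1 → (U γ).OnBoundary x) ∧
      (∀ x ∈ (U γ).interior, ∀ i i', (U γ).OnSide i x → (U γ).OnSide i' ((U γ).rev x) → ¬ i = i') ∧
      (∀ i, (U γ).cross i ≤ p γ) ∧ Nat.card {x // (U γ).IsTreeDart x} ≤ 2 * q γ := by
    refine PD.and h.forest (PD.and ?_ (PD.and ?_ (PD.and ?_ ?_)))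
    · exact PD.forallFin h.bdd_darts h.darts
        (PD.imp (h.ext.degree_eq_one PT.var) (h.ext.onBoundary PT.var))
    · refine PD.forallFin h.bdd_darts h.darts (PD.imp (h.ext.interior PT.var) ?_)
      refine PD.forallFin h.ext.bdd_sides h.ext.sides
        (PD.forallFin h.ext.ext.bdd_sides h.ext.ext.sides ?_)
      have h1 := h.ext (M := fun γ => (U γ).darts)
      have h2 := h1.ext (M := fun δ => 2 * (I δ.1).K.edges)
      have h3 := h2.ext (M := fun δ => 2 * (I δ.1.1).K.edges)
      exact PD.imp (h3.onSide (PT.wk PT.var) (PT.wk (PT.wk PT.var)))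
        (PD.imp (h3.onSide PT.var (h3.revOf (PT.wk (PT.wk PT.var))))
          (PD.finEq h3.bdd_sides (PT.wk PT.var) PT.var).not)
    · exact PD.forallFin h.bdd_sides h.sides (PD.natLe hP.ext (h.ext.crossOf PT.var) hp.wkFin)
    · exact PD.natLe ((Bdd.const 2).mul hQ)
        (PT.card h.bdd_darts h.darts (h.ext.isTreeDart PT.var))
        (PT.natMul (Bdd.const 2) hQ (PT.natConst 2) hq)
  exact key.congr fun γ => ⟨fun h => ⟨h.1, h.2, h.3, h.4, h.5⟩,
    fun ⟨h1, h2, h3, h4, h5⟩ => ⟨h1, h2, h3, h4, h5⟩⟩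

theorem HasPre.isMulticutDual (hI : HasInst m e I) (h : HasPre m e fun γ => (U γ).toPre) :
    PD m e fun γ => (I γ).IsMulticutDual (U γ) := by
  refine PD.forallFin hI.bdd_terminals hI.terminals
    (PD.forallFin hI.ext.bdd_terminals hI.ext.terminals ?_)
  have hI1 := hI.ext (M := fun γ => (I γ).t)
  have hI2 := hI1.ext (M := fun δ => (I δ.1).t)
  have h2 := (h.ext (M := fun γ => (I γ).t)).ext (M := fun δ => (I δ.1).t)
  refine PD.imp ?_ (PD.not (h2.sameFace hI2 (h2.cornerOf ?_) (h2.cornerOf ?_)))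
  · refine (PD.ofBool (c := fun δ => decide (s(δ.1.2, δ.2) ∈ (I δ.1.1).pairs)) ?_).congr
      fun δ => by simp
    exact PT.apply (N := fun (δ : Ext fun δ : Ext fun γ => (I γ).t => (I δ.1).t) => (I δ.1.1).t)
      (F := fun (δ : Ext fun δ : Ext fun γ => (I γ).t => (I δ.1).t) b => ofBool (decide (s(δ.1.2, b) ∈ (I δ.1.1).pairs)))
      hI2.bdd_terminals (PT.apply (N := fun (δ : Ext fun δ : Ext fun γ => (I γ).t => (I δ.1).t) => (I δ.1.1).t)
        (F := fun (δ : Ext fun δ : Ext fun γ => (I γ).t => (I δ.1).t) a => ofFun fun b : Fin (I δ.1.1).t =>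
        ofBool (decide (s(a, b) ∈ (I δ.1.1).pairs))) hI2.bdd_terminals hI2.pairs (PT.wk PT.var))
      PT.var
  · exact PT.apply (F := fun δ a => ofNat ((I δ.1.1).terminal a)) hI2.bdd_terminals hI2.terminal
      (PT.wk PT.var)
  · exact PT.apply (F := fun δ a => ofNat ((I δ.1.1).terminal a)) hI2.bdd_terminals hI2.terminal
      PT.var

theorem HasPre.isValid (hI : HasInst m e I) (h : HasPre m e fun γ => (U γ).toPre) (a b : ℕ) :
    PD m e fun γ => (I γ).IsValid a b (U γ) := by
  have hn := PT.natAdd hI.bdd_terminals hI.genus hI.terminals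
  have hN := hI.bdd_genus.add hI.bdd_terminals
  refine PD.congr ((h.isOverlay hI).and ((h.isGood ((Bdd.const a).mul hN)
    (PT.natMul (Bdd.const a) hN (PT.natConst a) hn) ((Bdd.const b).mul hN)
    (PT.natMul (Bdd.const b) hN (PT.natConst b) hn)).and (h.isMulticutDual hI)))
    fun γ => ⟨fun h => ⟨h.1, h.2, h.3⟩, fun ⟨h1, h2, h3⟩ => ⟨h1, h2, h3⟩⟩

end


/-! ## Comparison of topologies -/

section Same

variable {N : ℕ} (U V : Topology N)

/-- A pair of darts of two topologies. -/
def dartPair (x : Fin U.darts) (y : Fin V.darts) : Fin (U.darts * V.darts) :=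
  finProdFinEquiv (x, y)

variable {U V} in
theorem dartPair_inj {x x' : Fin U.darts} {y y' : Fin V.darts} :
    dartPair U V x y = dartPair U V x' y' ↔ x = x' ∧ y = y' := by
  simp [dartPair]

/-- Simultaneous steps in two topologies. -/
def PairStep (p q : Fin (U.darts * V.darts)) : Prop :=
  ∃ x y, p = dartPair U V x y ∧
    (q = dartPair U V (U.next x) (V.next y) ∨ q = dartPair U V (U.rev x) (V.rev y))

/-- The darts `x` and `y` are reached by the same walk, which starts from the given darts. -/
def Matches (c : Fin U.darts) (c' : Fin V.darts) (x : Fin U.darts) (y : Fin V.darts) : Prop :=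
  Relation.EqvGen (PairStep U V) (dartPair U V c c') (dartPair U V x y)

variable {U V}

theorem Matches.next_iff {c c' x y} :
    Matches U V c c' (U.next x) (V.next y) ↔ Matches U V c c' x y := by
  have h : Relation.EqvGen (PairStep U V) (dartPair U V x y)
      (dartPair U V (U.next x) (V.next y)) := Relation.EqvGen.rel _ _ ⟨x, y, rfl, Or.inl rfl⟩
  exact ⟨fun h' => h'.trans _ _ _ h.symm, fun h' => h'.trans _ _ _ h⟩

theorem Matches.rev_iff {c c' x y} :
    Matches U V c c' (U.rev x) (V.rev y) ↔ Matches U V c c' x y := by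
  have h : Relation.EqvGen (PairStep U V) (dartPair U V x y)
      (dartPair U V (U.rev x) (V.rev y)) := Relation.EqvGen.rel _ _ ⟨x, y, rfl, Or.inr rfl⟩
  exact ⟨fun h' => h'.trans _ _ _ h.symm, fun h' => h'.trans _ _ _ h⟩

/-- By connectedness, a walk in `U` leads from `c` to any dart, and each of its steps can be copied
in `V`, starting from `c'`. -/
theorem exists_of_invariant (U V : Topology N) {S : Fin U.darts → Fin V.darts → Prop}
    (hn : ∀ x y, S (U.next x) (V.next y) ↔ S x y) (hr : ∀ x y, S (U.rev x) (V.rev y) ↔ S x y)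
    {c c'} (hc : S c c') (x : Fin U.darts) : ∃ y, S x y := by
  have key : ∀ x x', Relation.EqvGen (fun a b => b = U.next a ∨ b = U.rev a) x x' →
      ((∃ y, S x y) ↔ ∃ y, S x' y) := by
    intro x x' h
    induction h with
    | rel x x' h =>
      rcases h with rfl | rfl
      · exact ⟨fun ⟨y, h⟩ => ⟨_, (hn _ _).2 h⟩, fun ⟨y, h⟩ => ⟨V.next.symm y, (hn _ _).1 (by simpa)⟩⟩
      · exact ⟨fun ⟨y, h⟩ => ⟨_, (hr _ _).2 h⟩, fun ⟨y, h⟩ => ⟨V.rev.symm y, (hr _ _).1 (by simpa)⟩⟩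
    | refl => rfl
    | symm _ _ _ ih => exact ih.symm
    | trans _ _ _ _ _ ih1 ih2 => exact ih1.trans ih2
  exact (key c x (U.connected c x)).1 ⟨_, hc⟩

/-- An isomorphism of connected maps is determined by the image of one dart, and here corner `i₀`
must go to corner `i₀`. The pairs reached by simultaneous walks from there lie on the graph of any
renaming. Conversely, these pairs meet every dart of `U` and of `V` by connectedness, so if the
relation is single-valued in both directions it is a bijection, compatible with `next` and `rev` by
construction. -/
theorem Topology.same_iff (i₀ : Fin N) : U.Same V ↔ (∀ i, U.cross i = V.cross i) ∧
    (∀ i, Matches U V (U.corner i₀) (V.corner i₀) (U.corner i) (V.corner i)) ∧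
    (∀ x y y', Matches U V (U.corner i₀) (V.corner i₀) x y →
      Matches U V (U.corner i₀) (V.corner i₀) x y' → y = y') ∧
    ∀ y x x', Matches U V (U.corner i₀) (V.corner i₀) x y →
      Matches U V (U.corner i₀) (V.corner i₀) x' y → x = x' := by
  constructor
  · rintro ⟨e, hn, hr, hc, hx⟩
    have h1 : ∀ p q, Relation.EqvGen (PairStep U V) p q →
        ((∃ x, p = dartPair U V x (e x)) ↔ ∃ x, q = dartPair U V x (e x)) := by
      intro p q h
      induction h with
      | rel p q h =>
        obtain ⟨x, y, rfl, rfl | rfl⟩ := h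
        · simp only [dartPair_inj]
          constructor
          · rintro ⟨_, rfl, rfl⟩; exact ⟨_, rfl, (hn _).symm⟩
          · rintro ⟨_, rfl, h⟩; exact ⟨x, rfl, by rw [hn] at h; exact V.next.injective h⟩
        · simp only [dartPair_inj]
          constructor
          · rintro ⟨_, rfl, rfl⟩; exact ⟨_, rfl, (hr _).symm⟩
          · rintro ⟨_, rfl, h⟩; exact ⟨x, rfl, by rw [hr] at h; exact V.rev.injective h⟩
      | refl => rfl
      | symm _ _ _ ih => exact ih.symm
      | trans _ _ _ _ _ ih1 ih2 => exact ih1.trans ih2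
    have h2 : ∀ x y, Matches U V (U.corner i₀) (V.corner i₀) x y → y = e x := by
      intro x y h
      obtain ⟨x', hx'⟩ := (h1 _ _ h).1 ⟨U.corner i₀, by rw [hc]⟩
      obtain ⟨rfl, rfl⟩ := dartPair_inj.1 hx'
      rfl
    have h3 : ∀ i, Matches U V (U.corner i₀) (V.corner i₀) (U.corner i) (V.corner i) := by
      intro i
      obtain ⟨y, hy⟩ := exists_of_invariant U V (S := Matches U V (U.corner i₀) (V.corner i₀))
        (fun _ _ => Matches.next_iff) (fun _ _ => Matches.rev_iff) (Relation.EqvGen.refl _)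
        (U.corner i)
      have := h2 _ _ hy
      rw [hc] at this
      rwa [this] at hy
    refine ⟨hx, h3, fun x y y' h h' => (h2 _ _ h).trans (h2 _ _ h').symm, fun y x x' h h' => ?_⟩
    exact e.injective ((h2 _ _ h).symm.trans (h2 _ _ h'))
  · rintro ⟨hx, hc, hf, hi⟩
    choose f hf' using exists_of_invariant U V (S := Matches U V (U.corner i₀) (V.corner i₀))
      (fun _ _ => Matches.next_iff) (fun _ _ => Matches.rev_iff) (Relation.EqvGen.refl _)
    -- The same relation read from `V` to `U`: the connectedness of `V` gives surjectivity.
    have hs := exists_of_invariant V U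
      (S := fun y x => Matches U V (U.corner i₀) (V.corner i₀) x y)
      (fun _ _ => Matches.next_iff) (fun _ _ => Matches.rev_iff) (Relation.EqvGen.refl _)
    refine ⟨Equiv.ofBijective f ⟨fun x x' h => hi (f x') x x' (h ▸ hf' x) (hf' x'), fun y => ?_⟩,
      fun x => ?_, fun x => ?_, fun i => ?_, hx⟩
    · obtain ⟨x, hx⟩ := hs y
      exact ⟨x, hf _ _ _ (hf' x) hx⟩
    · exact hf _ _ _ (hf' _) (Matches.next_iff.2 (hf' x))
    · exact hf _ _ _ (hf' _) (Matches.rev_iff.2 (hf' x))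
    · exact hf _ _ _ (hf' _) (hc i)

end Same

section

variable {Γ : Type} {m : Γ → ℕ} {e : Γ → Data} {N : Γ → ℕ} {U V : ∀ γ, Topology (N γ)}

theorem HasPre.dartPair (hU : HasPre m e fun γ => (U γ).toPre)
    (hV : HasPre m e fun γ => (V γ).toPre) {x : ∀ γ, Fin (U γ).darts} {y : ∀ γ, Fin (V γ).darts}
    (hx : PT m e fun γ => ofNat (x γ)) (hy : PT m e fun γ => ofNat (y γ)) :
    PT m e fun γ => ofNat (dartPair (U γ) (V γ) (x γ) (y γ)) := by
  have hB := hV.bdd_darts.mul (hU.bdd_darts.fin x)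
  exact (PT.natAdd hB hy (PT.natMul hV.bdd_darts (hU.bdd_darts.fin x) hV.darts hx)).congr
    fun γ => by simp [Multicut.dartPair]

theorem HasPre.matches (hU : HasPre m e fun γ => (U γ).toPre)
    (hV : HasPre m e fun γ => (V γ).toPre) {c x : ∀ γ, Fin (U γ).darts}
    {c' y : ∀ γ, Fin (V γ).darts} (hc : PT m e fun γ => ofNat (c γ))
    (hc' : PT m e fun γ => ofNat (c' γ))
    (hx : PT m e fun γ => ofNat (x γ)) (hy : PT m e fun γ => ofNat (y γ)) :
    PD m e fun γ => Matches (U γ) (V γ) (c γ) (c' γ) (x γ) (y γ) := by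
  have hB := hU.bdd_darts.mul hV.bdd_darts
  have hD := PT.natMul hU.bdd_darts hV.bdd_darts hU.darts hV.darts
  refine PD.eqvGen hB hD ?_ (hU.dartPair hV hc hc') (hU.dartPair hV hx hy)
  have hU2 := (hU.ext (M := fun γ => (U γ).darts * (V γ).darts)).ext
    (M := fun δ => (U δ.1).darts * (V δ.1).darts)
  have hV2 := (hV.ext (M := fun γ => (U γ).darts * (V γ).darts)).ext
    (M := fun δ => (U δ.1).darts * (V δ.1).darts)
  refine PD.existsFin hU2.bdd_darts hU2.darts ?_
  have hU3 := hU2.ext (M := fun δ => (U δ.1.1).darts)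
  have hV3 := hV2.ext (M := fun δ => (U δ.1.1).darts)
  refine PD.existsFin hV3.bdd_darts hV3.darts ?_
  have hU4 := hU3.ext (M := fun δ => (V δ.1.1.1).darts)
  have hV4 := hV3.ext (M := fun δ => (V δ.1.1.1).darts)
  have hB4 := hU4.bdd_darts.mul hV4.bdd_darts
  have v1 : PT (fun δ : Ext fun δ : Ext fun δ : Ext fun δ : Ext fun γ => (U γ).darts * (V γ).darts =>
      (U δ.1).darts * (V δ.1).darts => (U δ.1.1).darts => (V δ.1.1.1).darts => m δ.1.1.1.1)
      (fun δ => Data.cons (ofNat δ.2) (Data.cons (ofNat δ.1.2) (Data.cons (ofNat δ.1.1.2)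
        (Data.cons (ofNat δ.1.1.1.2) (e δ.1.1.1.1))))) fun δ => ofNat δ.1.2 := PT.wk PT.var
  refine PD.and (PD.finEq hB4 (PT.wk (PT.wk (PT.wk PT.var))) (hU4.dartPair hV4 v1 PT.var))
    (PD.or (PD.finEq hB4 (PT.wk (PT.wk PT.var)) (hU4.dartPair hV4 (hU4.nextOf v1)
      (hV4.nextOf PT.var))) (PD.finEq hB4 (PT.wk (PT.wk PT.var))
        (hU4.dartPair hV4 (hU4.revOf v1) (hV4.revOf PT.var))))

theorem HasPre.same (hN : ∀ γ, 0 < N γ) (hU : HasPre m e fun γ => (U γ).toPre)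
    (hV : HasPre m e fun γ => (V γ).toPre) : PD m e fun γ => (U γ).Same (V γ) := by
  refine PD.congr ?_ fun γ => Topology.same_iff (U := U γ) (V := V γ) ⟨0, hN γ⟩
  have h0 : PT m e fun γ => ofNat (⟨0, hN γ⟩ : Fin (N γ)) := PT.natConst 0
  have hc := hU.cornerOf h0
  have hc' := hV.cornerOf h0
  refine PD.and ?_ (PD.and ?_ (PD.and ?_ ?_))
  · exact PD.forallFin hU.bdd_sides hU.sides (PD.natEq (hU.ext.bddCross _) (hV.ext.bddCross _)
      (hU.ext.crossOf PT.var) (hV.ext.crossOf PT.var))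
  · exact PD.forallFin hU.bdd_sides hU.sides (hU.ext.matches hV.ext hc.wkFin hc'.wkFin
      (hU.ext.cornerOf PT.var) (hV.ext.cornerOf PT.var))
  · refine PD.forallFin hU.bdd_darts hU.darts ?_
    have hU1 := hU.ext (M := fun γ => (U γ).darts)
    have hV1 := hV.ext (M := fun γ => (U γ).darts)
    refine PD.forallFin hV1.bdd_darts hV1.darts ?_
    have hU2 := hU1.ext (M := fun δ => (V δ.1).darts)
    have hV2 := hV1.ext (M := fun δ => (V δ.1).darts)
    refine PD.forallFin hV2.bdd_darts hV2.darts ?_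
    have hU3 := hU2.ext (M := fun δ => (V δ.1.1).darts)
    have hV3 := hV2.ext (M := fun δ => (V δ.1.1).darts)
    exact PD.imp (hU3.matches hV3 (hc.wkFin.wkFin.wkFin) (hc'.wkFin.wkFin.wkFin)
      (PT.wk (PT.wk PT.var)) (PT.wk PT.var)) (PD.imp
      (hU3.matches hV3 (hc.wkFin.wkFin.wkFin) (hc'.wkFin.wkFin.wkFin)
      (PT.wk (PT.wk PT.var)) PT.var) (hV3.eqDart (PT.wk PT.var) PT.var))
  · refine PD.forallFin hV.bdd_darts hV.darts ?_
    have hU1 := hU.ext (M := fun γ => (V γ).darts)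
    have hV1 := hV.ext (M := fun γ => (V γ).darts)
    refine PD.forallFin hU1.bdd_darts hU1.darts ?_
    have hU2 := hU1.ext (M := fun δ => (U δ.1).darts)
    have hV2 := hV1.ext (M := fun δ => (U δ.1).darts)
    refine PD.forallFin hU2.bdd_darts hU2.darts ?_
    have hU3 := hU2.ext (M := fun δ => (U δ.1.1).darts)
    have hV3 := hV2.ext (M := fun δ => (U δ.1.1).darts)
    exact PD.imp (hU3.matches hV3 (hc.wkFin.wkFin.wkFin) (hc'.wkFin.wkFin.wkFin)
      (PT.wk PT.var) (PT.wk (PT.wk PT.var))) (PD.imp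
      (hU3.matches hV3 (hc.wkFin.wkFin.wkFin) (hc'.wkFin.wkFin.wkFin)
      PT.var (PT.wk (PT.wk PT.var))) (hU3.eqDart (PT.wk PT.var) PT.var))

end

/-! ## Lists -/

section Lists

variable {Γ : Type} {m : Γ → ℕ} {e : Γ → Data} {α β : Γ → Type} {l : ∀ γ, List (α γ)}
  {c : ∀ γ, α γ → Data} {d : ∀ γ, β γ → Data}

theorem Data.ofFun_get {α : Type} (l : List α) (c : α → Data) :
    (ofFun fun j : Fin l.length => c l[j]) = ofList (l.map c) := by
  rw [ofFun]; congr 1; apply List.ext_getElem <;> simp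

theorem PT.listMap {g : ∀ γ, α γ → β γ} (hN : Bdd m fun γ => (l γ).length)
    (hl : PT m e fun γ => ofList ((l γ).map (c γ)))
    (hg : PT (fun δ : Ext fun γ => (l γ).length => m δ.1)
      (fun δ => Data.cons (c δ.1 (l δ.1)[δ.2]) (e δ.1)) fun δ => d δ.1 (g δ.1 (l δ.1)[δ.2])) :
    PT m e fun γ => ofList (((l γ).map (g γ)).map (d γ)) :=
  (PT.mapFun (a := fun γ j => c γ (l γ)[j]) (b := fun γ j => d γ (g γ (l γ)[j])) hN
    (hl.congr fun γ => ofFun_get _ _) hg).congr fun γ => by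
      rw [ofFun_get (l γ) fun x => d γ (g γ x), List.map_map]; rfl

theorem PT.length (hN : Bdd m fun γ => (l γ).length)
    (hl : PT m e fun γ => ofList ((l γ).map (c γ))) : PT m e fun γ => ofNat (l γ).length :=
  (PT.listMap (g := fun _ x => x) (d := fun _ _ => Data.nil) hN hl PT.nil).congr fun γ => by
    simp [ofNat, List.map_const']

theorem PD.forallMem (hN : Bdd m fun γ => (l γ).length)
    (hl : PT m e fun γ => ofList ((l γ).map (c γ))) {P : ∀ γ, α γ → Prop}
    (hP : PD (fun δ : Ext fun γ => (l γ).length => m δ.1)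
      (fun δ => Data.cons (c δ.1 (l δ.1)[δ.2]) (e δ.1)) fun δ => P δ.1 (l δ.1)[δ.2]) :
    PD m e fun γ => ∀ x ∈ l γ, P γ x := by
  refine PD.congr (P := fun γ => ∀ j : Fin (l γ).length, P γ (l γ)[j])
    (PD.forallFin hN (PT.length hN hl) ?_) fun γ => List.forall_mem_iff_forall_getElem.trans
      ⟨fun h j => h j j.2, fun h j hj => h ⟨j, hj⟩⟩
  refine PT.comp (PT.cons ?_ (PT.tl PT.id)) hP
  exact PT.apply (F := fun (δ : Ext fun γ => (l γ).length) j => c δ.1 (l δ.1)[j]) (hN.pull _)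
    ((PT.wk (hl.pull _)).congr fun δ => ofFun_get _ _) PT.var

theorem PT.foldrList {F : ∀ γ, α γ → β γ → β γ} {b : ∀ γ, β γ}
    (hN : Bdd m fun γ => (l γ).length) (hl : PT m e fun γ => ofList ((l γ).map (c γ)))
    (hb : PT m e fun γ => d γ (b γ))
    (hs : PT (fun δ : Ext fun γ => (l γ).length => m δ.1)
      (fun δ => Data.cons (c δ.1 (l δ.1)[δ.2])
        (Data.cons (d δ.1 (((l δ.1).drop (δ.2 + 1)).foldr (F δ.1) (b δ.1))) (e δ.1)))
      fun δ => d δ.1 (F δ.1 (l δ.1)[δ.2] (((l δ.1).drop (δ.2 + 1)).foldr (F δ.1) (b δ.1)))) :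
    PT m e fun γ => d γ ((l γ).foldr (F γ) (b γ)) := by
  refine (PT.foldlList (l := fun γ => (l γ).reverse) (F := fun γ s x => F γ x s) (b := b)
    (hN.mono fun γ => by simp) (PT.reverse hN hl) hb ?_).congr fun γ => by
      rw [List.foldl_reverse]
  have hj : ∀ δ : Ext fun γ => (l γ).reverse.length,
      (l δ.1).length - 1 - δ.2 < (l δ.1).length := fun δ => by
    have := δ.2.2
    simp only [List.length_reverse] at this
    omega
  have h1 : ∀ δ : Ext fun γ => (l γ).reverse.length,
      (l δ.1).reverse[δ.2] = (l δ.1)[(l δ.1).length - 1 - δ.2]'(hj δ) := fun δ => by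
    rw [Fin.getElem_fin, List.getElem_reverse]
  have h2 : ∀ δ : Ext fun γ => (l γ).reverse.length,
      ((l δ.1).reverse.take δ.2).foldl (fun s x => F δ.1 x s) (b δ.1) =
        ((l δ.1).drop ((l δ.1).length - 1 - δ.2 + 1)).foldr (F δ.1) (b δ.1) := fun δ => by
    have := δ.2.2
    simp only [List.length_reverse] at this
    rw [List.take_reverse, List.foldl_reverse,
      show (l δ.1).length - 1 - δ.2 + 1 = (l δ.1).length - δ.2 by omega]
  simp only [h1, h2]
  exact hs.pull fun δ => ⟨δ.1, ⟨_, hj δ⟩⟩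

/-- Appending copies the first list, hence the uniform bound `L` on the lengths of the blocks. -/
theorem PT.flatMap {F : ∀ γ, α γ → List (β γ)} {L : Γ → ℕ} (hL : Bdd m L)
    (hF : ∀ γ, ∀ x ∈ l γ, (F γ x).length ≤ L γ)
    (hN : Bdd m fun γ => (l γ).length) (hl : PT m e fun γ => ofList ((l γ).map (c γ)))
    (hs : PT (fun δ : Ext fun γ => (l γ).length => m δ.1)
      (fun δ => Data.cons (c δ.1 (l δ.1)[δ.2]) (e δ.1))
      fun δ => ofList ((F δ.1 (l δ.1)[δ.2]).map (d δ.1))) :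
    PT m e fun γ => ofList (((l γ).flatMap (F γ)).map (d γ)) := by
  refine (PT.foldrList (d := fun γ (s : List (β γ)) => ofList (s.map (d γ)))
    (F := fun γ x s => F γ x ++ s) (b := fun _ => []) hN hl PT.nil ?_).congr fun γ => by
      congr 2
      induction l γ with
      | nil => rfl
      | cons a l ih => simp [ih]
  refine (PT.append (l := fun δ => (F δ.1 (l δ.1)[δ.2]).map (d δ.1)) ?_
    ((PT.cons PT.var (PT.tl (PT.tl PT.id))).comp hs) (PT.hd (PT.tl PT.id))).congr fun δ => by simp
  exact (hL.pull fun δ : Ext fun γ => (l γ).length => δ.1).mono fun δ => by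
    simpa using hF _ _ (List.getElem_mem _)

open Classical in
theorem PT.filter (hN : Bdd m fun γ => (l γ).length)
    (hl : PT m e fun γ => ofList ((l γ).map (c γ))) {P : ∀ γ, α γ → Prop}
    (hP : PD (fun δ : Ext fun γ => (l γ).length => m δ.1)
      (fun δ => Data.cons (c δ.1 (l δ.1)[δ.2]) (e δ.1)) fun δ => P δ.1 (l δ.1)[δ.2]) :
    PT m e fun γ => ofList (((l γ).filter fun x => P γ x).map (c γ)) := by
  refine (PT.foldrList (d := fun γ (s : List (α γ)) => ofList (s.map (c γ)))
    (F := fun γ x s => if P γ x then x :: s else s) (b := fun _ => []) hN hl PT.nil ?_).congr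
      fun γ => by
        congr 2
        induction l γ with
        | nil => rfl
        | cons a l ih => simp [List.filter_cons, ih]
  refine PT.ite ((PT.cons PT.var (PT.tl (PT.tl PT.id))).comp hP)
    (PT.cons PT.var (PT.hd (PT.tl PT.id))) (PT.hd (PT.tl PT.id)) ?_ ?_
  · intro δ h; simp only [if_pos h]; rfl
  · intro δ h; simp only [if_neg h]

open Classical in
-- The relation is to be decided only between members of the list, because the comparison of two
-- topologies is fast only under bounds that hold for these members.
theorem PT.pwFilter (hN : Bdd m fun γ => (l γ).length)
    (hl : PT m e fun γ => ofList ((l γ).map (c γ))) {R : ∀ γ, α γ → α γ → Prop}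
    (hR : PD (fun δ : Σ γ, {x // x ∈ l γ} × {x // x ∈ l γ} => m δ.1)
      (fun δ => Data.cons (c δ.1 δ.2.1) (Data.cons (c δ.1 δ.2.2) (e δ.1)))
      fun δ => R δ.1 δ.2.1 δ.2.2) :
    PT m e fun γ => ofList (((l γ).pwFilter (R γ)).map (c γ)) := by
  refine PT.foldrList (d := fun γ (s : List (α γ)) => ofList (s.map (c γ)))
    (F := fun γ x s => if ∀ y ∈ s, R γ x y then x :: s else s) (b := fun _ => []) hN hl PT.nil ?_
  have hmem : ∀ (δ : Ext fun γ => (l γ).length),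
      ∀ x ∈ ((l δ.1).drop (δ.2 + 1)).pwFilter (R δ.1), x ∈ l δ.1 := fun δ x hx =>
    List.mem_of_mem_drop ((List.pwFilter_sublist _).subset hx)
  refine PT.ite (PD.forallMem (P := fun δ y => R δ.1 (l δ.1)[δ.2] y) ?_ (PT.hd (PT.tl PT.id)) ?_)
    (PT.cons PT.var (PT.hd (PT.tl PT.id))) (PT.hd (PT.tl PT.id)) ?_ ?_
  rotate_left 2
  · intro δ h; simp only [if_pos h]; rfl
  · intro δ h; simp only [if_neg h]
  · refine (hN.pull fun δ : Ext fun γ => (l γ).length => δ.1).mono fun δ => ?_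
    exact (List.Sublist.length_le (List.pwFilter_sublist _)).trans (by simp)
  · exact (PT.cons (PT.hd (PT.tl PT.id)) (PT.cons PT.var (PT.tl (PT.tl (PT.tl PT.id))))).comp
      (hR.pull (Δ := Ext fun δ : Ext fun γ => (l γ).length =>
        (((l δ.1).drop (δ.2 + 1)).pwFilter (R δ.1)).length) fun δ => ⟨δ.1.1,
          ⟨_, List.getElem_mem δ.1.2.2⟩, ⟨_, hmem δ.1 _ (List.getElem_mem δ.2.2)⟩⟩)

end Lists


/-! ## Candidates -/

/-- The concatenations of `k` members of a list of lists. -/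
def seqs {α : Type} (X : List (List α)) : ℕ → List (List α)
  | 0 => [[]]
  | k + 1 => (seqs X k).flatMap fun l => X.map fun u => l ++ u

theorem mem_seqs {α : Type} {X : List (List α)} {k : ℕ} {l : List α} :
    l ∈ seqs X k ↔ ∃ us : List (List α), us.length = k ∧ (∀ u ∈ us, u ∈ X) ∧ us.flatten = l := by
  induction k generalizing l with
  | zero => simp [seqs, eq_comm]
  | succ k ih =>
    simp only [seqs, List.mem_flatMap, List.mem_map, ih]
    constructor
    · rintro ⟨_, ⟨us, rfl, hus, rfl⟩, u, hu, rfl⟩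
      refine ⟨us ++ [u], by simp, fun v hv => ?_, by simp⟩
      rcases List.mem_append.1 hv with h | h
      · exact hus v h
      · rw [List.mem_singleton.1 h]; exact hu
    · rintro ⟨us, hlen, hus, rfl⟩
      obtain ⟨vs, v, rfl⟩ : ∃ vs v, us = vs ++ [v] :=
        ⟨us.dropLast, us.getLast (by rintro rfl; simp at hlen),
          (List.dropLast_append_getLast _).symm⟩
      exact ⟨vs.flatten, ⟨vs, by simpa using hlen, fun u hu => hus u (by simp [hu]), rfl⟩, v,
        hus v (by simp), by simp⟩

theorem length_seqs {α : Type} (X : List (List α)) (k : ℕ) :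
    (seqs X k).length = X.length ^ k := by
  induction k with
  | zero => rfl
  | succ k ih => simp [seqs, List.length_flatMap, ih, pow_succ]

theorem length_le_of_mem_seqs {α : Type} {X : List (List α)} {k L : ℕ} {l : List α}
    (hX : ∀ u ∈ X, u.length ≤ L) (hl : l ∈ seqs X k) : l.length ≤ k * L := by
  obtain ⟨us, rfl, hus, rfl⟩ := mem_seqs.1 hl
  rw [List.length_flatten]
  refine (List.sum_le_card_nsmul _ L ?_).trans (by simp)
  simp only [List.mem_map]
  rintro _ ⟨u, hu, rfl⟩
  exact hX u (hus u hu)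

theorem mem_of_mem_seqs {α : Type} {X : List (List α)} {k : ℕ} {l : List α} (hl : l ∈ seqs X k)
    {x : α} (hx : x ∈ l) : ∃ u ∈ X, x ∈ u := by
  obtain ⟨us, -, hus, rfl⟩ := mem_seqs.1 hl
  obtain ⟨u, hu, hxu⟩ := List.mem_flatten.1 hx
  exact ⟨u, hus u hu, hxu⟩

/-- A finite sequence of natural numbers as data. -/
def Data.ofNats (l : List ℕ) : Data := ofList (l.map ofNat)

/-- Intervals of numbers, in both directions. -/
def runs (M : ℕ) : List (List ℕ) :=
  let up := (List.range M).flatMap fun s => (List.range M).map fun n => List.range' s n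
  up ++ up.map List.reverse

theorem range'_mem_runs {M s n : ℕ} (hs : s < M) (hn : n < M) : List.range' s n ∈ runs M := by
  simp only [runs, List.mem_append, List.mem_flatMap, List.mem_map, List.mem_range]
  exact Or.inl ⟨s, hs, n, hn, rfl⟩

theorem reverse_range'_mem_runs {M s n : ℕ} (hs : s < M) (hn : n < M) :
    (List.range' s n).reverse ∈ runs M := by
  simp only [runs, List.mem_append, List.mem_flatMap, List.mem_map, List.mem_range]
  exact Or.inr ⟨_, ⟨s, hs, n, hn, rfl⟩, rfl⟩

theorem length_runs (M : ℕ) : (runs M).length = 2 * M ^ 2 := by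
  simp [runs, List.length_flatMap]; ring

theorem runs_bounds {M : ℕ} {u : List ℕ} (hu : u ∈ runs M) :
    u.length ≤ M ∧ ∀ v ∈ u, v ≤ 2 * M := by
  simp only [runs, List.mem_append, List.mem_flatMap, List.mem_map, List.mem_range] at hu
  rcases hu with ⟨s, hs, n, hn, rfl⟩ | ⟨_, ⟨s, hs, n, hn, rfl⟩, rfl⟩
  · exact ⟨by simpa using hn.le, fun v hv => by simp at hv; omega⟩
  · exact ⟨by simpa using hn.le, fun v hv => by simp at hv; omega⟩

/-- The tables formed by `r` intervals. -/
def tableCandidates (M r : ℕ) : List (List ℕ) := seqs (runs M) r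

/-- The quadruples of tables formed by `r` intervals. -/
def candidates (M r : ℕ) : List (List (List ℕ)) :=
  seqs ((tableCandidates M r).map fun t => [t]) 4

/-- With `M` of order n² and `r` of order n this is n^{O(n)}, and it governs both the number of
topologies and the running time. -/
theorem length_candidates (M r : ℕ) : (candidates M r).length = ((2 * M ^ 2) ^ r) ^ 4 := by
  simp [candidates, tableCandidates, length_seqs, length_runs]

theorem mem_candidates {M r : ℕ} {T : List (List ℕ)} :
    T ∈ candidates M r ↔ T.length = 4 ∧ ∀ t ∈ T, t ∈ tableCandidates M r := by
  rw [candidates, mem_seqs]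
  constructor
  · rintro ⟨us, hl, hus, rfl⟩
    have : ∃ ts : List (List ℕ), us = ts.map (fun t => [t]) ∧ ∀ t ∈ ts, t ∈ tableCandidates M r := by
      clear hl
      induction us with
      | nil => exact ⟨[], rfl, by simp⟩
      | cons u us ih =>
        obtain ⟨ts, rfl, hts⟩ := ih fun v hv => hus v (by simp [hv])
        obtain ⟨t, ht, rfl⟩ := List.mem_map.1 (hus u (by simp))
        exact ⟨t :: ts, rfl, by simpa using ⟨ht, hts⟩⟩
    obtain ⟨ts, rfl, hts⟩ := this
    have hf : (ts.map fun t => [t]).flatten = ts := by simp [← List.flatMap_def]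
    rw [hf]
    exact ⟨by simpa using hl, hts⟩
  · rintro ⟨hl, hT⟩
    exact ⟨T.map fun t => [t], by simpa using hl, by simpa using hT, by simp [← List.flatMap_def]⟩

theorem tableCandidates_bounds {M r : ℕ} {t : List ℕ} (ht : t ∈ tableCandidates M r) :
    t.length ≤ r * M ∧ ∀ v ∈ t, v ≤ 2 * M := by
  refine ⟨length_le_of_mem_seqs (fun u hu => (runs_bounds hu).1) ht, fun v hv => ?_⟩
  obtain ⟨u, hu, hvu⟩ := mem_of_mem_seqs ht hv
  exact (runs_bounds hu).2 v hvu

/-! ### Programs that list the candidates -/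

section

variable {Γ : Type} {m : Γ → ℕ} {e : Γ → Data}

theorem PT.seqs {α : Type} {c : α → Data} {X : Γ → List (List α)} {k L : Γ → ℕ} (hK : Bdd m k)
    (hL : Bdd m L) (hXL : ∀ γ, ∀ u ∈ X γ, u.length ≤ L γ)
    (hXk : Bdd m fun γ => (X γ).length ^ k γ) (hlen : Bdd m fun γ => (X γ).length)
    (hX : PT m e fun γ => ofList ((X γ).map fun u => ofList (u.map c)))
    (hk : PT m e fun γ => ofNat (k γ)) :
    PT m e fun γ => ofList ((Multicut.seqs (X γ) (k γ)).map fun u => ofList (u.map c)) := by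
  refine PT.iter hK (S := fun γ j => ofList ((Multicut.seqs (X γ) j).map fun u => ofList (u.map c)))
    hk (PT.cons PT.nil PT.nil) ?_
  -- If `X` is empty, stage 0 still has one member although the final power may be 0; the summand 1
  -- covers this case.
  have hN : Bdd (fun δ : Ext k => m δ.1) fun δ => (Multicut.seqs (X δ.1) δ.2).length := by
    refine ((hXk.add (Bdd.const 1)).pull fun δ : Ext k => δ.1).mono fun δ => ?_
    rw [length_seqs]
    rcases Nat.eq_zero_or_pos (X δ.1).length with h | h
    · rw [h]
      have : 0 ^ (δ.2 : ℕ) ≤ 1 := pow_le_one' (Nat.zero_le 1) _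
      exact this.trans (Nat.le_add_left 1 _)
    · exact (Nat.pow_le_pow_right h δ.2.2.le).trans (Nat.le_succ _)
  refine PT.flatMap (L := fun δ : Ext k => (X δ.1).length) (α := fun _ => List α)
    (c := fun _ (u : List α) => ofList (u.map c)) (hlen.pull _) (fun γ x _ => by simp) hN PT.var ?_
  refine PT.listMap (c := fun _ (u : List α) => ofList (u.map c))
    (d := fun _ (u : List α) => ofList (u.map c))
    ((hlen.pull fun δ : Ext k => δ.1).pull Sigma.fst) (PT.wk (PT.wk (hX.pull _))) ?_
  refine (PT.append ?_ (PT.hd (PT.tl PT.id)) PT.var).congr fun δ => by rw [List.map_append]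
  refine (((hK.mul hL).pull fun δ : Ext k => δ.1).pull fun δ :
    Ext fun δ : Ext fun δ : Ext k => (Multicut.seqs (X δ.1) δ.2).length => (X δ.1.1).length =>
      δ.1.1).mono fun δ => ?_
  rw [List.length_map]
  exact (length_le_of_mem_seqs (hXL _) (List.getElem_mem _)).trans
    (Nat.mul_le_mul_right _ δ.1.1.2.2.le)

theorem PT.ofNats_range' {s n : Γ → ℕ} (hN : Bdd m n) (hs : PT m e fun γ => ofNat (s γ))
    (hn : PT m e fun γ => ofNat (n γ)) : PT m e fun γ => ofNats (List.range' (s γ) (n γ)) :=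
  (PT.table hN (b := fun γ j => ofNat (s γ + j)) hn (PT.natAdd hN.var hs.wkFin PT.var)).congr
    fun γ => by
      rw [ofNats, ofFun]; congr 1; apply List.ext_getElem <;> simp

theorem PT.ofNats_range {n : Γ → ℕ} (hN : Bdd m n) (hn : PT m e fun γ => ofNat (n γ)) :
    PT m e fun γ => ofList ((List.range (n γ)).map ofNat) :=
  (PT.ofNats_range' hN (PT.natConst 0) hn).congr fun γ => by rw [List.range_eq_range']; rfl

theorem PT.runs {M : Γ → ℕ} (hM : Bdd m M) (hm : PT m e fun γ => ofNat (M γ)) :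
    PT m e fun γ => ofList ((Multicut.runs (M γ)).map ofNats) := by
  have hup : PT m e fun γ => ofList (((List.range (M γ)).flatMap fun s =>
      (List.range (M γ)).map fun n => List.range' s n).map ofNats) := by
    refine PT.flatMap (L := M) (c := fun _ => ofNat) hM (fun γ x _ => by simp)
      (hM.mono fun γ => by simp) (PT.ofNats_range hM hm) ?_
    have hM1 : Bdd (fun δ : Ext fun γ => (List.range (M γ)).length => m δ.1) fun δ => M δ.1 :=
      hM.pull _
    refine PT.listMap (c := fun _ => ofNat) (hM1.mono fun γ => by simp)
      (PT.ofNats_range hM1 (PT.wk (hm.pull _))) ?_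
    refine PT.ofNats_range' ((hM1.pull fun δ : Ext fun δ : Ext fun γ => (List.range (M γ)).length =>
      (List.range (M δ.1)).length => δ.1).mono fun δ => ?_) (PT.hd (PT.tl PT.id)) PT.var
    have := δ.2.2
    simp only [List.length_range] at this
    simpa using this.le
  have hlen : Bdd m fun γ => ((List.range (M γ)).flatMap fun s =>
      (List.range (M γ)).map fun n => List.range' s n).length :=
    (hM.pow 2).mono fun γ => by simp [List.length_flatMap]; exact (sq _).ge
  have hrev := PT.listMap (c := fun _ => ofNats) (d := fun _ => ofNats) (g := fun _ => List.reverse)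
    hlen hup (PT.reverse (α := fun _ => ℕ) (l := fun δ => _) (c := fun _ => ofNat) ?_ PT.var)
  · refine (PT.append (hlen.mono fun γ => by simp) hup hrev).congr fun γ => ?_
    rw [Multicut.runs, List.map_append]
  · refine (hM.pull _).mono fun δ => (runs_bounds (M := M δ.1) ?_).1
    rw [Multicut.runs]
    exact List.mem_append_left _ (List.getElem_mem _)

theorem PT.candidates {M r : Γ → ℕ} (hM : Bdd m M) (hm : PT m e fun γ => ofNat (M γ))
    (hR : Bdd m r) (hr : PT m e fun γ => ofNat (r γ))
    (hB : Bdd m fun γ => (2 * M γ ^ 2) ^ r γ) :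
    PT m e fun γ => ofList ((Multicut.candidates (M γ) (r γ)).map fun T => ofList (T.map ofNats)) := by
  have h1 : PT m e fun γ => ofList ((tableCandidates (M γ) (r γ)).map ofNats) :=
    PT.seqs (c := ofNat) hR hM (fun γ u hu => (runs_bounds hu).1)
      (hB.mono fun γ => by rw [length_runs])
      (((Bdd.const 2).mul (hM.pow 2)).mono fun γ => by rw [length_runs]) (PT.runs hM hm) hr
  have hlen : Bdd m fun γ => (tableCandidates (M γ) (r γ)).length :=
    hB.mono fun γ => by rw [tableCandidates, length_seqs, length_runs]
  have h2 := PT.listMap (c := fun _ => ofNats) (d := fun _ (T : List (List ℕ)) => ofList (T.map ofNats))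
    (g := fun _ t => [t]) hlen h1 (PT.cons PT.var PT.nil)
  exact PT.seqs (c := ofNats) (Bdd.const 4) (Bdd.const 1) (fun γ u hu => by
    obtain ⟨t, -, rfl⟩ := List.mem_map.1 hu; rfl) ((hlen.pow 4).mono fun γ => by simp)
    (hlen.mono fun γ => by simp) h2 (PT.natConst 4)

end


/-! ## Recognition of valid candidates -/

/-- The tables of a topology. -/
def PreTopology.tables {N : ℕ} (W : PreTopology N) : List (List ℕ) :=
  [List.ofFn fun x => (W.next x : ℕ), List.ofFn fun x => (W.rev x : ℕ),
    List.ofFn fun i => (W.corner i : ℕ), List.ofFn W.cross]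

theorem Data.ofNats_ofFn {n : ℕ} (f : Fin n → ℕ) : ofNats (List.ofFn f) = ofFun fun x => ofNat (f x) := by
  rw [ofNats, ofFun, List.map_ofFn]; rfl

theorem Topology.encode_eq {N : ℕ} (U : Topology N) :
    U.encode = ofList (U.toPre.tables.map ofNats) := by
  simp [PreTopology.tables, ofNats_ofFn, Topology.encode]

theorem PreTopology.tables_injective {N : ℕ} {W W' : PreTopology N}
    (h : W.tables = W'.tables) : W = W' := by
  obtain ⟨d, n, r, c, x⟩ := W
  obtain ⟨d', n', r', c', x'⟩ := W'
  simp only [tables, List.cons.injEq, and_true] at h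
  obtain ⟨h1, h2, h3, h4⟩ := h
  obtain rfl : d = d' := by simpa using congrArg List.length h1
  have h1 := List.ofFn_injective h1
  have h2 := List.ofFn_injective h2
  have h3 := List.ofFn_injective h3
  obtain rfl := List.ofFn_injective h4
  obtain rfl : n = n' := Equiv.ext fun x => Fin.ext (congrFun h1 x)
  obtain rfl : r = r' := Equiv.ext fun x => Fin.ext (congrFun h2 x)
  obtain rfl : c = c' := funext fun x => Fin.ext (congrFun h3 x)
  rfl

theorem Topology.toPre_injective {N : ℕ} {U V : Topology N} (h : U.toPre = V.toPre) : U = V := by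
  cases U; cases V; cases h; rfl

/-- The lists `a`, `b`, `c`, `d` are the tables of two permutations, of the darts at the corners and of
the numbers of crossings. -/
def AreTables (N : ℕ) (a b c d : List ℕ) : Prop :=
  b.length = a.length ∧ c.length = N ∧ d.length = N ∧
    (∀ x : Fin a.length, a.getD x 0 < a.length) ∧ (∀ x : Fin a.length, b.getD x 0 < a.length) ∧
    (∀ x y : Fin a.length, a.getD x 0 = a.getD y 0 → x = y) ∧
    (∀ x y : Fin a.length, b.getD x 0 = b.getD y 0 → x = y) ∧
    ∀ i : Fin N, c.getD i 0 < a.length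

/-- An injective map of a finite set to itself is a permutation, so checking lengths, ranges and
injectivity is enough. -/
theorem areTables_iff {N : ℕ} {a b c d : List ℕ} :
    AreTables N a b c d ↔ ∃ W : PreTopology N, W.tables = [a, b, c, d] := by
  constructor
  · rintro ⟨hb, hc, hd, ha1, hb1, ha2, hb2, hc1⟩
    refine ⟨⟨a.length,
      Equiv.ofBijective (fun x => ⟨a.getD x 0, ha1 x⟩)
        (Finite.injective_iff_bijective.1 fun x y h => ha2 x y (Fin.ext_iff.1 h)),
      Equiv.ofBijective (fun x => ⟨b.getD x 0, hb1 x⟩)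
        (Finite.injective_iff_bijective.1 fun x y h => hb2 x y (Fin.ext_iff.1 h)),
      fun i => ⟨c.getD i 0, hc1 i⟩, fun i => d.getD i 0⟩, ?_⟩
    subst hc
    simp only [PreTopology.tables, Equiv.ofBijective_apply, List.cons.injEq, and_true]
    refine ⟨?_, ?_, ?_, ?_⟩
    · apply List.ext_getElem <;> simp +contextual
    · apply List.ext_getElem <;> simp +contextual [hb]
    · apply List.ext_getElem <;> simp +contextual
    · apply List.ext_getElem <;> simp +contextual [hd]
  · rintro ⟨⟨n, f, g, k, l⟩, h⟩
    simp only [PreTopology.tables, List.cons.injEq, and_true] at h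
    obtain ⟨rfl, rfl, rfl, rfl⟩ := h
    have key : ∀ {n N : ℕ} (f : Fin N → ℕ) (i : ℕ) (hi : i < N), (List.ofFn f).getD i 0 = f ⟨i, hi⟩ :=
      fun f i hi => by rw [List.getD_eq_getElem _ _ (by simpa)]; simp
    have hlt : ∀ x : Fin (List.ofFn fun x => (f x : ℕ)).length, (x : ℕ) < n := fun x => by
      simpa using x.2
    refine ⟨by simp, by simp, by simp, fun x => ?_, fun x => ?_, fun x y h => ?_, fun x y h => ?_,
      fun i => ?_⟩
    · rw [key (n := n) _ _ (hlt x)]; simp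
    · rw [key (n := n) _ _ (hlt x)]; simp
    · rw [key (n := n) _ _ (hlt x), key (n := n) _ _ (hlt y)] at h
      simpa [Fin.ext_iff] using f.injective (Fin.ext h)
    · rw [key (n := n) _ _ (hlt x), key (n := n) _ _ (hlt y)] at h
      simpa [Fin.ext_iff] using g.injective (Fin.ext h)
    · rw [key (n := n) _ _ i.2]; simp

section

variable {Γ : Type} {m : Γ → ℕ} {e : Γ → Data}

theorem PT.natGetD {l : Γ → List ℕ} {i : Γ → ℕ} (hI : Bdd m i) (hl : PT m e fun γ => ofNats (l γ))
    (hi : PT m e fun γ => ofNat (i γ)) : PT m e fun γ => ofNat ((l γ).getD (i γ) 0) :=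
  (PT.getD hI hl hi).congr fun γ => by
    exact (List.getD_map (f := ofNat) ..).symm

theorem Bdd.natGetD {l : Γ → List ℕ} {B : Γ → ℕ} (hB : Bdd m B) (h : ∀ γ, ∀ v ∈ l γ, v ≤ B γ)
    (i : Γ → ℕ) : Bdd m fun γ => (l γ).getD (i γ) 0 :=
  hB.mono fun γ => by
    rcases lt_or_ge (i γ) (l γ).length with h' | h'
    · rw [List.getD_eq_getElem _ _ h']
      exact h γ _ (List.getElem_mem _)
    · rw [List.getD_eq_default _ _ h']
      exact Nat.zero_le _

theorem PD.injTable {l : Γ → List ℕ} {n B : Γ → ℕ} (hB : Bdd m B) (h : ∀ γ, ∀ v ∈ l γ, v ≤ B γ)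
    (hN : Bdd m n) (hl : PT m e fun γ => ofNats (l γ)) (hn : PT m e fun γ => ofNat (n γ)) :
    PD m e fun γ => ∀ x y : Fin (n γ), (l γ).getD x 0 = (l γ).getD y 0 → x = y := by
  refine PD.forallFin hN hn (PD.forallFin hN.ext hn.wkFin ?_)
  have hN2 := hN.ext.ext (M := fun δ : Ext n => n δ.1)
  have hB2 := hB.ext.ext (M := fun δ : Ext n => n δ.1)
  have hx := hN.var.ext (M := fun δ : Ext n => n δ.1)
  have hy := hN.ext.var (M := fun δ : Ext n => n δ.1)
  exact PD.imp (PD.natEq (hB2.natGetD (fun δ => h _) _) (hB2.natGetD (fun δ => h _) _)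
    (PT.natGetD hx hl.wkFin.wkFin (PT.wk PT.var)) (PT.natGetD hy hl.wkFin.wkFin PT.var))
    (PD.finEq hN2 (PT.wk PT.var) PT.var)

theorem PD.ltTable {l : Γ → List ℕ} {n k : Γ → ℕ} (hN : Bdd m n) (hK : Bdd m k)
    (hl : PT m e fun γ => ofNats (l γ)) (hn : PT m e fun γ => ofNat (n γ))
    (hk : PT m e fun γ => ofNat (k γ)) :
    PD m e fun γ => ∀ x : Fin (n γ), (l γ).getD x 0 < k γ :=
  PD.forallFin hN hn (PD.natLt hK.ext (PT.natGetD hN.var hl.wkFin PT.var) hk.wkFin)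

theorem PD.areTables {N B : Γ → ℕ} {a b c d : Γ → List ℕ} (hN : Bdd m N)
    (hn : PT m e fun γ => ofNat (N γ)) (hB : Bdd m B)
    (hlen : ∀ γ, (a γ).length ≤ B γ ∧ (b γ).length ≤ B γ ∧ (c γ).length ≤ B γ ∧ (d γ).length ≤ B γ)
    (hval : ∀ γ, (∀ v ∈ a γ, v ≤ B γ) ∧ ∀ v ∈ b γ, v ≤ B γ)
    (ha : PT m e fun γ => ofNats (a γ)) (hb : PT m e fun γ => ofNats (b γ))
    (hc : PT m e fun γ => ofNats (c γ)) (hd : PT m e fun γ => ofNats (d γ)) :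
    PD m e fun γ => AreTables (N γ) (a γ) (b γ) (c γ) (d γ) := by
  have ba : Bdd m fun γ => (a γ).length := hB.mono fun γ => (hlen γ).1
  have bb : Bdd m fun γ => (b γ).length := hB.mono fun γ => (hlen γ).2.1
  have bc : Bdd m fun γ => (c γ).length := hB.mono fun γ => (hlen γ).2.2.1
  have bd : Bdd m fun γ => (d γ).length := hB.mono fun γ => (hlen γ).2.2.2
  have la := PT.length (c := fun _ => ofNat) ba ha
  have lb := PT.length (c := fun _ => ofNat) bb hb
  have lc := PT.length (c := fun _ => ofNat) bc hc
  have ld := PT.length (c := fun _ => ofNat) bd hd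
  exact (PD.natEq bb ba lb la).and ((PD.natEq bc hN lc hn).and ((PD.natEq bd hN ld hn).and
    ((PD.ltTable ba ba ha la la).and ((PD.ltTable ba ba hb la la).and
      ((PD.injTable hB (fun γ => (hval γ).1) ba ha la).and
        ((PD.injTable hB (fun γ => (hval γ).2) ba hb la).and (PD.ltTable hN ba hc hn la)))))))

theorem HasPre.of_tables {N B : Γ → ℕ} {W : ∀ γ, PreTopology (N γ)} {T : Γ → List (List ℕ)}
    (hW : ∀ γ, (W γ).tables = T γ) (hN : Bdd m N)
    (hn : PT m e fun γ => ofNat (N γ)) (hB : Bdd m B)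
    (hT : ∀ γ, ∀ t ∈ T γ, t.length ≤ B γ ∧ ∀ v ∈ t, v ≤ B γ)
    (h : PT m e fun γ => ofList ((T γ).map ofNats)) : HasPre m e W := by
  have h' : PT m e fun γ => Data.cons (ofFun fun x => ofNat ((W γ).next x))
      (Data.cons (ofFun fun x => ofNat ((W γ).rev x)) (Data.cons (ofFun fun x => ofNat ((W γ).corner x))
        (Data.cons (ofFun fun x => ofNat ((W γ).cross x)) Data.nil))) := h.congr fun γ => by
    simp [← hW, PreTopology.tables, ofNats_ofFn, ofList]
  have hd : Bdd m fun γ => (W γ).darts := hB.mono fun γ => by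
    simpa using (hT γ (List.ofFn fun x => ((W γ).next x : ℕ)) (by simp [← hW, PreTopology.tables])).1
  refine ⟨hN, hn, hd, ?_, h'.hd, h'.tl.hd, h'.tl.tl.hd, h'.tl.tl.tl.hd, B, hB, fun γ i => ?_⟩
  · refine (PT.length (l := fun γ => List.ofFn fun x => ((W γ).next x : ℕ)) (c := fun _ => ofNat)
      (hd.mono fun γ => by simp) ?_).congr fun γ => by simp
    exact h'.hd.congr fun γ => ofNats_ofFn _
  · exact (hT γ (List.ofFn (W γ).cross) (by simp [← hW, PreTopology.tables])).2 _
      (by simp)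

/-- Three nested tests: the lists are tables of a `PreTopology`, it satisfies the axioms, and the
resulting topology is valid. Each is run only where the previous one succeeded. There the structure
can be picked by choice: the program sees only the tables, and these determine the structure. -/
theorem PD.exists_isValid {I : Γ → Instance} (hI : HasInst m e I) (p q : ℕ) {B : Γ → ℕ}
    {T : Γ → List (List ℕ)} (h4 : ∀ γ, (T γ).length = 4) (hB : Bdd m B)
    (hT : ∀ γ, ∀ t ∈ T γ, t.length ≤ B γ ∧ ∀ v ∈ t, v ≤ B γ)
    (h : PT m e fun γ => ofList ((T γ).map ofNats)) :
    PD m e fun γ => ∃ U, (I γ).IsValid p q U ∧ U.toPre.tables = T γ := by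
  have h1 : PD m e fun γ => ∃ W : PreTopology (2 * (I γ).K.edges), W.tables = T γ := by
    obtain ⟨a, b, c, d, rfl⟩ : ∃ a b c d : Γ → List ℕ, T = fun γ => [a γ, b γ, c γ, d γ] := by
      have : ∀ γ, ∃ a b c d, T γ = [a, b, c, d] := fun γ => by
        obtain ⟨a, b, c, d, h⟩ := List.length_eq_four.1 (h4 γ)
        exact ⟨a, b, c, d, h⟩
      choose a b c d h using this
      exact ⟨a, b, c, d, funext h⟩
    have h : PT m e fun γ => Data.cons (ofNats (a γ)) (Data.cons (ofNats (b γ))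
      (Data.cons (ofNats (c γ)) (Data.cons (ofNats (d γ)) Data.nil))) := h
    refine (PD.areTables hI.bdd_sides hI.sides hB (fun γ => ?_) (fun γ => ?_) h.hd h.tl.hd h.tl.tl.hd
      h.tl.tl.tl.hd).congr fun γ => areTables_iff.symm
    · have := hT γ
      simp only [List.forall_mem_cons] at this
      exact ⟨this.1.1, this.2.1.1, this.2.2.1.1, this.2.2.2.1.1⟩
    · have := hT γ
      simp only [List.forall_mem_cons] at this
      exact ⟨this.1.2, this.2.1.2⟩
  refine PD.congr (h1.and_of (Q := fun γ => ∃ U, (I γ).IsValid p q U ∧ U.toPre.tables = T γ) ?_)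
    fun γ => ⟨fun ⟨U, hU, hU'⟩ => ⟨⟨_, hU'⟩, U, hU, hU'⟩, fun h => h.2⟩
  have hW : HasPre _ _ _ := HasPre.of_tables
    (W := fun γ : {γ // ∃ W : PreTopology (2 * (I γ).K.edges), W.tables = T γ} => γ.2.choose)
    (fun γ => γ.2.choose_spec) (hI.bdd_sides.pull _) (hI.sides.pull _) (hB.pull _)
    (fun γ => hT γ) (h.pull _)
  refine PD.congr (PD.and_of (Q := fun γ : {γ // ∃ W : PreTopology (2 * (I γ).K.edges),
    W.tables = T γ} => ∃ U, (I γ.1).IsValid p q U ∧ U.toPre.tables = T γ) hW.isTopology ?_) fun γ => ⟨?_, And.right⟩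
  · refine (HasPre.isValid (U := fun γ => γ.2.toTopology) ((hI.pull _).pull _)
      (hW.pull Subtype.val) p q).congr fun γ => ?_
    have hγ : γ.2.toTopology.toPre.tables = T γ := γ.1.2.choose_spec
    constructor
    · rintro ⟨U, hU, hU'⟩
      rwa [← Topology.toPre_injective (PreTopology.tables_injective (hU'.trans hγ.symm))]
    · exact fun h => ⟨_, h, hγ⟩
  · rintro ⟨U, hU, hU'⟩
    refine ⟨?_, U, hU, hU'⟩
    rw [← PreTopology.tables_injective (hU'.trans γ.2.choose_spec.symm)]
    exact U.isTopology_toPre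

/-! ## Enumeration -/

open Classical in
-- The candidates are filtered by validity and then freed from repetitions. All of the combinatorics
-- is in the hypothesis `hc`: each class of valid topologies has a valid representative among the
-- candidates.
theorem exists_enumeration {I : Γ → Instance} (hI : HasInst m e I) (p q : ℕ) {M r : Γ → ℕ}
    (hM : Bdd m M) (hm : PT m e fun γ => ofNat (M γ)) (hR : Bdd m r)
    (hr : PT m e fun γ => ofNat (r γ)) (hB : Bdd m fun γ => (2 * M γ ^ 2) ^ r γ)
    (hc : ∀ γ V, (I γ).IsValid p q V → ∃ U, (I γ).IsValid p q U ∧ U.Same V ∧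
      U.toPre.tables ∈ candidates (M γ) (r γ)) :
    ∃ L : ∀ γ, List (Topology (2 * (I γ).K.edges)), (∀ γ, (I γ).Enumerates p q (L γ)) ∧
      (∀ γ, (L γ).length ≤ ((2 * M γ ^ 2) ^ r γ) ^ 4) ∧
      PT m e fun γ => ofList ((L γ).map Topology.encode) := by
  have hlen : Bdd m fun γ => (candidates (M γ) (r γ)).length :=
    (hB.pow 4).mono fun γ => (length_candidates _ _).le
  have h1 := PT.filter (c := fun _ (T : List (List ℕ)) => ofList (T.map ofNats))
    (P := fun γ T => ∃ U, (I γ).IsValid p q U ∧ U.toPre.tables = T) hlen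
    (PT.candidates hM hm hR hr hB) ?_
  swap
  · have hB' : Bdd m fun γ => r γ * M γ + 2 * M γ := (hR.mul hM).add ((Bdd.const 2).mul hM)
    refine PD.exists_isValid ((hI.pull _).wk) p q (fun δ => (mem_candidates.1
      (List.getElem_mem _)).1) (hB'.pull _) (fun δ t ht => ?_) PT.var
    have := tableCandidates_bounds ((mem_candidates.1 (List.getElem_mem _)).2 t ht)
    exact ⟨this.1.trans (Nat.le_add_right _ _), fun v hv => (this.2 v hv).trans (Nat.le_add_left _ _)⟩
  -- The surviving quadruples are lifted to topologies, in the same order, so that the output of the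
  -- filter is their list of encodings.
  have hU : ∀ γ, ∃ Us : List (Topology (2 * (I γ).K.edges)), (∀ U ∈ Us, (I γ).IsValid p q U) ∧
      Us.map (fun U => U.toPre.tables) = (candidates (M γ) (r γ)).filter
        fun T => ∃ U, (I γ).IsValid p q U ∧ U.toPre.tables = T := by
    intro γ
    induction candidates (M γ) (r γ) with
    | nil => exact ⟨[], by simp, rfl⟩
    | cons T l ih =>
      obtain ⟨Us, hUs, hl⟩ := ih
      by_cases hT : ∃ U, (I γ).IsValid p q U ∧ U.toPre.tables = T
      · obtain ⟨U, hU, hUT⟩ := hT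
        refine ⟨U :: Us, by simpa using ⟨hU, hUs⟩, ?_⟩
        rw [List.filter_cons_of_pos (by simpa using ⟨U, hU, hUT⟩), ← hl, ← hUT]
        rfl
      · exact ⟨Us, hUs, by rw [List.filter_cons_of_neg (by simpa using hT), hl]⟩
  choose Us hUs hUl using hU
  have hUlen : ∀ γ, (Us γ).length ≤ (candidates (M γ) (r γ)).length := fun γ => by
    rw [← List.length_map (f := fun U : Topology (2 * (I γ).K.edges) => U.toPre.tables), hUl]
    exact List.length_filter_le _ _
  have h2 : PT m e fun γ => ofList ((Us γ).map Topology.encode) := h1.congr fun γ => by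
    rw [← hUl, List.map_map]
    congr 2
    exact funext Topology.encode_eq
  have hUc : ∀ γ, ∀ U ∈ Us γ, U.toPre.tables ∈ candidates (M γ) (r γ) := fun γ U hU => by
    have : U.toPre.tables ∈ (Us γ).map fun U => U.toPre.tables := List.mem_map_of_mem hU
    rw [hUl] at this
    exact (List.mem_filter.1 this).1
  refine ⟨fun γ => (Us γ).pwFilter fun U V => ¬ U.Same V, fun γ => ⟨fun U hU => ?_, fun V hV => ?_,
    List.pairwise_pwFilter _⟩, fun γ => ?_, ?_⟩
  · exact hUs γ U ((List.pwFilter_sublist _).subset hU)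
  · obtain ⟨U, hU, hUV, hUc⟩ := hc γ V hV
    have hmem : ∃ U' ∈ Us γ, U' = U := by
      have : U.toPre.tables ∈ (Us γ).map fun U => U.toPre.tables := by
        rw [hUl]
        exact List.mem_filter.2 ⟨hUc, by simpa using ⟨U, hU, rfl⟩⟩
      obtain ⟨U', hU', h⟩ := List.mem_map.1 this
      exact ⟨U', hU', Topology.toPre_injective (PreTopology.tables_injective h)⟩
    obtain ⟨U, hU', rfl⟩ := hmem
    by_contra hcon
    push Not at hcon
    -- If `U` differed from all topologies that were kept, then by transitivity of `Same` it would
    -- differ from all members of `Us γ`, itself included.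
    have key := (List.forall_mem_pwFilter (R := fun U V : Topology (2 * (I γ).K.edges) =>
      ¬ U.Same V) (fun {x y z} hxz => by
        by_contra hn
        push Not at hn
        exact hxz ((Topology.setoid _).trans hn.1 hn.2)) U (Us γ)).1 ?_
    · exact key U hU' ((Topology.setoid _).refl U)
    · intro W hW hUW
      exact hcon W hW ((Topology.setoid _).trans ((Topology.setoid _).symm hUW) hUV)
  · rw [← length_candidates]
    exact (List.pwFilter_sublist _).length_le.trans (hUlen γ)
  · have h3 := PT.pwFilter (c := fun _ => Topology.encode) (R := fun _ U V => ¬ U.Same V)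
      (hlen.mono hUlen) h2 ?_
    · convert h3
    have hI' := hI.pull (Sigma.fst : (Σ γ, {U // U ∈ Us γ} × {U // U ∈ Us γ}) → Γ)
    have hB' : Bdd (fun δ : Σ γ, {U // U ∈ Us γ} × {U // U ∈ Us γ} => m δ.1)
      fun δ => r δ.1 * M δ.1 + 2 * M δ.1 :=
        ((hR.mul hM).add ((Bdd.const 2).mul hM)).pull _
    have hb : ∀ (δ : Σ γ, {U // U ∈ Us γ} × {U // U ∈ Us γ}), ∀ U ∈ Us δ.1, ∀ t ∈ U.toPre.tables,
        t.length ≤ r δ.1 * M δ.1 + 2 * M δ.1 ∧ ∀ v ∈ t, v ≤ r δ.1 * M δ.1 + 2 * M δ.1 := by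
      intro δ U hU t ht
      have := tableCandidates_bounds ((mem_candidates.1 (hUc _ U hU)).2 t ht)
      exact ⟨this.1.trans (Nat.le_add_right _ _),
        fun v hv => (this.2 v hv).trans (Nat.le_add_left _ _)⟩
    refine PD.not (HasPre.same (Γ := Σ γ, {U // U ∈ Us γ} × {U // U ∈ Us γ})
      (U := fun δ => δ.2.1.1) (V := fun δ => δ.2.2.1)
      (fun δ => by have := (I δ.1).K.edges_pos; omega) ?_ ?_)
    · exact HasPre.of_tables (fun δ => rfl) hI'.bdd_sides (PT.wk (PT.wk hI'.sides)) hB'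
        (fun δ => hb δ _ δ.2.1.2) (PT.var.congr fun δ => (Topology.encode_eq _).symm)
    · exact HasPre.of_tables (fun δ => rfl) hI'.bdd_sides (PT.wk (PT.wk hI'.sides)) hB'
        (fun δ => hb δ _ δ.2.2.2) ((PT.wk PT.var).congr fun δ => (Topology.encode_eq _).symm)

end


/-! ## Invariance under renaming -/

section Renaming

variable {N : ℕ}

/-- The bijection `e` is a renaming of the darts of `U` to the darts of `V`. -/
structure IsRenaming (U V : PreTopology N) (e : Fin U.darts ≃ Fin V.darts) : Prop where
  next : ∀ x, e (U.next x) = V.next (e x)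
  rev : ∀ x, e (U.rev x) = V.rev (e x)
  corner : ∀ i, e (U.corner i) = V.corner i
  cross : ∀ i, U.cross i = V.cross i

/-- Cycles, connections and faces are all generated by elementary steps, so their invariance need
only be checked on one step. -/
theorem eqvGen_congr {α β : Type} (e : α ≃ β) {R : α → α → Prop} {S : β → β → Prop}
    (h : ∀ x y, R x y ↔ S (e x) (e y)) (x y : α) :
    Relation.EqvGen R x y ↔ Relation.EqvGen S (e x) (e y) := by
  constructor
  · intro hxy
    induction hxy with
    | rel x y hxy => exact Relation.EqvGen.rel _ _ ((h _ _).1 hxy)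
    | refl => exact Relation.EqvGen.refl _
    | symm _ _ _ ih => exact ih.symm
    | trans _ _ _ _ _ ih1 ih2 => exact ih1.trans _ _ _ ih2
  · suffices H : ∀ a b, Relation.EqvGen S a b → Relation.EqvGen R (e.symm a) (e.symm b) by
      intro hxy
      simpa using H _ _ hxy
    intro a b hab
    induction hab with
    | rel a b hab => exact Relation.EqvGen.rel _ _ ((h _ _).2 (by simpa))
    | refl => exact Relation.EqvGen.refl _
    | symm _ _ _ ih => exact ih.symm
    | trans _ _ _ _ _ ih1 ih2 => exact ih1.trans _ _ _ ih2

namespace IsRenaming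

section

variable {U V : PreTopology N} {e : Fin U.darts ≃ Fin V.darts}

theorem piece (h : IsRenaming U V e) (i j) : e (U.piece i j) = V.piece i j := by
  induction j with
  | zero => exact h.corner i
  | succ j ih =>
    have h1 : U.piece i (j + 1) = U.next (U.rev (U.piece i j)) := by
      rw [PreTopology.piece, pow_succ']; rfl
    have h2 : V.piece i (j + 1) = V.next (V.rev (V.piece i j)) := by
      rw [PreTopology.piece, pow_succ']; rfl
    rw [h1, h2, h.next, h.rev, ih]

theorem sameCycle_congr {α β : Type} (e : α ≃ β) {f : Equiv.Perm α} {g : Equiv.Perm β}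
    (h : ∀ x, e (f x) = g (e x)) {x y} : f.SameCycle x y ↔ g.SameCycle (e x) (e y) := by
  rw [sameCycle_iff_eqvGen, sameCycle_iff_eqvGen]
  exact eqvGen_congr e (fun x y => by rw [← h, e.apply_eq_iff_eq]) x y

theorem numCycles_congr {n k : ℕ} (e : Fin n ≃ Fin k) {f : Equiv.Perm (Fin n)}
    {g : Equiv.Perm (Fin k)} (h : ∀ x, e (f x) = g (e x)) : numCycles f = numCycles g :=
  Nat.card_congr (Quotient.congr e fun _ _ => sameCycle_congr e h)

theorem sameCycle (h : IsRenaming U V e) {x y} :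
    U.next.SameCycle x y ↔ V.next.SameCycle (e x) (e y) :=
  sameCycle_congr e h.next

theorem face (h : IsRenaming U V e) (x) : e ((U.next⁻¹ * U.rev) x) = (V.next⁻¹ * V.rev) (e x) := by
  rw [Equiv.Perm.mul_apply, Equiv.Perm.mul_apply, ← h.rev, eq_comm, Equiv.Perm.inv_eq_iff_eq,
    ← h.next]
  exact congrArg e (U.next.apply_symm_apply _).symm

/-- Needed before validity is discussed: the renumbered data are at first only a `PreTopology`. -/
theorem isTopology (h : IsRenaming U V e) (hV : V.IsTopology) : U.IsTopology where
  rev_rev x := e.injective (by rw [h.rev, h.rev, hV.rev_rev])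
  rev_ne x hx := hV.rev_ne (e x) (by rw [← h.rev, hx])
  connected x y := (eqvGen_congr e (fun a b => by
    rw [← h.next, ← h.rev, e.apply_eq_iff_eq, e.apply_eq_iff_eq]) x y).2 (hV.connected (e x) (e y))
  planar := by
    rw [numCycles_congr e h.next, numCycles_congr e h.rev, numCycles_congr e h.face]
    exact hV.planar
  side_end i := e.injective (by rw [h.piece, h.cross, h.corner, hV.side_end])
  outer_simple i i' j hj j' hj' hs := by
    rw [h.cross] at hj hj'
    refine hV.outer_simple i i' j hj j' hj' ?_
    rwa [← h.piece, ← h.piece, ← h.sameCycle]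

end

section

variable {U V : Topology N} {e : Fin U.darts ≃ Fin V.darts} (h : IsRenaming U.toPre V.toPre e)
include h

theorem piece_eq (i j) : e (U.piece i j) = V.piece i j := h.piece i j

theorem next_eq (x) : e (U.next x) = V.next (e x) := h.next x

theorem rev_eq (x) : e (U.rev x) = V.rev (e x) := h.rev x

theorem corner_eq (i) : e (U.corner i) = V.corner i := h.corner i

theorem cross_eq (i) : U.cross i = V.cross i := h.cross i

theorem sameCycle_next {x y} : U.next.SameCycle x y ↔ V.next.SameCycle (e x) (e y) := h.sameCycle

theorem degree (x) : U.degree x = V.degree (e x) := by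
  refine Function.minimalPeriod_eq_minimalPeriod_iff.2 fun n => ?_
  have : Function.Semiconj e U.next V.next := h.next_eq
  rw [Function.IsPeriodicPt, Function.IsFixedPt, Function.IsPeriodicPt, Function.IsFixedPt,
    ← (this.iterate_right n).eq, e.apply_eq_iff_eq]

theorem isOuter {x} : U.IsOuter x ↔ V.IsOuter (e x) := by
  refine exists_congr fun i => exists_congr fun j => ?_
  rw [h.cross_eq, ← h.piece_eq, ← h.rev_eq, e.apply_eq_iff_eq, e.apply_eq_iff_eq]

theorem mem_interior {x} : x ∈ U.interior ↔ e x ∈ V.interior := h.isOuter.not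

theorem onSide {i x} : U.OnSide i x ↔ V.OnSide i (e x) := by
  refine exists_congr fun j => ?_
  rw [h.cross_eq, ← h.piece_eq, ← h.sameCycle_next]

theorem onBoundary {x} : U.OnBoundary x ↔ V.OnBoundary (e x) := exists_congr fun _ => h.onSide

theorem isTreeDart {x} : U.IsTreeDart x ↔ V.IsTreeDart (e x) := by
  rw [Topology.IsTreeDart, Topology.IsTreeDart, h.mem_interior, h.onBoundary, h.onBoundary, h.rev_eq]

end

end IsRenaming

end Renaming

namespace IsRenaming

variable {K : Gluing} {U V : Topology (2 * K.edges)} {e : Fin U.darts ≃ Fin V.darts}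
  (h : IsRenaming U.toPre V.toPre e)
include h

theorem isGood {p q : ℕ} (hV : V.IsGood p q) : U.IsGood p q where
  forest x hx hcon := by
    refine hV.forest (e x) (h.mem_interior.1 hx) ?_
    rw [← h.rev_eq]
    refine (eqvGen_congr e (fun a b => ?_) _ _).1 hcon
    rw [h.sameCycle_next, ← h.rev_eq, e.apply_eq_iff_eq]
    simp [h.mem_interior]
  leaves x hx := h.onBoundary.2 (hV.leaves _ (by rw [← h.degree, hx]))
  arcs x hx i i' h1 h2 := hV.arcs (e x) (h.mem_interior.1 hx) i i' (h.onSide.1 h1)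
    (by rw [← h.rev_eq]; exact h.onSide.1 h2)
  cross_le i := by rw [h.cross_eq]; exact hV.cross_le i
  tree_le := by
    rw [Nat.card_congr (e.subtypeEquiv fun x => h.isTreeDart)]
    exact hV.tree_le

theorem connectsInSurface {x y} : U.ConnectsInSurface x y ↔ V.ConnectsInSurface (e x) (e y) := by
  refine eqvGen_congr e (fun x y => ?_) x y
  refine or_congr h.sameCycle_next (or_congr (and_congr h.mem_interior (by rw [← h.rev_eq, e.apply_eq_iff_eq]))
    (exists_congr fun i => exists_congr fun j => ?_))
  have : U.gluePoint i j = V.gluePoint i j := by simp only [Topology.gluePoint, h.cross_eq]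
  rw [h.cross_eq, ← h.piece_eq, ← h.piece_eq, e.apply_eq_iff_eq, e.apply_eq_iff_eq, this]

theorem sameFace {x y} : U.SameFace x y ↔ V.SameFace (e x) (e y) := by
  refine eqvGen_congr e (fun x y => ?_) x y
  refine or_congr ?_ (exists_congr fun i => exists_congr fun j => ?_)
  · exact sameCycle_congr e h.face
  · have : U.glue i j = V.glue i j := by simp only [Topology.glue, h.cross_eq]
    rw [h.cross_eq, ← h.piece_eq, ← h.piece_eq, e.apply_eq_iff_eq, e.apply_eq_iff_eq, this]

theorem isOverlay (hV : V.IsOverlay) : U.IsOverlay where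
  generalPosition :=
    { cross_mate := fun i => by rw [h.cross_eq, h.cross_eq]; exact hV.generalPosition.cross_mate i
      degree_corner := fun i => by
        rw [h.degree, h.corner_eq]; exact hV.generalPosition.degree_corner i
      degree_crossing := fun i j h1 h2 => by
        rw [h.degree, h.piece_eq]
        exact hV.generalPosition.degree_crossing i j h1 (by rwa [← h.cross_eq]) }
  formsGraph x hx := by
    obtain ⟨y, hy, hxy⟩ := hV.formsGraph (e x) (h.mem_interior.1 hx)
    refine ⟨e.symm y, ?_, ?_⟩
    · rwa [h.onBoundary, e.apply_symm_apply]
    · rwa [h.connectsInSurface, e.apply_symm_apply]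

end IsRenaming

theorem Instance.IsValid.of_same {I : Instance} {a b : ℕ} {U V : Topology (2 * I.K.edges)}
    (hV : I.IsValid a b V) (hUV : U.Same V) : I.IsValid a b U := by
  obtain ⟨e, h1, h2, h3, h4⟩ := hUV
  have h : IsRenaming U.toPre V.toPre e := ⟨h1, h2, h3, h4⟩
  refine ⟨h.isOverlay hV.isOverlay, h.isGood hV.isGood, fun s t hst hcon => ?_⟩
  refine hV.isMulticutDual s t hst ?_
  rw [← h.corner_eq, ← h.corner_eq]
  exact h.sameFace.1 hcon


/-! ## The local structure of an overlay -/

theorem sameCycle_apply {α : Type} (f : Equiv.Perm α) (x : α) : f.SameCycle x (f x) := ⟨1, by simp⟩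

/-- On a finite set the nonnegative powers of `f` already exhaust a cycle, so closure of `S` under
`f` suffices. -/
theorem sameCycle_cases {n : ℕ} {f : Equiv.Perm (Fin n)} {p x : Fin n} (h : f.SameCycle p x)
    {S : Set (Fin n)} (hp : p ∈ S) (hS : ∀ y ∈ S, f y ∈ S) : x ∈ S := by
  obtain ⟨k, rfl⟩ := h.exists_nat_pow_eq
  induction k with
  | zero => exact hp
  | succ k ih =>
    rw [pow_succ']
    exact hS _ (ih ⟨k, by simp⟩)

namespace Topology

variable {N : ℕ} (U : Topology N)

theorem piece_zero (i : Fin N) : U.piece i 0 = U.corner i := rfl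

theorem piece_succ (i : Fin N) (j : ℕ) : U.piece i (j + 1) = U.next (U.rev (U.piece i j)) := by
  rw [piece, pow_succ']; rfl

theorem piece_end (i : Fin N) : U.piece i (U.cross i + 1) = U.corner (finRotate N i) :=
  U.side_end i

variable {U}

theorem piece_inj {i i' : Fin N} {j j' : ℕ} (hj : j ≤ U.cross i) (hj' : j' ≤ U.cross i')
    (h : U.next.SameCycle (U.piece i j) (U.piece i' j')) : i = i' ∧ j = j' :=
  U.outer_simple i i' j j' hj hj' h

theorem exists_piece_succ {i : Fin N} {j : ℕ} (hj : j ≤ U.cross i) :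
    ∃ i' j', j' ≤ U.cross i' ∧ U.next (U.rev (U.piece i j)) = U.piece i' j' := by
  rcases hj.lt_or_eq with h | rfl
  · exact ⟨i, j + 1, h, (U.piece_succ i j).symm⟩
  · exact ⟨finRotate N i, 0, Nat.zero_le _, by rw [← piece_succ, piece_end, piece_zero]⟩

theorem exists_piece_pred {i : Fin N} {j : ℕ} (hj : j ≤ U.cross i) :
    ∃ i' j', j' ≤ U.cross i' ∧ U.piece i j = U.next (U.rev (U.piece i' j')) := by
  obtain _ | j := j
  · refine ⟨(finRotate N).symm i, _, le_rfl, ?_⟩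
    rw [← piece_succ, piece_end, Equiv.apply_symm_apply, piece_zero]
  · exact ⟨i, j, by omega, U.piece_succ i j⟩

theorem isOuter_piece {i : Fin N} {j : ℕ} (hj : j ≤ U.cross i) : U.IsOuter (U.piece i j) :=
  ⟨i, j, hj, Or.inl rfl⟩

theorem isOuter_rev {x : Fin U.darts} : U.IsOuter (U.rev x) ↔ U.IsOuter x := by
  simp only [IsOuter, U.rev_rev]
  exact exists_congr fun i => exists_congr fun j => and_congr_right fun _ => or_comm

theorem rev_mem_interior {x : Fin U.darts} : U.rev x ∈ U.interior ↔ x ∈ U.interior :=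
  isOuter_rev.not

theorem IsOuter.cases {x : Fin U.darts} (h : U.IsOuter x) :
    ∃ i j, j ≤ U.cross i ∧ (x = U.piece i j ∨ x = U.rev (U.piece i j)) := by
  obtain ⟨i, j, hj, h | h⟩ := h
  · exact ⟨i, j, hj, Or.inl h⟩
  · exact ⟨i, j, hj, Or.inr (by rw [← h, U.rev_rev])⟩

theorem IsOuter.onBoundary {x : Fin U.darts} (h : U.IsOuter x) : U.OnBoundary x := by
  obtain ⟨i, j, hj, rfl | rfl⟩ := h.cases
  · exact ⟨i, j, hj, Equiv.Perm.SameCycle.refl _ _⟩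
  · obtain ⟨i', j', hj', h⟩ := exists_piece_succ hj
    exact ⟨i', j', hj', by rw [← h]; exact (sameCycle_apply _ _).symm⟩

variable (U) in
/-- The vertices on the boundary have the degrees required by general position. -/
structure BoundaryDegrees : Prop where
  corner : ∀ i, U.degree (U.corner i) = 2
  crossing : ∀ i j, 1 ≤ j → j ≤ U.cross i → U.degree (U.piece i j) = 3

namespace BoundaryDegrees

variable (h : U.BoundaryDegrees)
include h

theorem next_piece_ne {i j} (hj : j ≤ U.cross i) : U.next (U.piece i j) ≠ U.piece i j := by
  intro hfix
  have h1 : U.degree (U.piece i j) = 1 := Function.minimalPeriod_eq_one_iff_isFixedPt.2 hfix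
  obtain _ | j := j
  · have := h.corner i
    rw [← piece_zero, h1] at this
    omega
  · have := h.crossing i (j + 1) (by omega) hj
    omega

/-- Around a crossing point, counterclockwise, come the piece that starts there, the interior dart,
and the reverse of the preceding piece. Degree 3 closes the cycle, since `next` takes the last of
them to the first. -/
theorem next_next_piece {i j} (hj : j + 1 ≤ U.cross i) :
    U.next (U.next (U.piece i (j + 1))) = U.rev (U.piece i j) := by
  apply U.next.injective
  rw [← piece_succ]
  have := Function.isPeriodicPt_minimalPeriod U.next (U.piece i (j + 1))
  rw [show Function.minimalPeriod U.next (U.piece i (j + 1)) = 3 from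
    h.crossing i (j + 1) (by omega) hj] at this
  exact this

theorem isOuter_next_corner (i) : U.IsOuter (U.next (U.corner i)) := by
  obtain ⟨i', j', hj', h'⟩ := exists_piece_pred (U := U) (i := i) (Nat.zero_le _)
  have := Function.isPeriodicPt_minimalPeriod U.next (U.corner i)
  rw [show Function.minimalPeriod U.next (U.corner i) = 2 from h.corner i] at this
  have h2 : U.next (U.next (U.corner i)) = U.next (U.rev (U.piece i' j')) := by
    rw [← h', piece_zero]; exact this
  rw [U.next.injective h2, isOuter_rev]
  exact isOuter_piece hj'

/-- Otherwise `next` would take the piece to a piece leaving from the same vertex, which is the same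
piece because the outer cycle is simple; but no boundary vertex has degree 1. -/
theorem piece_ne_rev_piece {i i' j j'} (hj : j ≤ U.cross i) (hj' : j' ≤ U.cross i') :
    U.piece i j ≠ U.rev (U.piece i' j') := by
  intro heq
  obtain ⟨i₁, j₁, hj₁, h₁⟩ := exists_piece_succ hj'
  rw [← heq] at h₁
  obtain ⟨rfl, rfl⟩ := piece_inj hj hj₁ (by rw [← h₁]; exact sameCycle_apply _ _)
  exact h.next_piece_ne hj h₁

theorem next_piece_mem_interior {i j} (hj0 : 1 ≤ j) (hj : j ≤ U.cross i) :
    U.next (U.piece i j) ∈ U.interior := by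
  intro hout
  obtain ⟨i', j', hj', h' | h'⟩ := hout.cases
  · obtain ⟨rfl, rfl⟩ := piece_inj hj hj' (by rw [← h']; exact sameCycle_apply _ _)
    exact h.next_piece_ne hj h'
  · obtain ⟨j, rfl⟩ : ∃ k, j = k + 1 := ⟨j - 1, by omega⟩
    have h1 := h.next_next_piece hj
    rw [h'] at h1
    obtain ⟨i₁, j₁, hj₁, h₁⟩ := exists_piece_succ hj'
    exact h.piece_ne_rev_piece hj₁ (by omega) (h₁.symm.trans h1)

/-- Both darts at a corner are outer, and so are two of the three darts at a crossing point; the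
third is the one after the piece. -/
theorem eq_next_piece {x} (hx : x ∈ U.interior) {i} (hb : U.OnSide i x) :
    ∃ j, 1 ≤ j ∧ j ≤ U.cross i ∧ x = U.next (U.piece i j) := by
  obtain ⟨j, hj, hs⟩ := hb
  obtain _ | j := j
  · exfalso
    refine hx (sameCycle_cases hs (S := {x | x = U.corner i ∨ x = U.next (U.corner i)})
      (Or.inl rfl) ?_ |>.elim (fun h' => h' ▸ isOuter_piece (j := 0) (Nat.zero_le _))
        fun h' => h' ▸ h.isOuter_next_corner i)
    rintro y (rfl | rfl)
    · exact Or.inr rfl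
    · refine Or.inl ?_
      have := Function.isPeriodicPt_minimalPeriod U.next (U.corner i)
      rwa [show Function.minimalPeriod U.next (U.corner i) = 2 from h.corner i] at this
  · have h3 := h.next_next_piece hj
    rcases sameCycle_cases hs (S := {x | x = U.piece i (j + 1) ∨ x = U.next (U.piece i (j + 1)) ∨
        x = U.rev (U.piece i j)}) (Or.inl rfl) (by
      rintro y (rfl | rfl | rfl)
      · exact Or.inr (Or.inl rfl)
      · exact Or.inr (Or.inr h3)
      · exact Or.inl (piece_succ _ _ _).symm) with rfl | rfl | rfl
    · exact absurd (isOuter_piece hj) hx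
    · exact ⟨j + 1, by omega, hj, rfl⟩
    · exact absurd (isOuter_rev.2 (isOuter_piece (by omega))) hx

theorem face_piece {i j} (hj : j + 1 ≤ U.cross i) :
    (U.next⁻¹ * U.rev) (U.piece i j) = U.next (U.piece i (j + 1)) := by
  rw [Equiv.Perm.mul_apply, Equiv.Perm.inv_eq_iff_eq, h.next_next_piece hj]

omit h in
theorem onSide_next_piece {i j} (hj : j ≤ U.cross i) : U.OnSide i (U.next (U.piece i j)) :=
  ⟨j, hj, sameCycle_apply _ _⟩

omit h in
theorem face_of_rev_eq {i j} {x} (hx : U.rev x = U.next (U.piece i j)) :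
    (U.next⁻¹ * U.rev) x = U.piece i j := by
  rw [Equiv.Perm.mul_apply, Equiv.Perm.inv_eq_iff_eq, hx]

omit h in
theorem face_rev_piece (i) (j) :
    (U.next⁻¹ * U.rev).SameCycle (U.rev (U.corner i)) (U.rev (U.piece i j)) := by
  induction j with
  | zero => rfl
  | succ j ih =>
    refine ih.trans (Equiv.Perm.SameCycle.symm ⟨1, ?_⟩)
    rw [zpow_one, Equiv.Perm.mul_apply, Equiv.Perm.inv_eq_iff_eq, U.rev_rev, piece_succ]

end BoundaryDegrees

end Topology


/-! ## Counting by Euler's formula -/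

namespace Topology

variable {N : ℕ} {U : Topology N}

variable (U) in
/-- The edge of `x` is an arc. -/
def IsArcDart (x : Fin U.darts) : Prop :=
  x ∈ U.interior ∧ U.OnBoundary x ∧ U.OnBoundary (U.rev x)

theorem isTreeDart_or_isArcDart {x : Fin U.darts} (hx : x ∈ U.interior) :
    U.IsTreeDart x ∨ U.IsArcDart x := by
  by_cases h : U.OnBoundary x ∧ U.OnBoundary (U.rev x)
  · exact Or.inr ⟨hx, h⟩
  · exact Or.inl ⟨hx, h⟩

variable (U) in
/-- Arcs connect different sides. -/
def ArcsConnectSides : Prop :=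
  ∀ x ∈ U.interior, ∀ i i', U.OnSide i x → U.OnSide i' (U.rev x) → i ≠ i'

variable (U) in
/-- The face to the left of a dart. -/
def face (x : Fin U.darts) : Quotient (Equiv.Perm.SameCycle.setoid (U.next⁻¹ * U.rev)) :=
  Quotient.mk _ x

theorem face_apply (x : Fin U.darts) : U.face ((U.next⁻¹ * U.rev) x) = U.face x :=
  Quotient.sound (sameCycle_apply _ _).symm

variable (U) in
/-- The face is the outer face, or it has a corner or a tree edge on its boundary. -/
def IsSpecial (q : Quotient (Equiv.Perm.SameCycle.setoid (U.next⁻¹ * U.rev))) : Prop :=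
  (∃ i, q = U.face (U.rev (U.corner i))) ∨ (∃ i, q = U.face (U.piece i (U.cross i))) ∨
    ∃ x, U.IsTreeDart x ∧ q = U.face x

open Classical in
variable (U) in
/-- The number of darts of arcs on the boundary of a face. -/
noncomputable def arcsOn (q : Quotient (Equiv.Perm.SameCycle.setoid (U.next⁻¹ * U.rev))) : ℕ :=
  (Finset.univ.filter fun x => U.IsArcDart x ∧ U.face x = q).card

/-- The outer face is counted once per side, so it need not be shown that all sides see the same
one. The last pieces contribute `N` more, and each tree dart at most one face. -/
theorem card_isSpecial_le :
    Nat.card {q // U.IsSpecial q} ≤ 2 * N + Nat.card {x // U.IsTreeDart x} := by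
  classical
  have h : Function.Surjective (fun s : (Fin N ⊕ Fin N) ⊕ {x // U.IsTreeDart x} =>
      (show {q // U.IsSpecial q} from match s with
        | Sum.inl (Sum.inl i) => ⟨U.face (U.rev (U.corner i)), Or.inl ⟨i, rfl⟩⟩
        | Sum.inl (Sum.inr i) => ⟨U.face (U.piece i (U.cross i)), Or.inr (Or.inl ⟨i, rfl⟩)⟩
        | Sum.inr x => ⟨U.face x, Or.inr (Or.inr ⟨x, x.2, rfl⟩)⟩)) := by
    rintro ⟨q, ⟨i, rfl⟩ | ⟨i, rfl⟩ | ⟨x, hx, rfl⟩⟩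
    · exact ⟨Sum.inl (Sum.inl i), rfl⟩
    · exact ⟨Sum.inl (Sum.inr i), rfl⟩
    · exact ⟨Sum.inr ⟨x, hx⟩, rfl⟩
  have := Nat.card_le_card_of_surjective _ h
  rw [Nat.card_sum, Nat.card_sum] at this
  simp only [Nat.card_eq_fintype_card (α := Fin N), Fintype.card_fin] at this
  omega

namespace BoundaryDegrees

variable (h : U.BoundaryDegrees)
include h

omit h in
theorem isSpecial_face_rev_piece {i j} : U.IsSpecial (U.face (U.rev (U.piece i j))) :=
  Or.inl ⟨i, Quotient.sound (face_rev_piece i j).symm⟩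

/-- On a face that is not special, an arc is followed by a piece of a side and by another arc. -/
theorem next_arc (harcs : U.ArcsConnectSides) {x} (hx : U.IsArcDart x)
    (hs : ¬ U.IsSpecial (U.face x)) :
    ∃ i j, 1 ≤ j ∧ j + 1 ≤ U.cross i ∧ U.rev x = U.next (U.piece i j) ∧
      U.IsArcDart (U.next (U.piece i (j + 1))) ∧
      U.face (U.next (U.piece i (j + 1))) = U.face x ∧ U.next (U.piece i (j + 1)) ≠ x := by
  obtain ⟨hxi, hxb, i, hri⟩ := hx
  obtain ⟨j, hj1, hj, hrev⟩ := h.eq_next_piece (rev_mem_interior.2 hxi) hri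
  have hf : U.face (U.piece i j) = U.face x := by rw [← face_of_rev_eq hrev, face_apply]
  have hj' : j + 1 ≤ U.cross i := by
    rcases hj.lt_or_eq with hlt | rfl
    · exact hlt
    · exact absurd (Or.inr (Or.inl ⟨i, hf.symm⟩)) hs
  have hf' : U.face (U.next (U.piece i (j + 1))) = U.face x := by
    rw [← h.face_piece hj', face_apply, hf]
  refine ⟨i, j, hj1, hj', hrev, ?_, hf', ?_⟩
  · refine (isTreeDart_or_isArcDart (h.next_piece_mem_interior (by omega) hj')).resolve_left
      fun ht => hs (Or.inr (Or.inr ⟨_, ht, hf'.symm⟩))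
  · rintro rfl
    exact harcs _ hxi i i (onSide_next_piece hj') hri rfl

theorem two_le_arcsOn (harcs : U.ArcsConnectSides)
    {q : Quotient (Equiv.Perm.SameCycle.setoid (U.next⁻¹ * U.rev))} (hq : ¬ U.IsSpecial q) :
    2 ≤ U.arcsOn q := by
  classical
  obtain ⟨x, hx, rfl⟩ : ∃ x, U.IsArcDart x ∧ U.face x = q := by
    induction q using Quotient.inductionOn with
    | h x =>
      change ¬ U.IsSpecial (U.face x) at hq
      by_cases hx : U.IsOuter x
      · obtain ⟨i, j, hj, rfl | rfl⟩ := hx.cases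
        · rcases hj.lt_or_eq with hlt | rfl
          · have hf : U.face (U.next (U.piece i (j + 1))) = U.face (U.piece i j) := by
              rw [← h.face_piece hlt, face_apply]
            exact ⟨_, (isTreeDart_or_isArcDart (h.next_piece_mem_interior (by omega)
              hlt)).resolve_left fun ht => hq (Or.inr (Or.inr ⟨_, ht, hf.symm⟩)), hf⟩
          · exact absurd (Or.inr (Or.inl ⟨i, rfl⟩)) hq
        · exact absurd isSpecial_face_rev_piece hq
      · exact ⟨x, (isTreeDart_or_isArcDart hx).resolve_left fun ht =>
          hq (Or.inr (Or.inr ⟨x, ht, rfl⟩)), rfl⟩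
  obtain ⟨i, j, -, -, -, h1, h2, h3⟩ := h.next_arc harcs hx hq
  exact Finset.one_lt_card.2 ⟨_, by simpa using ⟨h1, h2⟩, x, by simpa using hx, h3⟩

/-- Euler's formula, as an inequality between the numbers of faces and arcs. -/
theorem euler : Nat.card {x // U.IsArcDart x} + 4 ≤
    2 * numCycles (U.next⁻¹ * U.rev) + Nat.card {x // U.IsTreeDart x} := by
  classical
  let P : Finset (Fin U.darts) := Finset.univ.filter fun x => ∃ i j, j ≤ U.cross i ∧ x = U.piece i j
  let A : Finset (Fin U.darts) := Finset.univ.filter fun x => U.IsArcDart x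
  let T : Finset (Fin U.darts) := Finset.univ.filter fun x => U.IsTreeDart x
  have hA : Nat.card {x // U.IsArcDart x} = A.card := by
    rw [Nat.card_eq_fintype_card, Fintype.card_subtype]
  have hT : Nat.card {x // U.IsTreeDart x} = T.card := by
    rw [Nat.card_eq_fintype_card, Fintype.card_subtype]
  -- A boundary vertex is the start of a piece. At any other vertex all darts are tree darts.
  have hv : numCycles U.next ≤ P.card + T.card := by
    refine le_trans ?_ (Finset.card_union_le P T)
    have hsurj : Function.Surjective fun x : (P ∪ T : Finset (Fin U.darts)) =>
        (Quotient.mk (Equiv.Perm.SameCycle.setoid U.next) x.1) := by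
      intro q
      induction q using Quotient.inductionOn with
      | h x =>
        by_cases hx : U.OnBoundary x
        · obtain ⟨i, j, hj, hs⟩ := hx
          exact ⟨⟨U.piece i j, by simpa [P] using Or.inl ⟨i, j, hj, rfl⟩⟩, Quotient.sound hs⟩
        · exact ⟨⟨x, by simpa [T] using Or.inr ⟨fun ho => hx ho.onBoundary, fun hb => hx hb.1⟩⟩, rfl⟩
    refine (Nat.card_le_card_of_surjective _ hsurj).trans_eq ?_
    rw [Nat.card_eq_fintype_card, Fintype.card_coe]
  have he : U.darts ≤ 2 * numCycles U.rev := by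
    have : (Finset.univ : Finset (Fin U.darts)).card ≤ 2 * (Finset.univ.image fun x =>
        Quotient.mk (Equiv.Perm.SameCycle.setoid U.rev) x).card := by
      refine Finset.card_le_mul_card_image _ _ fun q hq => ?_
      obtain ⟨x, -, rfl⟩ := Finset.mem_image.1 hq
      refine (Finset.card_le_card (t := {x, U.rev x}) fun y hy => ?_).trans Finset.card_le_two
      have hy' : U.rev.SameCycle x y := (Quotient.exact (Finset.mem_filter.1 hy).2).symm
      have := sameCycle_cases hy' (S := {y | y = x ∨ y = U.rev x}) (Or.inl rfl) (by
        rintro z (rfl | rfl)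
        · exact Or.inr rfl
        · exact Or.inl (U.rev_rev x))
      simpa using this
    rw [Finset.card_univ, Fintype.card_fin] at this
    refine this.trans (Nat.mul_le_mul_left 2 ?_)
    rw [numCycles, Nat.card_eq_fintype_card]
    exact Finset.card_le_univ _
  -- Pieces, reversed pieces, arc darts and tree darts are pairwise disjoint.
  have hd : 2 * P.card + A.card + T.card ≤ U.darts := by
    have h1 : Disjoint P (P.image U.rev) := by
      refine Finset.disjoint_left.2 fun x hx hx' => ?_
      obtain ⟨y, hy, rfl⟩ := Finset.mem_image.1 hx'
      obtain ⟨i, j, hj, rfl⟩ := (Finset.mem_filter.1 hy).2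
      obtain ⟨i', j', hj', h'⟩ := (Finset.mem_filter.1 hx).2
      exact h.piece_ne_rev_piece hj' hj h'.symm
    have h2 : Disjoint (P ∪ P.image U.rev) A := by
      refine Finset.disjoint_left.2 fun x hx hx' => (Finset.mem_filter.1 hx').2.1 ?_
      rcases Finset.mem_union.1 hx with hx | hx
      · obtain ⟨i, j, hj, rfl⟩ := (Finset.mem_filter.1 hx).2
        exact isOuter_piece hj
      · obtain ⟨y, hy, rfl⟩ := Finset.mem_image.1 hx
        obtain ⟨i, j, hj, rfl⟩ := (Finset.mem_filter.1 hy).2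
        exact isOuter_rev.2 (isOuter_piece hj)
    have h3 : Disjoint (P ∪ P.image U.rev ∪ A) T := by
      refine Finset.disjoint_left.2 fun x hx hx' => ?_
      have hxT := (Finset.mem_filter.1 hx').2
      rcases Finset.mem_union.1 hx with hx | hx
      · refine hxT.1 ?_
        rcases Finset.mem_union.1 hx with hx | hx
        · obtain ⟨i, j, hj, rfl⟩ := (Finset.mem_filter.1 hx).2
          exact isOuter_piece hj
        · obtain ⟨y, hy, rfl⟩ := Finset.mem_image.1 hx
          obtain ⟨i, j, hj, rfl⟩ := (Finset.mem_filter.1 hy).2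
          exact isOuter_rev.2 (isOuter_piece hj)
      · exact hxT.2 (Finset.mem_filter.1 hx).2.2
    have := Finset.card_le_univ (P ∪ P.image U.rev ∪ A ∪ T)
    rw [Finset.card_union_of_disjoint h3, Finset.card_union_of_disjoint h2,
      Finset.card_union_of_disjoint h1, Finset.card_image_of_injective _ U.rev.injective,
      Fintype.card_fin] at this
    omega
  -- With V + F = E + 2, V ≤ |P| + |T| and 2E ≥ 2|P| + |A| + |T|, the number of pieces cancels.
  have := U.planar
  omega

open Classical in
/-- The number of darts of arcs that lie on a special face or on a face with at least three arcs. -/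
theorem card_irregular_arcs (harcs : U.ArcsConnectSides) :
    (Finset.univ.filter fun x => U.IsArcDart x ∧
      (U.IsSpecial (U.face x) ∨ 3 ≤ U.arcsOn (U.face x))).card ≤
      12 * N + 9 * Nat.card {x // U.IsTreeDart x} := by
  have hE := h.euler
  have hS := card_isSpecial_le (U := U)
  let Q := Quotient (Equiv.Perm.SameCycle.setoid (U.next⁻¹ * U.rev))
  have h1 : (Finset.univ.filter fun x => U.IsArcDart x ∧
      (U.IsSpecial (U.face x) ∨ 3 ≤ U.arcsOn (U.face x))).card =
      ∑ q : Q, if U.IsSpecial q ∨ 3 ≤ U.arcsOn q then U.arcsOn q else 0 := by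
    rw [Finset.card_eq_sum_card_fiberwise (f := U.face) (t := Finset.univ) (by simp)]
    refine Finset.sum_congr rfl fun q _ => ?_
    rw [Finset.filter_filter]
    split_ifs with hq
    · unfold arcsOn
      congr 1
      ext x
      simp only [Finset.mem_filter, Finset.mem_univ, true_and]
      constructor
      · tauto
      · rintro ⟨hx, rfl⟩; exact ⟨⟨hx, hq⟩, rfl⟩
    · refine Finset.card_eq_zero.2 (Finset.filter_eq_empty_iff.2 ?_)
      rintro x - ⟨⟨hx, hx'⟩, rfl⟩
      exact hq hx'
  have h2 : Nat.card {x // U.IsArcDart x} = ∑ q : Q, U.arcsOn q := by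
    rw [Nat.card_eq_fintype_card, Fintype.card_subtype,
      Finset.card_eq_sum_card_fiberwise (f := U.face) (t := Finset.univ) (by simp)]
    refine Finset.sum_congr rfl fun q _ => ?_
    rw [Finset.filter_filter, arcsOn]
  have h3 : numCycles (U.next⁻¹ * U.rev) = ∑ _q : Q, 1 := by
    rw [numCycles, Nat.card_eq_fintype_card]; simp [Q]
  have h4 : Nat.card {q // U.IsSpecial q} = ∑ q : Q, if U.IsSpecial q then 1 else 0 := by
    rw [Nat.card_eq_fintype_card, Fintype.card_subtype, Finset.card_filter]
  -- Face by face, with a arc darts on the face: [irregular]·a + 6 ≤ 3a + 6·[special]. A special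
  -- face satisfies it trivially, a = 2 gives equality, and a ≥ 3 gives 6 ≤ 2a. Adding three times
  -- Euler's inequality removes the number of faces.
  have h5 : (∑ q : Q, if U.IsSpecial q ∨ 3 ≤ U.arcsOn q then U.arcsOn q else 0) +
      6 * ∑ _q : Q, 1 ≤ 3 * (∑ q : Q, U.arcsOn q) +
        6 * ∑ q : Q, if U.IsSpecial q then 1 else 0 := by
    rw [Finset.mul_sum, Finset.mul_sum, Finset.mul_sum, ← Finset.sum_add_distrib,
      ← Finset.sum_add_distrib]
    refine Finset.sum_le_sum fun q _ => ?_
    by_cases hq : U.IsSpecial q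
    · simp only [hq, true_or, if_true]; omega
    · have := h.two_le_arcsOn harcs hq
      simp only [hq, false_or, if_false]
      split_ifs <;> omega
  rw [← h1, ← h2, ← h3, ← h4] at h5
  omega

end BoundaryDegrees

variable (U) in
/-- The two crossing points after positions `j` and `j + 1` of side `i` are joined by arcs to two
successive crossing points. -/
def IsRegular (i : Fin N) (j : ℕ) : Prop :=
  ∃ i' j', 1 ≤ j' ∧ j' + 1 ≤ U.cross i' ∧ U.rev (U.next (U.piece i j)) = U.next (U.piece i' (j' + 1)) ∧
    U.rev (U.next (U.piece i (j + 1))) = U.next (U.piece i' j')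

namespace BoundaryDegrees

variable (h : U.BoundaryDegrees)
include h

/-- The face runs along the arc `x`, the piece between the two crossing points, the arc `y`, a piece
of another side, and then an arc that differs from `y`. As `x` also differs from `y` and there are
at most two arc darts, that last arc is `x`, and the face closes up to a strip. -/
theorem isRegular_of (harcs : U.ArcsConnectSides) {i j} (hj1 : 1 ≤ j) (hj : j + 1 ≤ U.cross i)
    (hy : U.IsArcDart (U.next (U.piece i (j + 1))))
    (hs : ¬ U.IsSpecial (U.face (U.next (U.piece i (j + 1)))))
    (ha : U.arcsOn (U.face (U.next (U.piece i (j + 1)))) ≤ 2) : U.IsRegular i j := by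
  classical
  set y := U.next (U.piece i (j + 1)) with hydef
  set x := U.rev (U.next (U.piece i j)) with hxdef
  have hxi : x ∈ U.interior := rev_mem_interior.2 (h.next_piece_mem_interior hj1 (by omega))
  have hfp : U.face (U.piece i j) = U.face y := by rw [hydef, ← h.face_piece hj, face_apply]
  have hfx : U.face x = U.face y := by
    rw [← hfp, ← face_of_rev_eq (x := x) (by rw [hxdef, U.rev_rev]), face_apply]
  have hx : U.IsArcDart x := (isTreeDart_or_isArcDart hxi).resolve_left
    fun ht => hs (Or.inr (Or.inr ⟨x, ht, hfx.symm⟩))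
  have hxy : x ≠ y := by
    intro hxy
    refine harcs y hy.1 i i (onSide_next_piece hj) ?_ rfl
    rw [← hxy, hxdef, U.rev_rev]
    exact onSide_next_piece (by omega)
  obtain ⟨i', j', hj1', hj', hrev, hz, hfz, hzy⟩ := h.next_arc harcs hy hs
  refine ⟨i', j', hj1', hj', ?_, hrev⟩
  by_contra hne
  have : 2 < U.arcsOn (U.face y) := Finset.two_lt_card.2
    ⟨x, by simpa using ⟨hx, hfx⟩, y, by simpa using hy, _, by simpa using ⟨hz, hfz⟩, hxy, hne, hzy.symm⟩
  omega

omit h in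
theorem next_piece_inj {i i' j j'} (hj : j ≤ U.cross i) (hj' : j' ≤ U.cross i')
    (heq : U.next (U.piece i j) = U.next (U.piece i' j')) : i = i' ∧ j = j' :=
  piece_inj hj hj' (by rw [U.next.injective heq])

open Classical in
-- An irregular pair is charged to the interior dart at its second crossing point. This dart is an
-- arc on an irregular face, or a tree dart; the latter account for the tenth multiple of the tree
-- darts.
theorem card_not_isRegular (harcs : U.ArcsConnectSides) :
    (Finset.univ.sigma fun i : Fin N => (Finset.range (U.cross i)).filter fun j =>
      1 ≤ j ∧ ¬ U.IsRegular i j).card ≤ 12 * N + 10 * Nat.card {x // U.IsTreeDart x} := by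
  have hc := h.card_irregular_arcs harcs
  have hT : Nat.card {x // U.IsTreeDart x} = (Finset.univ.filter U.IsTreeDart).card := by
    rw [Nat.card_eq_fintype_card, Fintype.card_subtype]
  have : (Finset.univ.sigma fun i : Fin N => (Finset.range (U.cross i)).filter fun j =>
      1 ≤ j ∧ ¬ U.IsRegular i j).card ≤ ((Finset.univ.filter fun x => U.IsArcDart x ∧
      (U.IsSpecial (U.face x) ∨ 3 ≤ U.arcsOn (U.face x))) ∪ Finset.univ.filter U.IsTreeDart).card := by
    refine Finset.card_le_card_of_injOn (fun p => U.next (U.piece p.1 (p.2 + 1))) ?_ ?_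
    · rintro ⟨i, j⟩ hp
      simp only [Finset.coe_sigma, Set.mem_sigma_iff, Finset.mem_coe, Finset.mem_filter,
        Finset.mem_range, Finset.mem_univ, true_and] at hp
      obtain ⟨hj, hj1, hr⟩ := hp
      simp only [Finset.coe_union, Set.mem_union, Finset.mem_coe, Finset.mem_filter,
        Finset.mem_univ, true_and]
      by_contra hcon
      push Not at hcon
      obtain ⟨h1, h2⟩ := hcon
      have hy := (isTreeDart_or_isArcDart (h.next_piece_mem_interior (i := i) (j := j + 1)
        (by omega) hj)).resolve_left h2
      exact hr (h.isRegular_of harcs hj1 hj hy (h1 hy).1 (by have := (h1 hy).2; omega))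
    · rintro ⟨i, j⟩ hp ⟨i', j'⟩ hp' heq
      simp only [Finset.coe_sigma, Set.mem_sigma_iff, Finset.mem_coe, Finset.mem_filter,
        Finset.mem_range, Finset.mem_univ, true_and] at hp hp'
      obtain ⟨rfl, h2⟩ := next_piece_inj (j := j + 1) (j' := j' + 1) hp.1 hp'.1 heq
      obtain rfl : j = j' := Nat.succ_injective h2
      rfl
  have h2 := Finset.card_union_le (Finset.univ.filter fun x => U.IsArcDart x ∧
      (U.IsSpecial (U.face x) ∨ 3 ≤ U.arcsOn (U.face x))) (Finset.univ.filter U.IsTreeDart)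
  omega

end BoundaryDegrees

end Topology


/-! ## Tables with few runs -/

/-- The list is a concatenation of at most `c` intervals. -/
def HasRuns (M c : ℕ) (l : List ℕ) : Prop :=
  ∃ us : List (List ℕ), us.length ≤ c ∧ (∀ u ∈ us, u ∈ runs M) ∧ us.flatten = l

namespace HasRuns

variable {M c c' : ℕ} {l l' : List ℕ}

theorem mono (h : HasRuns M c l) (hc : c ≤ c') : HasRuns M c' l :=
  let ⟨us, h1, h2⟩ := h
  ⟨us, h1.trans hc, h2⟩

theorem nil : HasRuns M 0 [] := ⟨[], by simp⟩

theorem append (h : HasRuns M c l) (h' : HasRuns M c' l') : HasRuns M (c + c') (l ++ l') := by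
  obtain ⟨us, h1, h2, rfl⟩ := h
  obtain ⟨vs, h3, h4, rfl⟩ := h'
  exact ⟨us ++ vs, by simpa using Nat.add_le_add h1 h3, by simpa [or_imp, forall_and] using ⟨h2, h4⟩,
    by simp⟩

theorem range' {s n : ℕ} (hs : s < M) (hn : n < M) : HasRuns M 1 (List.range' s n) :=
  ⟨[List.range' s n], by simp, by simpa using range'_mem_runs hs hn, by simp⟩

theorem singleton {v : ℕ} (hv : v < M) (hM : 1 < M) : HasRuns M 1 [v] := range' (n := 1) hv hM

theorem flatMap {α : Type} {L : List α} {f : α → List ℕ} {c : α → ℕ}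
    (h : ∀ x ∈ L, HasRuns M (c x) (f x)) : HasRuns M (L.map c).sum (L.flatMap f) := by
  induction L with
  | nil => exact nil
  | cons x L ih =>
    rw [List.map_cons, List.sum_cons, List.flatMap_cons]
    exact (h x (by simp)).append (ih fun y hy => h y (by simp [hy]))

theorem of_lt (h : ∀ v ∈ l, v < M) (hM : 1 < M) : HasRuns M l.length l := by
  have := flatMap (L := l) (f := fun v => [v]) (c := fun _ => 1) fun v hv => singleton (h v hv) hM
  simpa using this

/-- Candidates have exactly `c` intervals; missing ones are supplied by empty intervals. -/
theorem mem_tableCandidates (h : HasRuns M c l) (hM : 0 < M) : l ∈ tableCandidates M c := by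
  obtain ⟨us, h1, h2, rfl⟩ := h
  refine mem_seqs.2 ⟨us ++ List.replicate (c - us.length) [], by simp; omega, fun u hu => ?_, by simp⟩
  rcases List.mem_append.1 hu with hu | hu
  · exact h2 u hu
  · rw [List.eq_of_mem_replicate hu]
    exact range'_mem_runs (s := 0) (n := 0) hM hM

/-- A sequence is a concatenation of decreasing intervals. -/
theorem of_breaks (f : ℕ → ℕ) (n a : ℕ) : ∃ us : List (ℕ × ℕ),
    us.length ≤ 1 + ((List.range' a n).filter fun j => f j ≠ f (j + 1) + 1).length ∧
      us.flatMap (fun u => (List.range' u.1 (u.2 + 1)).reverse) = (List.range' a (n + 1)).map f := by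
  induction n generalizing a with
  | zero => exact ⟨[(f a, 0)], by simp, by simp⟩
  | succ n ih =>
    obtain ⟨us, h1, h2⟩ := ih (a + 1)
    rw [List.range'_succ (n := n + 1), List.map_cons, ← h2, List.range'_succ (n := n),
      List.filter_cons]
    by_cases hb : f a = f (a + 1) + 1
    · obtain _ | ⟨⟨s, k⟩, us⟩ := us
      · simp [List.range'_succ] at h2
      -- The first decreasing interval of the rest begins with its largest value `s + k`. When `f a`
      -- is one larger, the interval is extended at that end instead of a new one being opened.
      · have hs : s + k = f (a + 1) := by
          have := congrArg List.head? h2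
          rw [List.range'_succ (n := n), List.flatMap_cons, List.range'_concat] at this
          simpa using this
        refine ⟨(s, k + 1) :: us, by simpa [hb] using h1, ?_⟩
        rw [List.flatMap_cons, List.flatMap_cons, List.range'_concat (n := k + 1), hb, ← hs]
        simp
        omega
    · refine ⟨(f a, 0) :: us, ?_, by simp⟩
      rw [if_pos (by simpa using hb), List.length_cons, List.length_cons]
      omega

theorem of_breaks_map {f : ℕ → ℕ} {n : ℕ} (hf : ∀ j < n, f j < M) (hn : n < M) :
    HasRuns M (1 + ((List.range (n - 1)).filter fun j => f j ≠ f (j + 1) + 1).length)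
      ((List.range n).map f) := by
  obtain _ | n := n
  · exact nil.mono (Nat.zero_le _)
  obtain ⟨us, h1, h2⟩ := of_breaks f n 0
  rw [← List.range_eq_range'] at h1 h2
  refine ⟨us.map fun u => (List.range' u.1 (u.2 + 1)).reverse, by simpa using h1, ?_, by
    rw [← List.flatMap_def, h2]⟩
  simp only [List.mem_map]
  rintro _ ⟨⟨s, k⟩, hu, rfl⟩
  refine reverse_range'_mem_runs ?_ ?_
  · have : s ∈ (List.range (n + 1)).map f := by
      rw [← h2]
      exact List.mem_flatMap.2 ⟨_, hu, by simp⟩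
    obtain ⟨j, hj, rfl⟩ := List.mem_map.1 this
    exact hf j (List.mem_range.1 hj)
  · have h3 := congrArg List.length h2
    rw [List.length_flatMap, List.length_map, List.length_range] at h3
    have := List.single_le_sum (l := us.map fun u => ((List.range' u.1 (u.2 + 1)).reverse).length)
      (by simp) (k + 1) (List.mem_map.2 ⟨_, hu, by simp⟩)
    omega

end HasRuns

theorem map_idxOf {α : Type} [DecidableEq α] {l : List α} (h : l.Nodup) :
    l.map (fun x => l.idxOf x) = List.range l.length := by
  refine List.ext_getElem (by simp) fun j h1 h2 => ?_
  simp [h.idxOf_getElem]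

/-- This is the source of all the intervals: a permutation that takes a block of the dart list in
order to another block has one interval there in its table. -/
theorem map_idxOf_infix {α : Type} [DecidableEq α] {l s : List α} (h : l.Nodup)
    (hs : s <:+: l) : ∃ a, s.map (fun x => l.idxOf x) = List.range' a s.length ∧
      a + s.length ≤ l.length := by
  obtain ⟨A, B, hl⟩ := hs
  have h1 := map_idxOf h
  have h2 : l.map (fun x => l.idxOf x) = (A.map fun x => l.idxOf x) ++
      ((s.map fun x => l.idxOf x) ++ B.map fun x => l.idxOf x) := by
    rw [← List.map_append, ← List.map_append, ← List.append_assoc, hl]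
  have hlen : A.length + s.length + B.length = l.length := by rw [← hl]; simp [Nat.add_assoc]
  refine ⟨A.length, ?_, by omega⟩
  rw [h2] at h1
  have h3 := congrArg (fun t => (t.drop A.length).take s.length) h1
  rw [List.drop_left' (by simp), List.take_left' (by simp)] at h3
  rw [h3]
  refine List.ext_getElem (by simp; omega) fun j h1 h2 => ?_
  simp

theorem nodup_flatMap_range {α : Type} {N : ℕ} {c : Fin N → ℕ} {g : Fin N → ℕ → α}
    (h : ∀ i i' j j', j < c i → j' < c i' → g i j = g i' j' → i = i' ∧ j = j') :
    ((List.finRange N).flatMap fun i => (List.range (c i)).map (g i)).Nodup := by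
  refine List.nodup_flatMap.2 ⟨fun i _ => ?_, ?_⟩
  · refine List.Nodup.map_on (fun j hj j' hj' heq => ?_) List.nodup_range
    exact (h i i j j' (List.mem_range.1 hj) (List.mem_range.1 hj') heq).2
  · refine (List.nodup_finRange N).imp fun {i i'} hne => ?_
    intro x hx hx'
    obtain ⟨j, hj, rfl⟩ := List.mem_map.1 hx
    obtain ⟨j', hj', heq⟩ := List.mem_map.1 hx'
    exact hne (h i' i j' j (List.mem_range.1 hj') (List.mem_range.1 hj) heq).1.symm

theorem infix_flatMap {α β : Type} {L : List α} {f : α → List β} {x : α} (hx : x ∈ L) :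
    f x <:+: L.flatMap f := by
  obtain ⟨A, B, rfl⟩ := List.append_of_mem hx
  exact ⟨A.flatMap f, B.flatMap f, by simp⟩


/-! ## A numbering of the darts with few runs -/

theorem HasRuns.flatMap_finRange {N M : ℕ} {α : Type} {c : Fin N → ℕ} {f : Fin N → List α}
    {g : α → ℕ} (hf : ∀ i, HasRuns M (c i) ((f i).map g)) :
    HasRuns M (∑ i, c i) (((List.finRange N).flatMap f).map g) := by
  rw [List.map_flatMap, Fin.sum_univ_def]
  exact HasRuns.flatMap fun i _ => hf i

namespace Topology

variable {N : ℕ} (U : Topology N)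

/-- The pieces of a side. -/
def sidePieces (i : Fin N) : List (Fin U.darts) := (List.range (U.cross i + 1)).map (U.piece i)

/-- The reversed pieces of a side. -/
def revPieces (i : Fin N) : List (Fin U.darts) :=
  (List.range (U.cross i + 1)).map fun j => U.rev (U.piece i j)

/-- The darts that leave from the crossing points of a side into the interior. -/
def spokes (i : Fin N) : List (Fin U.darts) :=
  (List.range (U.cross i)).map fun j => U.next (U.piece i (j + 1))

/-- The darts that leave from the boundary, and the reversed pieces of the sides. -/
def boundaryList : List (Fin U.darts) :=
  (List.finRange N).flatMap U.sidePieces ++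
    ((List.finRange N).flatMap U.revPieces ++ (List.finRange N).flatMap U.spokes)

/-- The other darts. -/
noncomputable def innerList : List (Fin U.darts) :=
  (Finset.univ.filter fun x => x ∉ U.boundaryList).toList

/-- All darts, in an order in which the permutations have few runs. -/
noncomputable def dartList : List (Fin U.darts) := U.boundaryList ++ U.innerList

theorem mem_dartList (x : Fin U.darts) : x ∈ U.dartList := by
  rw [dartList, List.mem_append, innerList, Finset.mem_toList, Finset.mem_filter]
  by_cases hx : x ∈ U.boundaryList
  · exact Or.inl hx
  · exact Or.inr ⟨Finset.mem_univ _, hx⟩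

variable {U}

theorem piece_mem_boundaryList {i j} (hj : j ≤ U.cross i) : U.piece i j ∈ U.boundaryList :=
  List.mem_append_left _ (List.mem_flatMap.2 ⟨i, List.mem_finRange i,
    List.mem_map.2 ⟨j, List.mem_range.2 (by omega), rfl⟩⟩)

theorem rev_piece_mem_boundaryList {i j} (hj : j ≤ U.cross i) :
    U.rev (U.piece i j) ∈ U.boundaryList :=
  List.mem_append_right _ (List.mem_append_left _ (List.mem_flatMap.2 ⟨i, List.mem_finRange i,
    List.mem_map.2 ⟨j, List.mem_range.2 (by omega), rfl⟩⟩))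

theorem next_piece_mem_boundaryList {i j} (hj1 : 1 ≤ j) (hj : j ≤ U.cross i) :
    U.next (U.piece i j) ∈ U.boundaryList :=
  List.mem_append_right _ (List.mem_append_right _ (List.mem_flatMap.2 ⟨i, List.mem_finRange i,
    List.mem_map.2 ⟨j - 1, List.mem_range.2 (by omega), by rw [Nat.sub_add_cancel hj1]⟩⟩))

variable (U) in
theorem sidePieces_infix (i : Fin N) : U.sidePieces i <:+: U.dartList := by
  refine (infix_flatMap (f := U.sidePieces) (List.mem_finRange i)).trans ?_
  exact ⟨[], _, by rw [dartList, boundaryList, List.nil_append, List.append_assoc]⟩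

variable (U) in
theorem revPieces_infix (i : Fin N) : U.revPieces i <:+: U.dartList := by
  refine (infix_flatMap (f := U.revPieces) (List.mem_finRange i)).trans ?_
  exact ⟨(List.finRange N).flatMap U.sidePieces, (List.finRange N).flatMap U.spokes ++ U.innerList,
    by simp [dartList, boundaryList]⟩

variable (U) in
theorem spokes_infix (i : Fin N) : U.spokes i <:+: U.dartList := by
  refine (infix_flatMap (f := U.spokes) (List.mem_finRange i)).trans ?_
  exact ⟨(List.finRange N).flatMap U.sidePieces ++ (List.finRange N).flatMap U.revPieces, U.innerList,
    by simp [dartList, boundaryList]⟩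

namespace BoundaryDegrees

variable (h : U.BoundaryDegrees)
include h

theorem nodup_dartList : U.dartList.Nodup := by
  refine List.Nodup.append (List.Nodup.append ?_ (List.Nodup.append ?_ ?_ ?_) ?_)
    (Finset.nodup_toList _) ?_
  · refine nodup_flatMap_range (g := U.piece) fun i i' j j' hj hj' heq => ?_
    exact piece_inj (U := U) (by omega) (by omega) (by rw [heq])
  · refine nodup_flatMap_range (g := fun i j => U.rev (U.piece i j)) fun i i' j j' hj hj' heq => ?_
    exact piece_inj (U := U) (by omega) (by omega) (by rw [U.rev.injective heq])
  · refine nodup_flatMap_range (g := fun i j => U.next (U.piece i (j + 1)))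
      fun i i' j j' hj hj' heq => ?_
    have := next_piece_inj (U := U) (by omega) (by omega) heq
    exact ⟨this.1, by omega⟩
  · intro x hx hx'
    obtain ⟨i, -, hx⟩ := List.mem_flatMap.1 hx
    obtain ⟨i', -, hx'⟩ := List.mem_flatMap.1 hx'
    obtain ⟨j, hj, rfl⟩ := List.mem_map.1 hx
    obtain ⟨j', hj', heq⟩ := List.mem_map.1 hx'
    rw [List.mem_range] at hj hj'
    refine h.next_piece_mem_interior (i := i') (j := j' + 1) (by omega) (by omega) ?_
    rw [heq]
    exact isOuter_rev.2 (isOuter_piece (by omega))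
  · intro x hx hx'
    obtain ⟨i, -, hx⟩ := List.mem_flatMap.1 hx
    obtain ⟨j, hj, rfl⟩ := List.mem_map.1 hx
    rw [List.mem_range] at hj
    rcases List.mem_append.1 hx' with hx' | hx' <;> obtain ⟨i', -, hx'⟩ := List.mem_flatMap.1 hx' <;>
      obtain ⟨j', hj', heq⟩ := List.mem_map.1 hx' <;> rw [List.mem_range] at hj'
    · exact h.piece_ne_rev_piece (by omega) (by omega) heq.symm
    · refine h.next_piece_mem_interior (i := i') (j := j' + 1) (by omega) (by omega) ?_
      rw [heq]
      exact isOuter_piece (by omega)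
  · intro x hx hx'
    rw [innerList, Finset.mem_toList, Finset.mem_filter] at hx'
    exact hx'.2 hx

theorem length_dartList : U.dartList.length = U.darts := by
  rw [← List.toFinset_card_of_nodup h.nodup_dartList,
    Finset.eq_univ_iff_forall.2 fun x => List.mem_toFinset.2 (U.mem_dartList x), Finset.card_univ,
    Fintype.card_fin]

/-- What remains is interior and leaves from a vertex off the boundary, hence is a tree dart. -/
theorem length_innerList_le : U.innerList.length ≤ Nat.card {x // U.IsTreeDart x} := by
  classical
  rw [innerList, Finset.length_toList, Nat.card_eq_fintype_card, Fintype.card_subtype]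
  refine Finset.card_le_card fun x hx => ?_
  rw [Finset.mem_filter] at hx ⊢
  have hint : x ∈ U.interior := by
    intro hout
    obtain ⟨i, j, hj, rfl | rfl⟩ := hout.cases
    · exact hx.2 (piece_mem_boundaryList hj)
    · exact hx.2 (rev_piece_mem_boundaryList hj)
  refine ⟨Finset.mem_univ _, hint, fun ⟨⟨i, hi⟩, _⟩ => ?_⟩
  obtain ⟨j, hj1, hj, rfl⟩ := h.eq_next_piece hint hi
  exact hx.2 (next_piece_mem_boundaryList hj1 hj)

theorem darts_le {c : ℕ} (hc : ∀ i, U.cross i ≤ c) :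
    U.darts ≤ 3 * (N * (c + 1)) + Nat.card {x // U.IsTreeDart x} := by
  have key : ∀ f : Fin N → ℕ, (∀ i, f i ≤ c + 1) → ((List.finRange N).map f).sum ≤ N * (c + 1) := by
    intro f hf
    refine (List.sum_le_card_nsmul _ (c + 1) ?_).trans (by simp)
    simpa using hf
  have h1 := key (fun i => (U.sidePieces i).length) fun i => by simpa [sidePieces] using hc i
  have h2 := key (fun i => (U.revPieces i).length) fun i => by simpa [revPieces] using hc i
  have h3 := key (fun i => (U.spokes i).length) fun i => by
    simpa [spokes] using (hc i).trans (Nat.le_succ c)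
  have h4 := h.length_innerList_le
  have h5 := h.length_dartList
  simp only [dartList, boundaryList, List.length_append, List.length_flatMap] at h5
  omega

/-- The position of a dart in the list of all darts. -/
noncomputable def position : Equiv.Perm (Fin U.darts) :=
  Equiv.ofBijective
    (fun x => ⟨U.dartList.idxOf x, by
      have := List.idxOf_lt_length_of_mem (U.mem_dartList x)
      rwa [h.length_dartList] at this⟩)
    (Finite.injective_iff_bijective.1 fun x y hxy =>
      (List.idxOf_inj (U.mem_dartList x)).1 (congrArg Fin.val hxy))

theorem position_apply (x) : (h.position x : ℕ) = U.dartList.idxOf x := rfl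

/-- The topology with renamed darts. -/
noncomputable def renamed : PreTopology N where
  darts := U.darts
  next := h.position.symm.trans (U.next.trans h.position)
  rev := h.position.symm.trans (U.rev.trans h.position)
  corner i := h.position (U.corner i)
  cross := U.cross

theorem isRenaming_renamed : IsRenaming h.renamed U.toPre h.position.symm where
  next _ := h.position.symm_apply_apply _
  rev _ := h.position.symm_apply_apply _
  corner _ := h.position.symm_apply_apply _
  cross _ := rfl

/-- The dart with new number `n` is the `n`-th member of `dartList`, so the table of the conjugate
of `f` is read off along that list. -/
theorem ofFn_position (f : Equiv.Perm (Fin U.darts)) :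
    (List.ofFn fun y => (h.position.symm.trans (f.trans h.position) y : ℕ)) =
      U.dartList.map fun x => U.dartList.idxOf (f x) := by
  refine List.ext_getElem (by simp [h.length_dartList]) fun n hn hn' => ?_
  rw [List.length_ofFn] at hn
  rw [List.getElem_ofFn, List.getElem_map, Equiv.trans_apply, Equiv.trans_apply, position_apply]
  congr 2
  rw [Equiv.symm_apply_eq]
  refine Fin.ext ?_
  rw [position_apply, h.nodup_dartList.idxOf_getElem]

section

variable {M : ℕ} (hM : U.darts < M)
include hM

theorem hasRuns_of_infix {s : List (Fin U.darts)} (hs : s <:+: U.dartList) :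
    HasRuns M 1 (s.map fun x => U.dartList.idxOf x) := by
  obtain ⟨a, ha, hle⟩ := map_idxOf_infix h.nodup_dartList hs
  rw [h.length_dartList] at hle
  rw [ha]
  exact HasRuns.range' (by omega) (by omega)

theorem idxOf_lt (x) : U.dartList.idxOf x < M := (h.position x).2.trans hM

theorem hasRuns_inner (hM1 : 1 < M) (f : Equiv.Perm (Fin U.darts)) :
    HasRuns M (Nat.card {x // U.IsTreeDart x})
      (U.innerList.map fun x => U.dartList.idxOf (f x)) := by
  refine (HasRuns.of_lt (fun v hv => ?_) hM1).mono ((List.length_map _).trans_le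
    h.length_innerList_le)
  obtain ⟨x, -, rfl⟩ := List.mem_map.1 hv
  exact h.idxOf_lt hM _

/-- On each side, `next` takes the first piece to a single dart and the other pieces in order to the
spokes; the reversed pieces to the pieces shifted by one, the last to the following corner; the
spokes to the reversed pieces. This makes 2 + 2 + 1 intervals; the inner darts are listed singly. -/
theorem hasRuns_next (hM1 : 1 < M) :
    HasRuns M (5 * N + Nat.card {x // U.IsTreeDart x})
      (U.dartList.map fun x => U.dartList.idxOf (U.next x)) := by
  have h1 := HasRuns.flatMap_finRange (c := fun _ => 1 + 1) (f := U.sidePieces)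
    (g := fun x => U.dartList.idxOf (U.next x)) fun i => by
      have := (HasRuns.singleton (h.idxOf_lt hM (U.next (U.corner i))) hM1).append
        (h.hasRuns_of_infix hM (U.spokes_infix i))
      rw [sidePieces, List.range_succ_eq_map]
      simpa [spokes, Function.comp_def, piece_zero] using this
  have h2 := HasRuns.flatMap_finRange (c := fun _ => 1 + 1) (f := U.revPieces)
    (g := fun x => U.dartList.idxOf (U.next x)) fun i => by
      have := (h.hasRuns_of_infix hM
        ((List.tail_suffix _).isInfix.trans (U.sidePieces_infix i))).append
        (HasRuns.singleton (h.idxOf_lt hM (U.piece i (U.cross i + 1))) hM1)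
      rw [sidePieces, List.range_succ_eq_map] at this
      rw [revPieces, List.range_succ]
      simpa [Function.comp_def, piece_succ] using this
  have h3 := HasRuns.flatMap_finRange (c := fun _ => 1) (f := U.spokes)
    (g := fun x => U.dartList.idxOf (U.next x)) fun i => by
      have := h.hasRuns_of_infix hM (s := (List.range (U.cross i)).map fun j => U.rev (U.piece i j))
        (List.IsInfix.trans ⟨[], [U.rev (U.piece i (U.cross i))], by
          rw [revPieces, List.range_succ]; simp⟩ (U.revPieces_infix i))
      rw [spokes, List.map_map]
      rw [List.map_map] at this
      refine (congrArg (HasRuns M 1) (List.map_congr_left fun j hj => ?_)).mp this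
      simp only [Function.comp]
      rw [h.next_next_piece (by simpa using hj)]
  have h4 := (h1.append (h2.append h3)).append (h.hasRuns_inner hM hM1 U.next)
  simp only [← List.map_append] at h4
  refine HasRuns.mono h4 ?_
  simp
  omega

open Classical in
-- At a regular pair the far ends of the two arcs are successive spokes in the opposite order, so
-- the position drops by one and the decreasing interval goes on. Breaks occur only at irregular
-- pairs.
theorem hasRuns_rev_spokes (i : Fin N) :
    HasRuns M (1 + ((Finset.range (U.cross i)).filter fun j => 1 ≤ j ∧ ¬ U.IsRegular i j).card)
      ((U.spokes i).map fun x => U.dartList.idxOf (U.rev x)) := by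
  rw [spokes, List.map_map]
  have hlen : U.cross i < M := by
    have := (U.spokes_infix i).length_le
    rw [h.length_dartList, spokes, List.length_map, List.length_range] at this
    omega
  refine (HasRuns.of_breaks_map (fun j _ => h.idxOf_lt hM _) hlen).mono
    (Nat.add_le_add_left ?_ 1)
  have hidx : ∀ i, ∃ a, ∀ j < U.cross i, U.dartList.idxOf (U.next (U.piece i (j + 1))) = a + j := by
    intro i
    obtain ⟨a, ha, -⟩ := map_idxOf_infix h.nodup_dartList (U.spokes_infix i)
    refine ⟨a, fun j hj => ?_⟩
    have := congrArg (fun l => l[j]?) ha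
    simpa [spokes, hj] using this
  -- Entry `j` of the list belongs to crossing point `j + 1`, hence the shift.
  refine (show _ = ((Finset.range (U.cross i - 1)).filter _).card from rfl).trans_le
    (Finset.card_le_card_of_injOn (· + 1) (fun j hj => ?_) (by simp [Set.InjOn]))
  rw [Finset.mem_coe, Finset.mem_filter, Finset.mem_range] at hj ⊢
  refine ⟨Nat.add_lt_of_lt_sub hj.1, Nat.le_add_left 1 j, ?_⟩
  rintro ⟨i', j', hj1, hj2, e1, e2⟩
  obtain ⟨j', rfl⟩ : ∃ l, j' = l + 1 := ⟨j' - 1, by omega⟩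
  obtain ⟨a, ha⟩ := hidx i'
  refine absurd hj.2 ?_
  simp only [e1, e2, ha j' (by omega), ha (j' + 1) (by omega)]
  simp
  omega

/-- `rev` exchanges pieces and reversed pieces, which costs `2 * N` intervals. The spokes cost `N`
plus the `12 * N` and ten times the tree darts of `card_not_isRegular`, and the inner darts once
more the tree darts. -/
theorem hasRuns_rev (harcs : U.ArcsConnectSides) (hM1 : 1 < M) :
    HasRuns M (15 * N + 11 * Nat.card {x // U.IsTreeDart x})
      (U.dartList.map fun x => U.dartList.idxOf (U.rev x)) := by
  classical
  have h1 := HasRuns.flatMap_finRange (c := fun _ => 1) (f := U.sidePieces)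
    (g := fun x => U.dartList.idxOf (U.rev x)) fun i => by
      simpa [sidePieces, revPieces, Function.comp_def] using
        h.hasRuns_of_infix hM (U.revPieces_infix i)
  have h2 := HasRuns.flatMap_finRange (c := fun _ => 1) (f := U.revPieces)
    (g := fun x => U.dartList.idxOf (U.rev x)) fun i => by
      simpa [sidePieces, revPieces, Function.comp_def, U.rev_rev] using
        h.hasRuns_of_infix hM (U.sidePieces_infix i)
  have h3 := HasRuns.flatMap_finRange (f := U.spokes) (h.hasRuns_rev_spokes hM)
  have h4 := (h1.append (h2.append h3)).append (h.hasRuns_inner hM hM1 U.rev)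
  simp only [← List.map_append] at h4
  refine HasRuns.mono h4 ?_
  have := h.card_not_isRegular harcs
  rw [Finset.card_sigma] at this
  rw [Finset.sum_add_distrib]
  simp only [Finset.sum_const, Finset.card_univ, Fintype.card_fin, smul_eq_mul, mul_one]
  convert_to _ + (_ + (_ + ∑ i : Fin N, ((Finset.range (U.cross i)).filter fun j =>
    1 ≤ j ∧ ¬ U.IsRegular i j).card)) + _ ≤ _
  omega

end

/-- After a renaming of the darts, the tables of the topology consist of few intervals. -/
theorem exists_same (harcs : U.ArcsConnectSides) {M : ℕ} (hM : U.darts < M) (hM1 : 1 < M)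
    (hc : ∀ i, U.cross i < M) : ∃ V : Topology N, V.Same U ∧ ∀ t ∈ V.toPre.tables,
      HasRuns M (15 * N + 11 * Nat.card {x // U.IsTreeDart x}) t := by
  have hr := h.isRenaming_renamed
  refine ⟨(hr.isTopology U.isTopology_toPre).toTopology,
    ⟨h.position.symm, hr.next, hr.rev, hr.corner, hr.cross⟩, ?_⟩
  show ∀ t ∈ h.renamed.tables, _
  simp only [PreTopology.tables, List.forall_mem_cons, List.not_mem_nil, false_imp_iff,
    implies_true, and_true]
  refine ⟨?_, ?_, ?_, ?_⟩
  · exact (h.ofFn_position U.next).symm ▸ (h.hasRuns_next hM hM1).mono (by omega)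
  · exact (h.ofFn_position U.rev).symm ▸ h.hasRuns_rev hM harcs hM1
  · refine (HasRuns.of_lt (fun v hv => ?_) hM1).mono ((List.length_ofFn).trans_le (by omega))
    obtain ⟨i, rfl⟩ := (List.mem_ofFn' _ _).1 hv
    exact h.idxOf_lt hM _
  · refine (HasRuns.of_lt (fun v hv => ?_) hM1).mono ((List.length_ofFn).trans_le (by omega))
    obtain ⟨i, rfl⟩ := (List.mem_ofFn' _ _).1 hv
    exact hc i

end BoundaryDegrees

end Topology


/-! ## The enumeration of the valid topologies -/

/-- The constants: there are N ≤ 2kn sides and at most 2bn tree darts, so 15N + 22bn ≤ 30kn + 22bn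
intervals arise once the 11 tree-dart multiples are counted as 11·2bn. The number of darts is at
most 3·2kn·(a + 1)n + 2bn by `darts_le`; the remaining terms of the first constant make it exceed
the crossing numbers and 1 as well. -/
theorem Instance.IsValid.exists_mem_candidates {I : Instance} {a b k : ℕ}
    {V : Topology (2 * I.K.edges)} (hV : I.IsValid a b V) (hn : 2 ≤ I.g + I.t)
    (hk : I.K.edges ≤ k * (I.g + I.t)) :
    ∃ U, I.IsValid a b U ∧ U.Same V ∧ U.toPre.tables ∈
      candidates ((6 * k * (a + 1) + 2 * b + a + 2) * ((I.g + I.t) * (I.g + I.t)))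
        ((30 * k + 22 * b + 1) * (I.g + I.t)) := by
  have hd : V.BoundaryDegrees :=
    ⟨hV.isOverlay.generalPosition.degree_corner, hV.isOverlay.generalPosition.degree_crossing⟩
  have hc := hV.isGood.cross_le
  have hT := hV.isGood.tree_le
  have hD := hd.darts_le hc
  generalize hn' : I.g + I.t = n at *
  have hnn : n ≤ n * n := Nat.le_mul_self n
  have hkn : 2 * I.K.edges * (a * n + 1) ≤ 2 * (k * n) * ((a + 1) * n) :=
    Nat.mul_le_mul (by omega) (by rw [Nat.add_mul]; omega)
  have hM : V.darts + a * n + 2 ≤ (6 * k * (a + 1) + 2 * b + a + 2) * (n * n) := by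
    have h1 : a * n ≤ a * (n * n) := Nat.mul_le_mul_left _ hnn
    have h2 : b * n ≤ b * (n * n) := Nat.mul_le_mul_left _ hnn
    calc V.darts + a * n + 2
        ≤ 3 * (2 * (k * n) * ((a + 1) * n)) + 2 * (b * (n * n)) + a * (n * n) + 2 * (n * n) := by
          omega
      _ = _ := by ring
  obtain ⟨U, hUV, hU⟩ := hd.exists_same hV.isGood.arcs
    (M := (6 * k * (a + 1) + 2 * b + a + 2) * (n * n)) (by omega) (by omega)
    fun i => (hc i).trans_lt (by omega)
  refine ⟨U, hV.of_same hUV, hUV, mem_candidates.2 ⟨rfl, fun t ht => ?_⟩⟩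
  refine ((hU t ht).mono ?_).mem_tableCandidates (by omega)
  calc 15 * (2 * I.K.edges) + 11 * Nat.card {x // V.IsTreeDart x}
      ≤ 30 * (k * n) + 22 * (b * n) + n := by omega
    _ = _ := by ring

theorem Instance.Enumerates.finite_and_ncard_le {I : Instance} {a b : ℕ}
    {L : List (Topology (2 * I.K.edges))} (h : I.Enumerates a b L) :
    (I.validTopologies a b).Finite ∧ (I.validTopologies a b).ncard ≤ L.length := by
  classical
  have hsub : I.validTopologies a b ⊆
      ((L.map fun U => Quotient.mk (Topology.setoid (2 * I.K.edges)) U).toFinset : Set _) := by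
    rintro _ ⟨V, hV, rfl⟩
    obtain ⟨U, hU, hUV⟩ := h.complete V hV
    rw [List.coe_toFinset]
    exact List.mem_map.2 ⟨U, hU, Quotient.sound hUV⟩
  refine ⟨(Finset.finite_toSet _).subset hsub,
    (Set.ncard_le_ncard hsub (Finset.finite_toSet _)).trans ?_⟩
  rw [Set.ncard_coe_finset]
  exact (List.toFinset_card_le _).trans_eq (List.length_map _)

/-- The input does not state the numbers of sides and terminals; they are recovered as lengths of
its tables. -/
theorem PT.length_ofFun {Γ : Type} {m : Γ → ℕ} {e : Γ → Data} {N : Γ → ℕ}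
    {f : ∀ γ, Fin (N γ) → Data} (hN : Bdd m N) (hf : PT m e fun γ => ofFun (f γ)) :
    PT m e fun γ => ofNat (N γ) :=
  (PT.length (α := fun _ => Data) (l := fun γ => List.ofFn (f γ)) (c := fun _ x => x)
    (hN.mono fun γ => by simp) (hf.congr fun γ => by simp [ofFun, Function.comp_def])).congr fun γ => by simp

/-- The instances in which the cut graph has few edges. -/
abbrev BoundedInstance (k : ℕ) : Type :=
  {I : Instance // 2 ≤ I.g + I.t ∧ I.K.edges ≤ k * (I.g + I.t)}

namespace BoundedInstance

variable {k : ℕ}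

/-- The measure of running times. -/
def size (I : BoundedInstance k) : ℕ := (I.1.g + I.1.t) ^ (I.1.g + I.1.t)

theorem bdd_param : Bdd (size (k := k)) fun I => I.1.g + I.1.t :=
  ⟨1, fun I => by
    have := Nat.le_self_pow (n := I.1.g + I.1.t) (by have := I.2.1; omega) (I.1.g + I.1.t)
    rw [pow_one]
    exact this.trans (Nat.le_add_right _ _)⟩

/-- As n ≥ 2, C ≤ 2^C ≤ n^C, whence C^n ≤ (n^n)^C. -/
theorem bdd_pow (C : ℕ) : Bdd (size (k := k)) fun I => C ^ (I.1.g + I.1.t) :=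
  ⟨C, fun I => calc
    C ^ (I.1.g + I.1.t) ≤ ((I.1.g + I.1.t) ^ C) ^ (I.1.g + I.1.t) :=
      Nat.pow_le_pow_left (Nat.lt_two_pow_self.le.trans (Nat.pow_le_pow_left I.2.1 C)) _
    _ = size I ^ C := by rw [size, ← pow_mul, ← pow_mul, mul_comm]
    _ ≤ (size I + 2) ^ C := Nat.pow_le_pow_left (Nat.le_add_right _ _) C⟩

/-- The number is ((2c²)^d)^n · (n^n)^{4d}: an exponential in n times a power of the measure. -/
theorem bdd_numCandidates (c d : ℕ) : Bdd (size (k := k)) fun I =>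
    (2 * (c * ((I.1.g + I.1.t) * (I.1.g + I.1.t))) ^ 2) ^ (d * (I.1.g + I.1.t)) := by
  have hself : Bdd (size (k := k)) fun I => (I.1.g + I.1.t) ^ (I.1.g + I.1.t) :=
    ⟨1, fun I => by rw [size, pow_one]; exact Nat.le_add_right _ _⟩
  refine ((bdd_pow ((2 * c ^ 2) ^ d)).mul (hself.pow (4 * d))).mono fun I => le_of_eq ?_
  generalize I.1.g + I.1.t = n
  rw [← pow_mul, ← pow_mul, show n * (4 * d) = 4 * (d * n) by ring, pow_mul n 4, ← mul_pow]
  congr 1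
  ring

/-- Since the measure s = n^n is at least 2, s + 2 ≤ s², and powers of s are of the form n^{cn}. -/
theorem exists_bound {f : BoundedInstance k → ℕ} (hf : Bdd size f) :
    ∃ c, ∀ I, f I ≤ (I.1.g + I.1.t) ^ (c * (I.1.g + I.1.t)) := by
  obtain ⟨c, hc⟩ := hf
  refine ⟨2 * c, fun I => (hc I).trans ?_⟩
  have h2 : 2 ≤ size I := I.2.1.trans (Nat.le_self_pow (by have := I.2.1; omega) _)
  calc (size I + 2) ^ c ≤ (size I ^ 2) ^ c := Nat.pow_le_pow_left (by nlinarith) c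
    _ = _ := by rw [size, ← pow_mul, ← pow_mul]; congr 1; ring

theorem hasInst : HasInst (size (k := k)) (fun I => I.1.encode) fun I => I.1 := by
  have h : PT (size (k := k)) (fun I => I.1.encode) fun I =>
      cons (ofNat I.1.g) (cons (ofFun fun i => ofNat (I.1.K.mate i))
        (cons (ofFun fun i => ofBool (I.1.K.twist i)) (cons (ofFun fun a => ofNat (I.1.terminal a))
          (cons (ofFun fun a => ofFun fun b => ofBool (decide (s(a, b) ∈ I.1.pairs))) nil)))) :=
    PT.id
  have hsides : Bdd (size (k := k)) fun I => 2 * I.1.K.edges :=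
    ((Bdd.const 2).mul ((Bdd.const k).mul bdd_param)).mono fun I => Nat.mul_le_mul_left 2 I.2.2
  have hterm : Bdd (size (k := k)) fun I => I.1.t := bdd_param.mono fun I => Nat.le_add_left _ _
  exact
    { bdd_sides := hsides
      sides := PT.length_ofFun hsides h.tl.hd
      bdd_terminals := hterm
      terminals := PT.length_ofFun hterm h.tl.tl.tl.hd
      bdd_genus := bdd_param.mono fun I => Nat.le_add_right _ _
      genus := h.hd
      mate := h.tl.hd
      twist := h.tl.tl.hd
      terminal := h.tl.tl.tl.hd
      pairs := h.tl.tl.tl.tl.hd }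

theorem exists_program (k a b : ℕ) : ∃ (A : ℕ) (P : Prog), ∀ I : BoundedInstance k,
    (I.1.validTopologies a b).Finite ∧
    (I.1.validTopologies a b).ncard ≤ (I.1.g + I.1.t) ^ (A * (I.1.g + I.1.t)) ∧
    ∃ L, I.1.Enumerates a b L ∧ ∃ n ≤ (I.1.g + I.1.t) ^ (A * (I.1.g + I.1.t)),
      Run P I.1.encode (ofList (L.map Topology.encode)) n := by
  have hI := hasInst (k := k)
  have hn : PT (size (k := k)) (fun I => I.1.encode) fun I => ofNat (I.1.g + I.1.t) :=
    PT.natAdd hI.bdd_terminals hI.genus hI.terminals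
  have hbn := bdd_param (k := k)
  have hnn := PT.natMul hbn hbn hn hn
  have hB := bdd_numCandidates (k := k) (6 * k * (a + 1) + 2 * b + a + 2) (30 * k + 22 * b + 1)
  obtain ⟨L, hL, hlen, P, T, hT, hrun⟩ := exists_enumeration hI a b
    ((Bdd.const _).mul (hbn.mul hbn)) (PT.natMul (Bdd.const _) (hbn.mul hbn) (PT.natConst _) hnn)
    ((Bdd.const _).mul hbn) (PT.natMul (Bdd.const _) hbn (PT.natConst _) hn) hB
    fun I V hV => hV.exists_mem_candidates I.2.1 I.2.2
  obtain ⟨A, hA⟩ := exists_bound ((hB.pow 4).add hT)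
  refine ⟨A, P, fun I => ?_⟩
  obtain ⟨hfin, hcard⟩ := (hL I).finite_and_ncard_le
  obtain ⟨n, hnT, hr⟩ := hrun I
  exact ⟨hfin, hcard.trans ((hlen I).trans ((Nat.le_add_right _ _).trans (hA I))), L I, hL I, n,
    hnT.trans ((Nat.le_add_left _ _).trans (hA I)), hr⟩

end BoundedInstance

end Multicut

theorem mainTheorem4 (k a b : ℕ) :
    ∃ (A : ℕ) (P : Multicut.Prog), ∀ I : Multicut.Instance,
      2 ≤ I.g + I.t → I.K.edges ≤ k * (I.g + I.t) →
        (I.validTopologies a b).Finite ∧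
        (I.validTopologies a b).ncard ≤ (I.g + I.t) ^ (A * (I.g + I.t)) ∧
        ∃ L : List (Multicut.Topology (2 * I.K.edges)), I.Enumerates a b L ∧
          ∃ n ≤ (I.g + I.t) ^ (A * (I.g + I.t)),
            Multicut.Run P I.encode
              (Multicut.Data.ofList (L.map Multicut.Topology.encode)) n := by
  obtain ⟨A, P, h⟩ := Multicut.BoundedInstance.exists_program k a b
  exact ⟨A, P, fun I h2 hk => h ⟨I, h2, hk⟩⟩
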